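/- **Setting.** Let $Y,U$ be separable complex Hilbert spaces. Let $A:\mathcal D(A)\subseteq Y\to Y$ generate a strongly continuous semigroup $e^{At}$ on $Y$ with $\|e^{At}\|\le Me^{-\omega t}$ for all $t\ge 0$, for some $M\ge1$, $\omega>0$. For $\alpha>0$ write $A^\alpha$ and ${A^*}^\alpha$ for the fractional powers $(-A)^\alpha$ and $(-A^*)^\alpha$, and give domains of operators the graph norm. Duals are taken with pivot space $Y$. Let $B:U\to[\mathcal D(A^*)]'$ be a bounded linear operator, with adjoint $B^*:\mathcal D(A^*)\to U$. Assume that $$B^*e^{A^*t}x=F(t)x+G(t)x\qquad (t>0,\ x\in\mathcal D(A^*)),$$ where $F(t):Y\to U$ and $G(t):\mathcal D(A^*)\to U$, $t>0$, are bounded linear operators such that * there are $\gamma\in(0,1)$ and $\eta,N>0$ with $\|F(t)\|_{\mathcal L(Y,U)}\le N t^{-\gamma}e^{-\eta t}$ for all $t>0$; * there is $T>0$ such that $G(\cdot)$ extends to an element of $\mathcal L(Y,L^p(0,T;U))$ for every $p\in[1,\infty)$; * there are $T>0$, $\epsilon>0$ and $q\in(1,2)$ such that $G(\cdot){A^*}^{-\epsilon}$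 extends to an element of $\mathcal L(Y,C([0,T];U))$, and $B^*e^{A^*\cdot}{A^*}^{\epsilon}$, defined on $\mathcal D({A^*}^{1+\epsilon})$, extends to an element of $\mathcal L(Y,L^q(0,T;U))$. Define $$L^*v(s)=\int_s^\infty B^*e^{A^*(t-s)}v(t)\,dt,\qquad s\ge0,$$ for $\mathcal D(A^*)$-valued $v$. **Proposition 2.7.** The following hold. 1. $L^*$ maps $L^1(0,\infty;Y)$ continuously into $L^r(0,\infty;U)$ for each $r\in[1,\frac1\gamma)$. 2. $L^*$ maps $L^p(0,\infty;Y)$ continuously into $L^r(0,\infty;U)$ for each $p\in(1,\frac1{1-\gamma})$ and $r\in\big[p,\frac{p}{1-(1-\gamma)p}\big]$. 3. $L^*$ maps $L^p(0,\infty;Y)$ continuously into $L^r(0,\infty;U)$ for each $p\in[\frac1{1-\gamma},\infty)$ and $r\in[p,\infty)$. 4. $L^*$ maps $L^p(0,\infty;\mathcal D({A^*}^\epsilon))$ continuously into $L^\infty(0,\infty;U)$ for each $p\in(\frac1{1-\gamma},\infty]$. 5. $L^*$ maps $L^1(0,\infty;[\mathcal D(A^\epsilon)]')$ continuously into $L^r(0,\infty;U)$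 for each $r\in[1,q]$. In 1, 2, 3 and 5, with $X=Y$ or $X=[\mathcal D(A^\epsilon)]'$ (and $p=1$ in 1 and 5), this means that the operator given by the formula on the dense subspace $L^p(0,\infty;\mathcal D(A^*))$ of $L^p(0,\infty;X)$ extends to a (unique) continuous linear operator from $L^p(0,\infty;X)$ to $L^r(0,\infty;U)$. In 4 it means that each $B^*e^{A^*t}$, $t>0$, has a bounded extension $K(t)$ to $\mathcal D({A^*}^\epsilon)$, and that $L^*v(s)=\int_s^\infty K(t-s)v(t)\,dt$, with an absolutely convergent integral for a.e. $s>0$, defines a continuous linear operator from $L^p(0,\infty;\mathcal D({A^*}^\epsilon))$ to $L^\infty(0,\infty;U)$. -/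

import Mathlib

open MeasureTheory Set Filter Topology
open scoped ENNReal InnerProductSpace

namespace BoundaryControl

noncomputable section

/-! ## Strongly continuous semigroups, generators, fractional powers -/

section Semigroup

variable {Y : Type*} [NormedAddCommGroup Y] [InnerProductSpace ℂ Y]

/-- `S` restricted to `[0, ∞)` is a strongly continuous semigroup of bounded operators.  The values
of `S` at negative times are irrelevant. -/
structure IsC0Semigroup (S : ℝ → Y →L[ℂ] Y) : Prop where
  map_zero : S 0 = ContinuousLinearMap.id ℂ Y
  map_add : ∀ s t : ℝ, 0 ≤ s → 0 ≤ t → S (s + t) = (S s).comp (S t)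
  continuousOn : ∀ x : Y, ContinuousOn (fun t => S t x) (Ici 0)

/-- `‖S t‖ ≤ M e^{-ω t}` for all `t ≥ 0`, with some `M ≥ 1` and `ω > 0`. -/
def IsExpStable (S : ℝ → Y →L[ℂ] Y) : Prop :=
  ∃ M ω : ℝ, 1 ≤ M ∧ 0 < ω ∧ ∀ t : ℝ, 0 ≤ t → ‖S t‖ ≤ M * Real.exp (-(ω * t))

/-- The (unbounded) operator `A` is the infinitesimal generator of `S`: one has `x ∈ D(A)` and
`A x = y` if and only if `(S t x - x) / t → y` as `t → 0+`. -/
def IsGenerator (A : Y →ₗ.[ℂ] Y) (S : ℝ → Y →L[ℂ] Y) : Prop :=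
  ∀ x y : Y, (x, y) ∈ A.graph ↔
    Tendsto (fun t : ℝ => t⁻¹ • (S t x - x)) (𝓝[>] 0) (𝓝 y)

/-- The adjoint semigroup `e^{A^* t} = (e^{A t})^*`. -/
def adjSemigroup [CompleteSpace Y] (S : ℝ → Y →L[ℂ] Y) : ℝ → Y →L[ℂ] Y :=
  fun t => ContinuousLinearMap.adjoint (S t)

/-- The negative power `(-A)^{-α} x = Γ(α)⁻¹ ∫₀^∞ t^{α-1} S(t) x dt` of minus the generator `A` of
`S`, on the space of those `x` for which the integral converges absolutely (this is all of `Y` when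
`S` is exponentially stable and `α > 0`). -/
def negPow (S : ℝ → Y →L[ℂ] Y) (α : ℝ) : Y →ₗ.[ℂ] Y where
  domain :=
    { carrier := {x | IntegrableOn (fun t : ℝ => t ^ (α - 1) • S t x) (Ioi 0)}
      add_mem' := fun {x y} hx hy => by
        change IntegrableOn (fun t : ℝ => t ^ (α - 1) • S t (x + y)) (Ioi 0)
        simp only [map_add, smul_add]
        exact Integrable.add hx hy
      zero_mem' := by simp
      smul_mem' := fun c x hx => by
        have h := Integrable.smul c hx
        change IntegrableOn (fun t : ℝ => t ^ (α - 1) • S t (c • x)) (Ioi 0)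
        simp only [map_smul]
        refine h.congr (Eventually.of_forall fun t => ?_)
        exact smul_comm c (t ^ (α - 1)) (S t x) }
  toFun :=
    { toFun := fun x => (Real.Gamma α)⁻¹ • ∫ t in Ioi (0 : ℝ), t ^ (α - 1) • S t (x : Y)
      map_add' := fun x y => by
        rw [← smul_add, ← integral_add x.2 y.2]
        congr 2
        funext t
        change t ^ (α - 1) • S t ((x : Y) + (y : Y)) = _
        rw [map_add, smul_add]
      map_smul' := fun c x => by
        rw [RingHom.id_apply, smul_comm c, ← integral_smul c]
        congr 2
        funext t
        change t ^ (α - 1) • S t (c • (x : Y)) = _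
        rw [map_smul]
        exact smul_comm (t ^ (α - 1)) c (S t (x : Y)) }

/-- The fractional power `(-A)^α` of minus the generator `A` of `S`: the inverse of the (injective)
operator `(-A)^{-α}`, with domain the range of the latter. -/
def fracPow (S : ℝ → Y →L[ℂ] Y) (α : ℝ) : Y →ₗ.[ℂ] Y := (negPow S α).inverse

/-- The domain of an unbounded operator `C` with the graph norm, realized as the graph of `C`: its
elements are the pairs `(x, C x)` with `x ∈ D(C)`, and the norm is `max ‖x‖ ‖C x‖`. -/
abbrev Dom (C : Y →ₗ.[ℂ] Y) : Type _ := C.graph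

/-- The continuous inclusion `D(C) → Y`. -/
def Dom.val (C : Y →ₗ.[ℂ] Y) : Dom C →L[ℂ] Y :=
  (ContinuousLinearMap.fst ℂ Y Y).comp C.graph.subtypeL

/-- The operator `C` itself, as a continuous map `D(C) → Y`. -/
def Dom.op (C : Y →ₗ.[ℂ] Y) : Dom C →L[ℂ] Y :=
  (ContinuousLinearMap.snd ℂ Y Y).comp C.graph.subtypeL

lemma Dom.op_eq (C : Y →ₗ.[ℂ] Y) (z : Dom C) :
    Dom.op C z = C ⟨Dom.val C z, LinearPMap.mem_domain_of_mem_graph z.2⟩ :=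
  C.mem_graph_snd_inj z.2 (C.mem_graph ⟨_, LinearPMap.mem_domain_of_mem_graph z.2⟩) rfl

/-- The space `X'` of continuous conjugate-linear functionals on `X`. -/
abbrev AntiDual (X : Type*) [NormedAddCommGroup X] [NormedSpace ℂ X] : Type _ := X →L⋆[ℂ] ℂ

/-- The inclusion `Y → [D(C)]'` given by the inner product of the pivot space `Y`. -/
def pivot (C : Y →ₗ.[ℂ] Y) : Y →L[ℂ] AntiDual (Dom C) :=
  ((innerSL ℂ : Y →L⋆[ℂ] Y →L[ℂ] ℂ).comp (Dom.val C)).flip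

lemma pivot_apply (C : Y →ₗ.[ℂ] Y) (y : Y) (z : Dom C) :
    pivot C y z = ⟪Dom.val C z, y⟫_ℂ := rfl

end Semigroup

/-! ## The control operator and the operators `B^* e^{A^* t}` -/

section Control

variable {Y U : Type*} [NormedAddCommGroup Y] [InnerProductSpace ℂ Y]
  [NormedAddCommGroup U] [InnerProductSpace ℂ U] [CompleteSpace U]

/-- The adjoint `B^* : D(C) → U` of a bounded operator `B : U → [D(C)]'`. -/
def adjControl {C : Y →ₗ.[ℂ] Y} (B : U →L[ℂ] AntiDual (Dom C)) : Dom C →L[ℂ] U :=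
  ((InnerProductSpace.toDual ℂ U).symm.toContinuousLinearEquiv.toContinuousLinearMap).comp B.flip

lemma inner_adjControl {C : Y →ₗ.[ℂ] Y} (B : U →L[ℂ] AntiDual (Dom C)) (x : Dom C) (u : U) :
    ⟪adjControl B x, u⟫_ℂ = B u x := by
  simp [adjControl]

variable [CompleteSpace Y]

open Classical in
/-- `B^* e^{A^* t} x`, for `x` with `e^{A^* t} x ∈ D(A^*)` (in particular for all `x ∈ D(A^*)`, see
`adjSemigroup_mem_domain`); the value for other `x` is irrelevant. -/
def obs (A : Y →ₗ.[ℂ] Y) (S : ℝ → Y →L[ℂ] Y) (B : U →L[ℂ] AntiDual (Dom A.adjoint)) (t : ℝ)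
    (x : Y) : U :=
  if h : adjSemigroup S t x ∈ A.adjoint.domain then
    adjControl B ⟨(adjSemigroup S t x, A.adjoint ⟨adjSemigroup S t x, h⟩),
      A.adjoint.mem_graph ⟨adjSemigroup S t x, h⟩⟩
  else 0

/-- `e^{A^* t}` maps `D(A^*)` into itself. -/
lemma adjSemigroup_mem_domain {A : Y →ₗ.[ℂ] Y} {S : ℝ → Y →L[ℂ] Y} (hS : IsC0Semigroup S)
    (hA : IsGenerator A S) {t : ℝ} (ht : 0 ≤ t) {x : Y} (hx : x ∈ A.adjoint.domain) :
    adjSemigroup S t x ∈ A.adjoint.domain := by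
  have key : ∀ u : A.domain, (S t u, S t (A u)) ∈ A.graph := by
    intro u
    rw [hA]
    have h := (hA _ _).1 (A.mem_graph u)
    have h2 := ((S t).continuous.tendsto _).comp h
    refine h2.congr' ?_
    filter_upwards [self_mem_nhdsWithin] with r hr
    have hr' : (0 : ℝ) ≤ r := le_of_lt hr
    have hc : S t (S r u) = S r (S t u) := by
      have h1 := hS.map_add t r ht hr'
      have h3 := hS.map_add r t hr' ht
      rw [add_comm, h3] at h1
      exact (DFunLike.congr_fun h1 (u : Y)).symm
    simp only [Function.comp_apply, ← hc]
    rw [(S t).map_smul_of_tower, map_sub]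
  rw [LinearPMap.mem_adjoint_domain_iff] at hx ⊢
  have hmem : ∀ u : A.domain, S t u ∈ A.domain := fun u =>
    LinearPMap.mem_domain_of_mem_graph (key u)
  have hcont : Continuous fun u : A.domain => (⟨S t u, hmem u⟩ : A.domain) :=
    ((S t).continuous.comp continuous_subtype_val).subtype_mk _
  refine (hx.comp hcont).congr fun u => ?_
  have hval : A ⟨S t u, hmem u⟩ = S t (A u) :=
    A.mem_graph_snd_inj (A.mem_graph ⟨S t u, hmem u⟩) (key u) rfl
  change ⟪x, A ⟨S t u, hmem u⟩⟫_ℂ = ⟪adjSemigroup S t x, A u⟫_ℂ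
  rw [hval, adjSemigroup, ContinuousLinearMap.adjoint_inner_left]

/-- The standing assumptions on the control system `y' = A y + B u`: `A` generates the exponentially
stable semigroup `S t = e^{A t}`, and `B^* e^{A^* t} = F t + G t` on `D(A^*)` for `t > 0`, where `F`
and `G` have the stated properties.  Below `(A^*)^α` is `fracPow (adjSemigroup S) α`. -/
structure Assumptions (A : Y →ₗ.[ℂ] Y) (S : ℝ → Y →L[ℂ] Y) (B : U →L[ℂ] AntiDual (Dom A.adjoint))
    (F : ℝ → Y →L[ℂ] U) (G : ℝ → Dom A.adjoint →L[ℂ] U) (γ ε q : ℝ) : Prop where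
  semigroup : IsC0Semigroup S
  generator : IsGenerator A S
  stable : IsExpStable S
  decomposition : ∀ t : ℝ, 0 < t → ∀ x : Dom A.adjoint,
    obs A S B t (Dom.val _ x) = F t (Dom.val _ x) + G t x
  gamma_mem : γ ∈ Ioo (0 : ℝ) 1
  F_bound : ∃ η N : ℝ, 0 < η ∧ 0 < N ∧
    ∀ t : ℝ, 0 < t → ‖F t‖ ≤ N * t ^ (-γ) * Real.exp (-(η * t))
  /-- `G` extends to an element of `L(Y, L^p(0, T; U))` for all finite `p ≥ 1`. -/
  G_Lp : ∃ T : ℝ, 0 < T ∧ ∀ p : ℝ, 1 ≤ p → ∃ _ : Fact (1 ≤ ENNReal.ofReal p),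
    ∃ G' : Y →L[ℂ] Lp U (ENNReal.ofReal p) (volume.restrict (Ioo 0 T)),
      ∀ x : Dom A.adjoint,
        G' (Dom.val _ x) =ᵐ[volume.restrict (Ioo 0 T)] fun t => G t x
  eps_pos : 0 < ε
  q_mem : q ∈ Ioo (1 : ℝ) 2
  /-- With one and the same `T > 0`: the operator `G (A^*)^{-ε}` extends to an element `H` of
  `L(Y, C([0, T]; U))`, and `B^* e^{A^* ·} (A^*)^ε`, defined on `D((A^*)^{1+ε})`, extends to an
  element `K` of `L(Y, L^q(0, T; U))`. -/
  eps_cond : ∃ T : ℝ, 0 < T ∧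
    (∃ H : Y →L[ℂ] C(Icc (0 : ℝ) T, U),
      ∀ t : Icc (0 : ℝ) T, 0 < (t : ℝ) →
        ∀ z : Dom (fracPow (adjSemigroup S) ε), ∀ x : Dom A.adjoint, Dom.val _ x = Dom.val _ z →
          H (Dom.op _ z) t = G t x) ∧
    (∃ _ : Fact (1 ≤ ENNReal.ofReal q),
      ∃ K : Y →L[ℂ] Lp U (ENNReal.ofReal q) (volume.restrict (Ioo 0 T)),
        ∀ x : Dom (fracPow (adjSemigroup S) (1 + ε)), ∀ z : Dom (fracPow (adjSemigroup S) ε),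
          Dom.val _ z = Dom.val _ x →
          K (Dom.val _ x) =ᵐ[volume.restrict (Ioo 0 T)] fun t =>
            obs A S B t (Dom.op _ z))

/-! ## The operator `L^*` -/

/-- Lebesgue measure on `(0, ∞)`. -/
def halfLine : Measure ℝ := volume.restrict (Ioi 0)

/-- `w s = ∫_s^∞ k (t - s) (v t) dt` for almost every `s > 0`, with absolutely convergent integrals.
With `k t = B^* e^{A^* t}` this says `w = L^* v`. -/
def IsBackwardConv {X : Type*} (k : ℝ → X → U) (v : ℝ → X) (w : ℝ → U) : Prop :=
  ∀ᵐ s ∂halfLine, IntegrableOn (fun t => k (t - s) (v t)) (Ioi s) ∧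
    w s = ∫ t in Ioi s, k (t - s) (v t)

/-- Let `J : D(A^*) → X` be a continuous inclusion with dense range and `p < ∞`.  The operator
`L^* v (s) = ∫_s^∞ B^* e^{A^* (t - s)} v(t) dt`, given by this formula on the dense subspace
`L^p(0, ∞; D(A^*))` of `L^p(0, ∞; X)`, has a (necessarily unique) extension to a continuous linear
operator from `L^p(0, ∞; X)` to `L^r(0, ∞; U)`. -/
def LStarMaps (A : Y →ₗ.[ℂ] Y) (S : ℝ → Y →L[ℂ] Y) (B : U →L[ℂ] AntiDual (Dom A.adjoint))
    {X : Type*} [NormedAddCommGroup X] [NormedSpace ℂ X] (J : Dom A.adjoint →L[ℂ] X)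
    (p r : ℝ≥0∞) : Prop :=
  ∃ (_ : Fact (1 ≤ p)) (_ : Fact (1 ≤ r)),
    ∃ Λ : Lp X p halfLine →L[ℂ] Lp U r halfLine,
      ∀ f : Lp (Dom A.adjoint) p halfLine,
        IsBackwardConv (fun t (x : Dom A.adjoint) => obs A S B t (Dom.val _ x)) f (Λ (J.compLp f))

end Control

end

end BoundaryControl

open BoundaryControl

/-! Write k(τ) = B^* e^{A^* τ} on D(A^*). By the decomposition, ‖k(τ)x‖ is at most N τ^{-γ} e^{-ητ}
‖x‖ plus an excess, and L^* is a backward convolution with k, so it suffices to bound ∫_s^∞ ‖k(t-s)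
v(t)‖ dt for the two contributions separately and then to extend by density.

The singular part is a scalar convolution. Young's inequality handles every pair (p, r) with γ < 1/r
+ 1 - 1/p, that is, (i), (iii) and the non-endpoint range of (ii). At the endpoint r = p / (1 -
(1-γ)p) the kernel only just fails to lie in the Lebesgue space that Young requires, and the
Hardy-Littlewood-Sobolev inequality takes over (`exists_hardy_littlewood_sobolev`).

The excess is not dominated by a scalar kernel: only its L^r norm in τ is controlled by ‖x‖. Near 0
this comes from G. Away from 0 it comes from k(τ+σ) = k(τ) e^{A^* σ}: an L^r bound for k over one
period is carried along by exponential decay and summed as a geometric series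
(`exists_lintegral_Ioi_le_of_period`). The result is an exponentially weighted L^r bound, and the
Schur test `lintegral_rpow_lintegral_mul_le` turns it into an L^p to L^r bound for every p ≤ r, the
weight paying for the Hölder step. The two parts are joined in `exists_lintegral_conv_le`.

For (v) the extension of k (A^*)^ε gives an L^q bound of k(·)x near 0 by ‖(A^*)^{-ε} x‖, a quantity
dominated by the norm of x in [D(A^ε)]'. The same machinery then runs with no singular part. For
(iv) the extension K(t) is F(t) + H(·)(t) (A^*)^ε up to time T, followed by the semigroup; its norm
is at most a multiple of (t^{-γ} + 1) e^{-ωt}, so Hölder's inequality in t suffices.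

The operator theory needed is that (-A)^{-a} is bounded and injective, obeys the law of exponents
through the Beta integral, and has as adjoint the corresponding power for the adjoint semigroup,
which is itself strongly continuous. -/

namespace BoundaryControl

noncomputable section

/-! ## Integral operators with nonnegative kernels -/

section Kernels

/-- A Schur test from `L^p` to `L^r`: the kernel `φ₁` is uniformly in `L^r` in the outer variable and
`φ₂` acts on `L^p` uniformly in the outer variable. -/
lemma lintegral_rpow_lintegral_mul_le {α β : Type*} [MeasurableSpace α] [MeasurableSpace β]
    {μ : Measure α} {ν : Measure β} [SFinite μ] [SFinite ν] {p r : ℝ} (hp : 1 ≤ p) (hpr : p ≤ r)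
    {a : β → ℝ≥0∞} (ha : Measurable a) {φ₁ φ₂ : α → β → ℝ≥0∞}
    (hφ₁ : Measurable (Function.uncurry φ₁)) {C₁ C₂ : ℝ≥0∞}
    (h₁ : ∀ t, ∫⁻ s, φ₁ s t ^ r ∂μ ≤ C₁)
    (h₂ : ∀ s, ∀ b : β → ℝ≥0∞, Measurable b →
      ∫⁻ t, b t * φ₂ s t ∂ν ≤ C₂ * (∫⁻ t, b t ^ p ∂ν) ^ (1 / p)) :
    (∫⁻ s, (∫⁻ t, a t * φ₁ s t * φ₂ s t ∂ν) ^ r ∂μ) ^ (1 / r) ≤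
      C₂ * C₁ ^ (1 / r) * (∫⁻ t, a t ^ p ∂ν) ^ (1 / p) := by
  have hp0 : 0 < p := by linarith
  have hr0 : 0 < r := by linarith
  set I := ∫⁻ t, a t ^ p ∂ν with hI
  have hpr' : 0 ≤ 1 - p / r := by
    rw [sub_nonneg, div_le_one hr0]; exact hpr
  -- For fixed s, `h₂` is applied to b = a φ₁, and Hölder with weights p/r and 1 - p/r is applied to
  -- ∫ (a φ₁)^p. After raising to the power r, the factor ∫ a^p φ₁^r enters linearly, so Tonelli and
  -- `h₁` can finish.
  have key : ∀ s, (∫⁻ t, a t * φ₁ s t * φ₂ s t ∂ν) ^ r ≤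
      C₂ ^ r * I ^ (r / p - 1) * ∫⁻ t, a t ^ p * φ₁ s t ^ r ∂ν := by
    intro s
    have hm : Measurable fun t => φ₁ s t := hφ₁.comp measurable_prodMk_left
    have e1 : ∀ t, (a t * φ₁ s t) ^ p =
        (a t ^ p * φ₁ s t ^ r) ^ (p / r) * (a t ^ p) ^ (1 - p / r) := by
      intro t
      rw [ENNReal.mul_rpow_of_nonneg _ _ hp0.le,
        ENNReal.mul_rpow_of_nonneg _ _ (div_nonneg hp0.le hr0.le), ← ENNReal.rpow_mul (φ₁ s t), mul_div_cancel₀ _ hr0.ne', mul_right_comm,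
        ← ENNReal.rpow_add_of_nonneg _ _ (by positivity) hpr']
      simp
    have e2 : ∫⁻ t, (a t * φ₁ s t) ^ p ∂ν ≤
        (∫⁻ t, a t ^ p * φ₁ s t ^ r ∂ν) ^ (p / r) * I ^ (1 - p / r) := by
      simp only [e1]
      exact ENNReal.lintegral_mul_norm_pow_le (by fun_prop) (by fun_prop) (by positivity) hpr'
        (by ring)
    have e3 := h₂ s (fun t => a t * φ₁ s t) (by fun_prop)
    calc (∫⁻ t, a t * φ₁ s t * φ₂ s t ∂ν) ^ r
        ≤ (C₂ * ((∫⁻ t, a t ^ p * φ₁ s t ^ r ∂ν) ^ (p / r) * I ^ (1 - p / r)) ^ (1 / p)) ^ r := by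
          refine ENNReal.rpow_le_rpow (e3.trans ?_) hr0.le
          gcongr
      _ = C₂ ^ r * I ^ (r / p - 1) * ∫⁻ t, a t ^ p * φ₁ s t ^ r ∂ν := by
          rw [ENNReal.mul_rpow_of_nonneg _ _ hr0.le, ← ENNReal.rpow_mul,
            ENNReal.mul_rpow_of_nonneg _ _ (by positivity), ← ENNReal.rpow_mul, ← ENNReal.rpow_mul,
            show p / r * (1 / p * r) = 1 by field_simp, ENNReal.rpow_one,
            show (1 - p / r) * (1 / p * r) = r / p - 1 by field_simp]
          ring
  have hrp : 0 ≤ r / p - 1 := by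
    rw [sub_nonneg, one_le_div hp0]; exact hpr
  have hmeas : Measurable (Function.uncurry fun s t => a t ^ p * φ₁ s t ^ r) := by
    have : Measurable fun z : α × β => φ₁ z.1 z.2 := hφ₁
    change Measurable fun z : α × β => a z.2 ^ p * φ₁ z.1 z.2 ^ r
    fun_prop
  have total : ∫⁻ s, (∫⁻ t, a t * φ₁ s t * φ₂ s t ∂ν) ^ r ∂μ ≤ C₂ ^ r * C₁ * I ^ (r / p) := by
    calc _ ≤ ∫⁻ s, C₂ ^ r * I ^ (r / p - 1) * ∫⁻ t, a t ^ p * φ₁ s t ^ r ∂ν ∂μ :=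
          lintegral_mono key
      _ = C₂ ^ r * I ^ (r / p - 1) * ∫⁻ s, ∫⁻ t, a t ^ p * φ₁ s t ^ r ∂ν ∂μ :=
          lintegral_const_mul _ hmeas.lintegral_prod_right
      _ = C₂ ^ r * I ^ (r / p - 1) * ∫⁻ t, a t ^ p * ∫⁻ s, φ₁ s t ^ r ∂μ ∂ν := by
          rw [lintegral_lintegral_swap hmeas.aemeasurable]
          congr 1
          refine lintegral_congr fun t => lintegral_const_mul _ ?_
          have : Measurable fun s => φ₁ s t := hφ₁.comp measurable_prodMk_right
          fun_prop
      _ ≤ C₂ ^ r * I ^ (r / p - 1) * ∫⁻ t, a t ^ p * C₁ ∂ν := by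
          gcongr with t; exact h₁ t
      _ = C₂ ^ r * C₁ * I ^ (r / p) := by
          rw [lintegral_mul_const _ (by fun_prop), ← hI]
          have : I ^ (r / p) = I ^ (r / p - 1) * I := by
            conv_rhs => rw [← ENNReal.rpow_one I, ← ENNReal.rpow_mul, one_mul]
            rw [← ENNReal.rpow_add_of_nonneg _ _ hrp zero_le_one]; simp
          rw [this]; ring
  calc _ ≤ (C₂ ^ r * C₁ * I ^ (r / p)) ^ (1 / r) := ENNReal.rpow_le_rpow total (by positivity)
    _ = _ := by
      rw [ENNReal.mul_rpow_of_nonneg _ _ (by positivity),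
        ENNReal.mul_rpow_of_nonneg _ _ (by positivity), ← ENNReal.rpow_mul, ← ENNReal.rpow_mul,
        mul_one_div_cancel hr0.ne', ENNReal.rpow_one, show r / p * (1 / r) = 1 / p by field_simp]

/-- The kernel `τ^{-β} e^{-cτ}` on `(0, ∞)`. -/
def ker (β c τ : ℝ) : ℝ≥0∞ :=
  (Ioi (0 : ℝ)).indicator (fun τ => ENNReal.ofReal (τ ^ (-β) * Real.exp (-(c * τ)))) τ

lemma ker_of_pos (β c : ℝ) {τ : ℝ} (hτ : 0 < τ) :
    ker β c τ = ENNReal.ofReal (τ ^ (-β) * Real.exp (-(c * τ))) :=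
  indicator_of_mem (mem_Ioi.2 hτ) _

lemma ker_of_nonpos (β c : ℝ) {τ : ℝ} (hτ : τ ≤ 0) : ker β c τ = 0 :=
  indicator_of_notMem (by simpa using hτ) _

lemma measurable_ker (β c : ℝ) : Measurable (ker β c) := by
  unfold ker
  exact Measurable.indicator (by fun_prop) measurableSet_Ioi

lemma ker_ne_top (β c τ : ℝ) : ker β c τ ≠ ∞ := by
  rcases le_or_gt τ 0 with h | h
  · simp [ker_of_nonpos _ _ h]
  · simp [ker_of_pos _ _ h]

lemma ker_rpow (β c τ : ℝ) {ρ : ℝ} (hρ : 0 < ρ) : ker β c τ ^ ρ = ker (β * ρ) (c * ρ) τ := by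
  rcases le_or_gt τ 0 with h | h
  · simp [ker_of_nonpos _ _ h, hρ]
  · rw [ker_of_pos _ _ h, ker_of_pos _ _ h, ENNReal.ofReal_rpow_of_nonneg (by positivity) hρ.le,
      Real.mul_rpow (by positivity) (by positivity), ← Real.rpow_mul h.le, ← Real.exp_mul]
    congr 3 <;> ring_nf

lemma ker_mul_ker (β c β' c' τ : ℝ) : ker β c τ * ker β' c' τ = ker (β + β') (c + c') τ := by
  rcases le_or_gt τ 0 with h | h
  · simp [ker_of_nonpos _ _ h]
  · rw [ker_of_pos _ _ h, ker_of_pos _ _ h, ker_of_pos _ _ h, ← ENNReal.ofReal_mul (by positivity),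
      neg_add, Real.rpow_add h, add_mul, neg_add, Real.exp_add]
    ring_nf

lemma ker_mono {β c c' : ℝ} (h : c ≤ c') (τ : ℝ) : ker β c' τ ≤ ker β c τ := by
  rcases le_or_gt τ 0 with h' | h'
  · simp [ker_of_nonpos _ _ h']
  · rw [ker_of_pos _ _ h', ker_of_pos _ _ h']
    gcongr

lemma lintegral_ker_ne_top {β c : ℝ} (hβ : β < 1) (hc : 0 < c) : ∫⁻ τ, ker β c τ ≠ ∞ := by
  have h : IntegrableOn (fun τ : ℝ => τ ^ (-β) * Real.exp (-c * τ ^ (1 : ℝ))) (Ioi 0) :=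
    integrableOn_rpow_mul_exp_neg_mul_rpow (by linarith) zero_lt_one hc
  unfold ker
  rw [lintegral_indicator measurableSet_Ioi]
  have h2 := h.2
  rw [hasFiniteIntegral_iff_ofReal] at h2
  · refine ne_of_lt (lt_of_eq_of_lt ?_ h2)
    simp [neg_mul]
  · filter_upwards [ae_restrict_mem measurableSet_Ioi] with τ hτ
    have : (0 : ℝ) < τ := hτ
    simp only [Pi.zero_apply]
    positivity

lemma lintegral_ker_rpow_ne_top {β c ρ : ℝ} (hρ : 0 < ρ) (hβ : β * ρ < 1) (hc : 0 < c) :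
    ∫⁻ τ, ker β c τ ^ ρ ≠ ∞ := by
  simp only [ker_rpow _ _ _ hρ]
  exact lintegral_ker_ne_top hβ (by positivity)

/-- Hölder's inequality with the kernel `ker β c`, uniformly in translations. -/
lemma exists_lintegral_mul_ker_le {p β c : ℝ} (hp : 1 ≤ p) (hc : 0 < c)
    (hβ : β = 0 ∨ 1 < p ∧ β < 1 - 1 / p) : ∃ C : ℝ≥0∞, C ≠ ∞ ∧ ∀ s : ℝ, ∀ b : ℝ → ℝ≥0∞, Measurable b →
      ∫⁻ t, b t * ker β c (t - s) ≤ C * (∫⁻ t, b t ^ p) ^ (1 / p) := by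
  rcases hp.eq_or_lt with rfl | hp1
  · have hβ0 : β = 0 := hβ.resolve_right fun h => lt_irrefl _ h.1
    subst hβ0
    refine ⟨1, by simp, fun s b hb => ?_⟩
    simp only [one_mul, ENNReal.rpow_one, div_one]
    refine lintegral_mono fun t => ?_
    rcases le_or_gt (t - s) 0 with h | h
    · simp [ker_of_nonpos _ _ h]
    · rw [ker_of_pos _ _ h]
      refine mul_le_of_le_one_right' ?_
      simp only [neg_zero, Real.rpow_zero, one_mul]
      rw [ENNReal.ofReal_le_one, Real.exp_le_one_iff, Left.neg_nonpos_iff]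
      positivity
  · have hβ' : β < 1 - 1 / p := by
      rcases hβ with rfl | h
      · have : 1 / p < 1 := by rw [div_lt_one (by linarith)]; exact hp1
        linarith
      · exact h.2
    obtain ⟨p', hp'⟩ : ∃ p', p.HolderConjugate p' := ⟨_, Real.HolderConjugate.conjExponent hp1⟩
    refine ⟨(∫⁻ τ, ker β c τ ^ p') ^ (1 / p'), ?_, fun s b hb => ?_⟩
    · refine ENNReal.rpow_ne_top_of_nonneg (by have := hp'.symm.pos; positivity) ?_
      refine lintegral_ker_rpow_ne_top hp'.symm.pos ?_ hc
      have h1 := hp'.inv_add_inv_eq_one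
      have h2 : β < p'⁻¹ := by rw [one_div] at hβ'; linarith
      have h3 := mul_lt_mul_of_pos_right h2 hp'.symm.pos
      rwa [inv_mul_cancel₀ hp'.symm.pos.ne'] at h3
    · have := ENNReal.lintegral_mul_le_Lp_mul_Lq volume hp' hb.aemeasurable
        ((measurable_ker β c).comp (measurable_id.sub_const s)).aemeasurable
      rw [mul_comm]
      refine this.trans (le_of_eq ?_)
      congr 2
      exact lintegral_sub_right_eq_self (fun τ => ker β c τ ^ p') s

/-- Young's inequality for the kernel `ker γ c`. -/
lemma exists_young_ker {p r γ c : ℝ} (hp : 1 ≤ p) (hpr : p ≤ r)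
    (hγr : γ < 1 / r + (1 - 1 / p)) (hc : 0 < c) :
    ∃ C : ℝ≥0∞, C ≠ ∞ ∧ ∀ a : ℝ → ℝ≥0∞, Measurable a →
      (∫⁻ s, (∫⁻ t, a t * ker γ c (t - s)) ^ r) ^ (1 / r) ≤ C * (∫⁻ t, a t ^ p) ^ (1 / p) := by
  have hr0 : 0 < r := by linarith
  have hp1 : 0 ≤ 1 - 1 / p := by
    rw [sub_nonneg, div_le_one (by linarith)]; exact hp
  set D := 1 / r + (1 - 1 / p) with hD
  have hD0 : 0 < D := by positivity
  -- The exponent γ is shared between α and β in the ratio of 1/r to 1 - 1/p. The hypothesis γ < D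
  -- then says both that ker α is in L^r and that ker β is admissible for Hölder; for p = 1 it
  -- forces β = 0.
  set α := γ * (1 / r / D) with hα
  set β := γ * ((1 - 1 / p) / D) with hβ
  have hαβ : α + β = γ := by
    rw [hα, hβ, ← mul_add, ← add_div, ← hD, div_self hD0.ne', mul_one]
  have hα1 : α * r < 1 := by
    rw [hα, show γ * (1 / r / D) * r = γ / D by field_simp, div_lt_one hD0]
    exact hγr
  have hβ1 : β = 0 ∨ 1 < p ∧ β < 1 - 1 / p := by
    rcases hp1.eq_or_lt with h | h
    · left; rw [hβ, ← h]; simp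
    · right
      refine ⟨hp.lt_of_ne fun h1 => ?_, ?_⟩
      · rw [← h1] at h; simp at h
      rw [hβ, show γ * ((1 - 1 / p) / D) = (γ / D) * (1 - 1 / p) by ring]
      exact mul_lt_of_lt_one_left h ((div_lt_one hD0).2 hγr)
  obtain ⟨C₂, hC₂, h₂⟩ := exists_lintegral_mul_ker_le (c := c / 2) hp (by positivity) hβ1
  refine ⟨C₂ * (∫⁻ τ, ker α (c / 2) τ ^ r) ^ (1 / r), ?_, fun a ha => ?_⟩
  · exact ENNReal.mul_ne_top hC₂ (ENNReal.rpow_ne_top_of_nonneg (by positivity)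
      (lintegral_ker_rpow_ne_top hr0 hα1 (by positivity)))
  have := lintegral_rpow_lintegral_mul_le (μ := volume) (ν := volume) hp hpr ha
    (φ₁ := fun s t => ker α (c / 2) (t - s)) (φ₂ := fun s t => ker β (c / 2) (t - s))
    ((measurable_ker α (c / 2)).comp (measurable_snd.sub measurable_fst))
    (C₁ := ∫⁻ τ, ker α (c / 2) τ ^ r)
    (fun t => (lintegral_sub_left_eq_self (fun τ => ker α (c / 2) τ ^ r) t).le) h₂
  refine le_of_eq_of_le ?_ this
  simp only [mul_assoc, ker_mul_ker, hαβ, add_halves]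

/-- A kernel `ψ` with exponential decay, whose `L^r` norm in the outer variable is controlled by
`a`, is controlled from `L^p` to `L^r` for all `p ≤ r`. -/
lemma exists_lintegral_exp_kernel {p r c : ℝ} (hp : 1 ≤ p) (hpr : p ≤ r) (hc : 0 < c) {C : ℝ≥0∞}
    (hC : C ≠ ∞) :
    ∃ C' : ℝ≥0∞, C' ≠ ∞ ∧ ∀ a : ℝ → ℝ≥0∞, Measurable a → (∀ t, a t ≠ ∞) → ∀ ψ : ℝ → ℝ → ℝ≥0∞,
      Measurable (Function.uncurry ψ) → (∀ s t, t ≤ s → ψ s t = 0) → (∀ s t, a t = 0 → ψ s t = 0) →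
      (∀ t, ∫⁻ s, (ψ s t * ENNReal.ofReal (Real.exp (c * (t - s)))) ^ r ≤ C * a t ^ r) →
      (∫⁻ s, (∫⁻ t, ψ s t) ^ r) ^ (1 / r) ≤ C' * (∫⁻ t, a t ^ p) ^ (1 / p) := by
  have hr0 : 0 < r := by linarith
  obtain ⟨C₂, hC₂, h₂⟩ := exists_lintegral_mul_ker_le (c := c) hp hc (Or.inl rfl)
  refine ⟨C₂ * C ^ (1 / r), ENNReal.mul_ne_top hC₂
    (ENNReal.rpow_ne_top_of_nonneg (by positivity) hC), fun a ha ha' ψ hψ h0 h0' hb => ?_⟩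
  have hψ' : Measurable fun z : ℝ × ℝ => ψ z.1 z.2 := hψ
  -- The factor φ₁ is ψ with its weight, divided by a(t) so that its L^r norm is bounded uniformly
  -- in t; φ₂ = e^{-c(t-s)} undoes the weight. Where a(t) = 0 the inverse is infinite, which is
  -- harmless because ψ vanishes there.
  have := lintegral_rpow_lintegral_mul_le (μ := volume) (ν := volume) hp hpr ha
    (φ₁ := fun s t => ψ s t * ENNReal.ofReal (Real.exp (c * (t - s))) * (a t)⁻¹)
    (φ₂ := fun s t => ker 0 c (t - s)) ?_ (C₁ := C) ?_ h₂
  · refine le_of_eq_of_le ?_ this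
    congr 1
    refine lintegral_congr fun s => ?_
    congr 1
    refine lintegral_congr fun t => ?_
    rcases le_or_gt t s with h | h
    · simp [h0 s t h]
    by_cases hat : a t = 0
    · simp [h0' s t hat]
    · rw [ker_of_pos _ _ (sub_pos.2 h), neg_zero, Real.rpow_zero, one_mul, mul_comm (ψ s t * _),
        ← mul_assoc (a t), ENNReal.mul_inv_cancel hat (ha' t), one_mul, mul_assoc,
        ← ENNReal.ofReal_mul (by positivity), ← Real.exp_add]
      simp
  · change Measurable fun z : ℝ × ℝ => ψ z.1 z.2 * ENNReal.ofReal (Real.exp (c * (z.2 - z.1))) *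
      (a z.2)⁻¹
    fun_prop
  · intro t
    have hm : Measurable fun s => ψ s t := hψ.comp measurable_prodMk_right
    simp only [ENNReal.mul_rpow_of_nonneg _ _ hr0.le] at hb ⊢
    rw [lintegral_mul_const _ (by fun_prop)]
    by_cases hat : a t = 0
    · have : ∀ s, ψ s t = 0 := fun s => h0' s t hat
      simp [this, hr0]
    · calc _ ≤ C * a t ^ r * (a t)⁻¹ ^ r := by gcongr; exact hb t
        _ = C := by
          rw [mul_assoc, ← ENNReal.mul_rpow_of_nonneg _ _ hr0.le, ENNReal.mul_inv_cancel hat (ha' t)]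
          simp

end Kernels

/-! ## The Hardy-Littlewood-Sobolev inequality on the line -/

section HardyLittlewoodSobolev

lemma lintegral_Ioo_rpow {e b : ℝ} (he : 0 < e) (hb : 0 ≤ b) :
    ∫⁻ x in Ioo 0 b, ENNReal.ofReal (x ^ (e - 1)) = ENNReal.ofReal (b ^ e / e) := by
  have hi : IntegrableOn (fun x : ℝ => x ^ (e - 1)) (Ioo 0 b) :=
    ((intervalIntegrable_iff_integrableOn_Ioc_of_le hb).1
      (intervalIntegral.intervalIntegrable_rpow' (by linarith))).mono_set Ioo_subset_Ioc_self
  rw [← ofReal_integral_eq_lintegral_ofReal hi]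
  · rw [← integral_Ioc_eq_integral_Ioo, ← intervalIntegral.integral_of_le hb,
      integral_rpow (Or.inl (by linarith)), sub_add_cancel, Real.zero_rpow he.ne', sub_zero]
  · filter_upwards [ae_restrict_mem measurableSet_Ioo] with x hx
    exact Real.rpow_nonneg hx.1.le _

/-- The pointwise layer cake formula for powers. -/
lemma lintegral_layercake_rpow {e : ℝ} (he : 0 < e) (x : ℝ≥0∞) :
    ∫⁻ m in Ioi (0 : ℝ), {m : ℝ | ENNReal.ofReal m < x}.indicator
      (fun m => ENNReal.ofReal (m ^ (e - 1))) m = ENNReal.ofReal (1 / e) * x ^ e := by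
  have key : ∀ b : ℝ, 0 ≤ b → ∫⁻ m in Ioi (0 : ℝ), {m : ℝ | ENNReal.ofReal m < .ofReal b}.indicator
      (fun m => ENNReal.ofReal (m ^ (e - 1))) m = ENNReal.ofReal (1 / e) * ENNReal.ofReal b ^ e := by
    intro b hb
    rw [ENNReal.ofReal_rpow_of_nonneg hb he.le, ← ENNReal.ofReal_mul (by positivity),
      ← lintegral_indicator measurableSet_Ioi, show 1 / e * b ^ e = b ^ e / e by ring,
      ← lintegral_Ioo_rpow he hb, ← lintegral_indicator measurableSet_Ioo]
    refine lintegral_congr fun m => ?_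
    simp only [indicator_apply, mem_Ioi, mem_ofPred_eq, mem_Ioo]
    by_cases hm : 0 < m
    · simp [hm, ENNReal.ofReal_lt_ofReal_iff_of_nonneg hm.le]
    · simp [hm]
  rcases eq_or_ne x ∞ with rfl | hx
  · rw [ENNReal.top_rpow_of_pos he, ENNReal.mul_top (by simpa using he)]
    -- The finite case with b = (e n)^{1/e} has value exactly n, and its integrand is below the one
    -- for x = ∞.
    refine ENNReal.eq_top_of_forall_nnreal_le fun n => ?_
    have h1 := key ((e * n) ^ (1 / e)) (by positivity)
    rw [ENNReal.ofReal_rpow_of_nonneg (by positivity) he.le, ← ENNReal.ofReal_mul (by positivity),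
      ← Real.rpow_mul (by positivity), one_div_mul_cancel he.ne', Real.rpow_one, ← mul_assoc,
      one_div_mul_cancel he.ne', one_mul, ENNReal.ofReal_coe_nnreal] at h1
    rw [← h1]
    refine lintegral_mono fun m => indicator_le_indicator_of_subset ?_ (by simp) m
    intro m hm
    simp
  · have := key x.toReal ENNReal.toReal_nonneg
    rwa [ENNReal.ofReal_toReal hx] at this

/-- Decomposition of a fractional integral into a bounded part and an integrable part. -/
lemma exists_lintegral_ker_le_add {p γ : ℝ} (hγ0 : 0 < γ) (hγ1 : γ < 1) (hp : 1 < p)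
    (hpγ : p < 1 / (1 - γ)) : ∃ C K : ℝ, 0 < C ∧ 0 < K ∧ ∀ a : ℝ → ℝ≥0∞, Measurable a →
      ∫⁻ t, a t ^ p ≤ 1 → ∀ m : ℝ, 0 < m → ∃ j : ℝ → ℝ≥0∞, Measurable j ∧
        (∀ s, ∫⁻ t, a t * ker γ 0 (t - s) ≤ ENNReal.ofReal (C * m ^ (1 - p * (1 - γ))) + j s) ∧
        ∫⁻ s, j s ≤ ENNReal.ofReal (K * m ^ (-(p * (1 - γ)))) *
          ∫⁻ t, {t | ENNReal.ofReal m < a t}.indicator a t := by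
  have hγ' : 0 < 1 - γ := by linarith
  have hp0 : 0 < p := by linarith
  have hpγ' : p * (1 - γ) < 1 := by rwa [lt_div_iff₀ hγ'] at hpγ
  obtain ⟨p', hp'⟩ : ∃ p', p.HolderConjugate p' := ⟨_, Real.HolderConjugate.conjExponent hp⟩
  have hp'0 := hp'.symm.pos
  have hinv : 1 / p' = 1 - 1 / p := by
    have := hp'.inv_add_inv_eq_one
    simp only [one_div]; linarith
  have hγp' : 1 < γ * p' := by
    have h1 : p * (1 / p') < p * γ := by
      rw [hinv, mul_sub, mul_one_div_cancel hp0.ne']; linarith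
    have h2 := lt_of_mul_lt_mul_left h1 hp0.le
    rwa [div_lt_iff₀ hp'0] at h2
  set K₁ : ℝ := 1 / (1 - γ) with hK₁
  set K₂ : ℝ := (1 / (γ * p' - 1)) ^ (1 / p') with hK₂
  have hK₁0 : 0 < K₁ := by positivity
  have hK₂0 : 0 < K₂ := by
    have : 0 < γ * p' - 1 := by linarith
    positivity
  refine ⟨K₁ + K₂, K₁, by positivity, hK₁0, fun a ha ha1 m hm => ?_⟩
  -- This cut-off radius balances the two bounded contributions: m R^{1-γ} from the near kernel
  -- against a ≤ m, and R^{1/p' - γ} from the tail by Hölder, are both m^{1 - p(1-γ)}.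
  set R : ℝ := m ^ (-p) with hR
  have hR0 : 0 < R := by positivity
  set κ : ℝ → ℝ≥0∞ := (Iio R).indicator (ker γ 0) with hκ
  set κ' : ℝ → ℝ≥0∞ := (Ici R).indicator (ker γ 0) with hκ'
  have hκm : Measurable κ := (measurable_ker γ 0).indicator measurableSet_Iio
  have hκm' : Measurable κ' := (measurable_ker γ 0).indicator measurableSet_Ici
  set E : Set ℝ := {t | ENNReal.ofReal m < a t} with hE
  have hEm : MeasurableSet E := measurableSet_lt measurable_const ha
  have hk1 : ∫⁻ τ, κ τ = ENNReal.ofReal (K₁ * R ^ (1 - γ)) := by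
    rw [show K₁ * R ^ (1 - γ) = R ^ (1 - γ) / (1 - γ) by rw [hK₁]; ring,
      ← lintegral_Ioo_rpow hγ' hR0.le, ← lintegral_indicator measurableSet_Ioo]
    refine lintegral_congr fun τ => ?_
    simp only [hκ, ker, indicator_apply, mem_Iio, mem_Ioi, mem_Ioo]
    by_cases h1 : 0 < τ <;> by_cases h2 : τ < R <;> simp [h1, h2]
  have hk2 : (∫⁻ τ, κ' τ ^ p') ^ (1 / p') = ENNReal.ofReal (K₂ * R ^ (1 / p' - γ)) := by
    have hlt : -γ * p' < -1 := by linarith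
    have e1 : ∫⁻ τ, κ' τ ^ p' = ENNReal.ofReal (1 / (γ * p' - 1) * R ^ (1 - γ * p')) := by
      have hi := integrableOn_Ioi_rpow_of_lt hlt hR0
      have e2 := integral_Ioi_rpow_of_lt hlt hR0
      have e3 : 1 / (γ * p' - 1) * R ^ (1 - γ * p') = ∫ t in Ioi R, t ^ (-γ * p') := by
        rw [e2, show -γ * p' + 1 = 1 - γ * p' by ring, show 1 - γ * p' = -(γ * p' - 1) by ring,
          neg_div_neg_eq]
        ring
      rw [e3, ofReal_integral_eq_lintegral_ofReal hi, ← setLIntegral_congr Ioi_ae_eq_Ici.symm,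
        ← lintegral_indicator measurableSet_Ici]
      · refine lintegral_congr fun τ => ?_
        simp only [hκ', indicator_apply, mem_Ici]
        by_cases h2 : R ≤ τ
        · have h3 : 0 < τ := hR0.trans_le h2
          simp only [h2, if_true]
          rw [ker_of_pos _ _ h3, ENNReal.ofReal_rpow_of_nonneg (by positivity) hp'0.le]
          simp [← Real.rpow_mul h3.le]
        · simp [h2, hp'0]
      · filter_upwards [ae_restrict_mem measurableSet_Ioi] with x hx
        exact Real.rpow_nonneg (hR0.trans hx).le _
    have h4 : 0 ≤ 1 / (γ * p' - 1) := by
      have : 0 < γ * p' - 1 := by linarith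
      positivity
    rw [e1, ENNReal.ofReal_rpow_of_nonneg (by positivity) (by positivity),
      Real.mul_rpow h4 (by positivity), ← Real.rpow_mul hR0.le, hK₂]
    congr 3
    field_simp
  refine ⟨fun s => ∫⁻ t, E.indicator a t * κ (t - s), ?_, fun s => ?_, ?_⟩
  · have : Measurable fun z : ℝ × ℝ => E.indicator a z.2 * κ (z.2 - z.1) :=
      ((ha.indicator hEm).comp measurable_snd).mul (hκm.comp (measurable_snd.sub measurable_fst))
    exact this.lintegral_prod_right'
  -- Three regimes: near kernel with a ≤ m, tail of the kernel, near kernel with a > m. Only the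
  -- last goes into j.
  · have hpt : ∀ t, a t * ker γ 0 (t - s) ≤ (ENNReal.ofReal m * κ (t - s) + κ' (t - s) * a t) +
        E.indicator a t * κ (t - s) := by
      intro t
      by_cases h1 : t - s < R
      · have e1 : κ (t - s) = ker γ 0 (t - s) := indicator_of_mem (mem_Iio.2 h1) _
        rw [e1]
        by_cases h2 : t ∈ E
        · rw [indicator_of_mem h2]
          exact le_add_self
        · rw [indicator_of_notMem h2]
          have : a t ≤ ENNReal.ofReal m := not_lt.1 h2
          refine le_add_right (le_add_right ?_)
          gcongr
      · have e1 : κ' (t - s) = ker γ 0 (t - s) := indicator_of_mem (mem_Ici.2 (not_lt.1 h1)) _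
        rw [e1, mul_comm (a t)]
        exact le_add_right le_add_self
    have hm1 : Measurable fun t => κ (t - s) := hκm.comp (measurable_id.sub_const s)
    have hm2 : Measurable fun t => κ' (t - s) := hκm'.comp (measurable_id.sub_const s)
    refine (lintegral_mono hpt).trans ?_
    rw [lintegral_add_left (by fun_prop), lintegral_add_left (by fun_prop)]
    gcongr
    rw [lintegral_const_mul _ hm1, lintegral_sub_right_eq_self κ s, hk1]
    have hH := ENNReal.lintegral_mul_le_Lp_mul_Lq volume hp'.symm hm2.aemeasurable ha.aemeasurable
    rw [lintegral_sub_right_eq_self (fun τ => κ' τ ^ p') s, hk2] at hH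
    have h5 : (∫⁻ t, a t ^ p) ^ (1 / p) ≤ 1 := ENNReal.rpow_le_one ha1 (by positivity)
    have hH' : ∫⁻ t, κ' (t - s) * a t ≤ ENNReal.ofReal (K₂ * R ^ (1 / p' - γ)) :=
      hH.trans (mul_le_of_le_one_right' h5)
    refine (add_le_add_right hH' _).trans (le_of_eq ?_)
    rw [← ENNReal.ofReal_mul hm.le, ← ENNReal.ofReal_add (by positivity) (by positivity)]
    congr 1
    rw [hinv, hR, ← Real.rpow_mul hm.le, ← Real.rpow_mul hm.le, add_mul, mul_left_comm]
    congr 2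
    · conv_lhs => rw [← Real.rpow_one m]
      rw [← Real.rpow_mul hm.le, ← Real.rpow_add hm]
      ring_nf
    · congr 1
      field_simp
      ring
  · have hm3 : Measurable (Function.uncurry fun s t => E.indicator a t * κ (t - s)) :=
      ((ha.indicator hEm).comp measurable_snd).mul (hκm.comp (measurable_snd.sub measurable_fst))
    rw [lintegral_lintegral_swap hm3.aemeasurable]
    have : ∀ t, ∫⁻ s, E.indicator a t * κ (t - s) = E.indicator a t *
        ENNReal.ofReal (K₁ * R ^ (1 - γ)) := by
      intro t
      have hm4 : Measurable fun s => κ (t - s) := hκm.comp (measurable_id.const_sub t)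
      rw [lintegral_const_mul _ hm4, lintegral_sub_left_eq_self κ t, hk1]
    simp only [this]
    rw [lintegral_mul_const _ (ha.indicator hEm), mul_comm, hR, ← Real.rpow_mul hm.le, neg_mul]

/-- The Hardy-Littlewood-Sobolev inequality, for normalized functions. -/
lemma exists_lintegral_rpow_ker_le_of_le_one {p γ : ℝ} (hγ0 : 0 < γ) (hγ1 : γ < 1) (hp : 1 < p)
    (hpγ : p < 1 / (1 - γ)) : ∃ C : ℝ≥0∞, C ≠ ∞ ∧ ∀ a : ℝ → ℝ≥0∞, Measurable a →
      ∫⁻ t, a t ^ p ≤ 1 →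
      ∫⁻ s, (∫⁻ t, a t * ker γ 0 (t - s)) ^ (p / (1 - (1 - γ) * p)) ≤ C := by
  obtain ⟨C, K, hC, hK, H⟩ := exists_lintegral_ker_le_add hγ0 hγ1 hp hpγ
  have hγ' : 0 < 1 - γ := by linarith
  have hp0 : 0 < p := by linarith
  have hpγ' : p * (1 - γ) < 1 := by rwa [lt_div_iff₀ hγ'] at hpγ
  set θ : ℝ := 1 - p * (1 - γ) with hθ
  have hθ0 : 0 < θ := by linarith
  rw [show 1 - (1 - γ) * p = θ by rw [hθ]; ring]
  refine ⟨ENNReal.ofReal (2 * C) ^ (p / θ) * (ENNReal.ofReal p * (ENNReal.ofReal (K / C) *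
    ENNReal.ofReal (1 / (p - 1)))), by finiteness, fun a ha ha1 => ?_⟩
  set I : ℝ → ℝ≥0∞ := fun s => ∫⁻ t, a t * ker γ 0 (t - s) with hI
  have hIm : Measurable I := by
    have : Measurable fun z : ℝ × ℝ => a z.2 * ker γ 0 (z.2 - z.1) :=
      (ha.comp measurable_snd).mul ((measurable_ker γ 0).comp (measurable_snd.sub measurable_fst))
    exact this.lintegral_prod_right'
  have hC2 : ENNReal.ofReal (2 * C) ≠ 0 := by simp [hC]
  -- With this normalization, h > m means I > 2 C m^θ. Since the bounded part of I takes up at most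
  -- C m^θ, the integrable part j must be at least C m^θ.
  set h : ℝ → ℝ≥0∞ := fun s => (I s / ENNReal.ofReal (2 * C)) ^ (1 / θ) with hh
  have hhm : Measurable h := by fun_prop
  have hIh : ∀ s, I s ^ (p / θ) = ENNReal.ofReal (2 * C) ^ (p / θ) * h s ^ p := by
    intro s
    rw [hh, ← ENNReal.rpow_mul, show 1 / θ * p = p / θ by ring,
      ← ENNReal.mul_rpow_of_nonneg _ _ (by positivity), ENNReal.mul_div_cancel hC2 ENNReal.ofReal_ne_top]
  -- Chebyshev's inequality for j. The powers combine to m^{-θ} m^{-p(1-γ)} = m^{-1}, a weak-type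
  -- bound that sees only the part of a above level m.
  have hsup : ∀ m : ℝ, 0 < m → volume {s | ENNReal.ofReal m < h s} ≤
      ENNReal.ofReal (K / C * m⁻¹) * ∫⁻ t, {t | ENNReal.ofReal m < a t}.indicator a t := by
    intro m hm
    obtain ⟨j, hj, hj1, hj2⟩ := H a ha ha1 m hm
    have hsub : {s | ENNReal.ofReal m < h s} ⊆ {s | ENNReal.ofReal (C * m ^ θ) ≤ j s} := by
      intro s hs
      have h1 : ENNReal.ofReal m ^ θ < h s ^ θ := ENNReal.rpow_lt_rpow hs hθ0
      rw [hh, ← ENNReal.rpow_mul, one_div_mul_cancel hθ0.ne', ENNReal.rpow_one,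
        ENNReal.lt_div_iff_mul_lt (Or.inl hC2) (Or.inl ENNReal.ofReal_ne_top),
        ENNReal.ofReal_rpow_of_pos hm, ← ENNReal.ofReal_mul (by positivity),
        show m ^ θ * (2 * C) = C * m ^ θ + C * m ^ θ by ring,
        ENNReal.ofReal_add (by positivity) (by positivity)] at h1
      have h2 := h1.trans_le (hj1 s)
      exact (lt_of_add_lt_add_left h2).le
    have hpos : 0 < C * m ^ θ := by positivity
    have h3 := mul_meas_ge_le_lintegral (μ := volume) hj (ENNReal.ofReal (C * m ^ θ))
    have h4 : volume {s | ENNReal.ofReal (C * m ^ θ) ≤ j s} ≤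
        (ENNReal.ofReal (C * m ^ θ))⁻¹ * ∫⁻ s, j s := by
      rw [mul_comm _⁻¹, ← div_eq_mul_inv,
        ENNReal.le_div_iff_mul_le (by simp [hpos]) (by simp), mul_comm]
      exact h3
    refine (measure_mono hsub).trans (h4.trans ?_)
    refine (mul_le_mul_right hj2 _).trans (le_of_eq ?_)
    rw [← mul_assoc, ← ENNReal.ofReal_inv_of_pos hpos, ← ENNReal.ofReal_mul (by positivity)]
    congr 2
    rw [mul_inv, ← Real.rpow_neg hm.le, mul_mul_mul_comm, ← Real.rpow_add hm,
      show -θ + -(p * (1 - γ)) = -1 by rw [hθ]; ring, Real.rpow_neg_one, mul_comm C⁻¹,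
      div_eq_mul_inv]
  -- Marcinkiewicz interpolation by hand: the layer cake formula and `hsup` bound ∫ h^p by a
  -- multiple of ∫ m^{p-2} ∫_{a > m} a dt dm. Exchanging the integrals gives ∫ a · a^{p-1}/(p-1),
  -- which is where p > 1 is needed.
  have hA : ∫⁻ s, h s ^ p ≤ ENNReal.ofReal p * (ENNReal.ofReal (K / C) *
      ENNReal.ofReal (1 / (p - 1))) := by
    have hmeas1 : Measurable (Function.uncurry fun (s m : ℝ) =>
        {m : ℝ | ENNReal.ofReal m < h s}.indicator
          (fun m => ENNReal.ofReal (m ^ (p - 1))) m) := by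
      have hset : MeasurableSet {z : ℝ × ℝ | ENNReal.ofReal z.2 < h z.1} :=
        measurableSet_lt (by fun_prop) (by fun_prop)
      have : Measurable fun z : ℝ × ℝ => ENNReal.ofReal (z.2 ^ (p - 1)) := by fun_prop
      exact this.indicator hset
    have hmeas2 : Measurable (Function.uncurry fun (m t : ℝ) => a t *
        {m : ℝ | ENNReal.ofReal m < a t}.indicator
          (fun m => ENNReal.ofReal (m ^ (p - 1 - 1))) m) := by
      have hset : MeasurableSet {z : ℝ × ℝ | ENNReal.ofReal z.1 < a z.2} :=
        measurableSet_lt (by fun_prop) (by fun_prop)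
      have : Measurable fun z : ℝ × ℝ => ENNReal.ofReal (z.1 ^ (p - 1 - 1)) := by fun_prop
      exact (ha.comp measurable_snd).mul (this.indicator hset)
    have e1 : ∀ s, h s ^ p = ENNReal.ofReal p * ∫⁻ m in Ioi (0 : ℝ),
        {m : ℝ | ENNReal.ofReal m < h s}.indicator (fun m => ENNReal.ofReal (m ^ (p - 1))) m := by
      intro s
      rw [lintegral_layercake_rpow hp0, ← mul_assoc, ← ENNReal.ofReal_mul hp0.le,
        mul_one_div_cancel hp0.ne', ENNReal.ofReal_one, one_mul]
    simp only [e1]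
    rw [lintegral_const_mul _ hmeas1.lintegral_prod_right, lintegral_lintegral_swap
      hmeas1.aemeasurable]
    gcongr
    have e2 : ∀ m ∈ Ioi (0 : ℝ), ∫⁻ s, {m : ℝ | ENNReal.ofReal m < h s}.indicator
          (fun m => ENNReal.ofReal (m ^ (p - 1))) m ≤
        ENNReal.ofReal (K / C) * ∫⁻ t, a t * {m : ℝ | ENNReal.ofReal m < a t}.indicator
          (fun m => ENNReal.ofReal (m ^ (p - 1 - 1))) m := by
      intro m hm
      have hm : 0 < m := hm
      have e3 : ∀ s, {m : ℝ | ENNReal.ofReal m < h s}.indicator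
          (fun m => ENNReal.ofReal (m ^ (p - 1))) m =
          {s | ENNReal.ofReal m < h s}.indicator (fun _ => ENNReal.ofReal (m ^ (p - 1))) s := by
        intro s; simp [indicator_apply]
      have e4 : ∀ t, a t * {m : ℝ | ENNReal.ofReal m < a t}.indicator
          (fun m => ENNReal.ofReal (m ^ (p - 1 - 1))) m = ENNReal.ofReal (m ^ (p - 1 - 1)) *
          {t | ENNReal.ofReal m < a t}.indicator a t := by
        intro t; simp [indicator_apply, mul_comm]
      simp only [e3, e4]
      rw [lintegral_indicator (measurableSet_lt measurable_const hhm), setLIntegral_const,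
        lintegral_const_mul _ (ha.indicator (measurableSet_lt measurable_const ha))]
      calc _ ≤ ENNReal.ofReal (m ^ (p - 1)) * (ENNReal.ofReal (K / C * m⁻¹) *
            ∫⁻ t, {t | ENNReal.ofReal m < a t}.indicator a t) := by
            gcongr; exact hsup m hm
        _ = _ := by
          rw [← mul_assoc, ← mul_assoc, ← ENNReal.ofReal_mul (by positivity),
            ← ENNReal.ofReal_mul (by positivity)]
          congr 2
          rw [Real.rpow_sub_one hm.ne' (p - 1)]
          ring
    refine (setLIntegral_mono' measurableSet_Ioi e2).trans ?_
    rw [lintegral_const_mul _ hmeas2.lintegral_prod_right, lintegral_lintegral_swap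
      hmeas2.aemeasurable]
    gcongr
    have e5 : ∀ t, ∫⁻ m in Ioi (0 : ℝ), a t * {m : ℝ | ENNReal.ofReal m < a t}.indicator
          (fun m => ENNReal.ofReal (m ^ (p - 1 - 1))) m =
        ENNReal.ofReal (1 / (p - 1)) * a t ^ p := by
      intro t
      rw [lintegral_const_mul, lintegral_layercake_rpow (by linarith), mul_left_comm]
      · congr 1
        nth_rewrite 1 [← ENNReal.rpow_one (a t)]
        rw [← ENNReal.rpow_add_of_nonneg _ _ zero_le_one (by linarith)]
        ring_nf
      · exact Measurable.indicator (by fun_prop) (measurableSet_lt (by fun_prop) measurable_const)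
    simp only [e5]
    rw [lintegral_const_mul _ (by fun_prop)]
    exact mul_le_of_le_one_right' ha1
  rw [lintegral_congr hIh, lintegral_const_mul _ (by fun_prop)]
  gcongr

/-- The Hardy-Littlewood-Sobolev inequality for the kernel `ker γ 0`. -/
lemma exists_hardy_littlewood_sobolev {p γ : ℝ} (hγ0 : 0 < γ) (hγ1 : γ < 1) (hp : 1 < p)
    (hpγ : p < 1 / (1 - γ)) : ∃ C : ℝ≥0∞, C ≠ ∞ ∧ ∀ a : ℝ → ℝ≥0∞, Measurable a →
      (∫⁻ s, (∫⁻ t, a t * ker γ 0 (t - s)) ^ (p / (1 - (1 - γ) * p))) ^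
        (1 / (p / (1 - (1 - γ) * p))) ≤ C * (∫⁻ t, a t ^ p) ^ (1 / p) := by
  obtain ⟨C, hC, H⟩ := exists_lintegral_rpow_ker_le_of_le_one hγ0 hγ1 hp hpγ
  have hp0 : 0 < p := by linarith
  have hθ0 : 0 < 1 - (1 - γ) * p := by
    have hγ' : 0 < 1 - γ := by linarith
    have : p * (1 - γ) < 1 := by rwa [lt_div_iff₀ hγ'] at hpγ
    linarith
  set r := p / (1 - (1 - γ) * p) with hr
  have hr0 : 0 < r := by positivity
  -- The summand 1 keeps the constant nonzero, so that the right-hand side is ∞ when the norm of a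
  -- is ∞.
  refine ⟨C ^ (1 / r) + 1, by finiteness, fun a ha => ?_⟩
  set L := (∫⁻ t, a t ^ p) ^ (1 / p) with hL
  have hLp : L ^ p = ∫⁻ t, a t ^ p := by
    rw [hL, ← ENNReal.rpow_mul, one_div_mul_cancel hp0.ne', ENNReal.rpow_one]
  rcases eq_or_ne L 0 with h0 | h0
  · rw [h0, ENNReal.zero_rpow_of_pos hp0] at hLp
    have hz : a =ᵐ[volume] 0 := by
      have := (lintegral_eq_zero_iff (by fun_prop)).1 hLp.symm
      filter_upwards [this] with t ht
      simpa [hp0, hp0.not_gt] using ht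
    have hz' : ∀ s, ∫⁻ t, a t * ker γ 0 (t - s) = 0 := by
      intro s
      rw [lintegral_congr_ae (g := fun _ => 0)]
      · simp
      · filter_upwards [hz] with t ht
        simp [ht]
    simp [hz', hr0]
  rcases eq_or_ne L ∞ with h1 | h1
  · rw [h1, ENNReal.mul_top (by simp)]
    exact le_top
  have h2 := H (fun t => L⁻¹ * a t) (by fun_prop) (by
    simp only [ENNReal.mul_rpow_of_nonneg _ _ hp0.le]
    rw [lintegral_const_mul _ (by fun_prop), ← hLp, ← ENNReal.mul_rpow_of_nonneg _ _ hp0.le,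
      ENNReal.inv_mul_cancel h0 h1, ENNReal.one_rpow])
  have hm : ∀ s, Measurable fun t => a t * ker γ 0 (t - s) := fun s =>
    ha.mul ((measurable_ker γ 0).comp (measurable_id.sub_const s))
  have hIm : Measurable fun s => ∫⁻ t, a t * ker γ 0 (t - s) := by
    have : Measurable fun z : ℝ × ℝ => a z.2 * ker γ 0 (z.2 - z.1) :=
      (ha.comp measurable_snd).mul ((measurable_ker γ 0).comp (measurable_snd.sub measurable_fst))
    exact this.lintegral_prod_right'
  have e1 : ∀ s, ∫⁻ t, L⁻¹ * a t * ker γ 0 (t - s) = L⁻¹ * ∫⁻ t, a t * ker γ 0 (t - s) := by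
    intro s
    rw [← lintegral_const_mul _ (hm s)]
    simp only [mul_assoc]
  simp only [e1, ENNReal.mul_rpow_of_nonneg _ _ hr0.le] at h2
  rw [lintegral_const_mul _ (by fun_prop)] at h2
  have h3 : (∫⁻ s, (∫⁻ t, a t * ker γ 0 (t - s)) ^ r) ≤ L ^ r * C := by
    calc _ = L ^ r * (L⁻¹ ^ r * ∫⁻ s, (∫⁻ t, a t * ker γ 0 (t - s)) ^ r) := by
          rw [← mul_assoc, ← ENNReal.mul_rpow_of_nonneg _ _ hr0.le, ENNReal.mul_inv_cancel h0 h1]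
          simp
      _ ≤ L ^ r * C := by gcongr
  calc _ ≤ (L ^ r * C) ^ (1 / r) := by gcongr
    _ = C ^ (1 / r) * L := by
      rw [ENNReal.mul_rpow_of_nonneg _ _ (by positivity), ← ENNReal.rpow_mul,
        mul_one_div_cancel hr0.ne', ENNReal.rpow_one, mul_comm]
    _ ≤ _ := by gcongr; exact le_self_add

end HardyLittlewoodSobolev

/-! ### Propagation of a bound over one period -/

section Period

/-- An `L^r` bound on one period extends to an exponentially weighted bound on a half line, for
quantities propagated by an exponentially decaying semigroup. -/
lemma exists_lintegral_Ioi_le_of_period {X : Type*} {N : X → ℝ≥0∞} {T : ℝ → X → X}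
    {κ : ℝ → X → ℝ≥0∞} {r ω c a d : ℝ} {M C : ℝ≥0∞} (hr : 0 < r) (hc : 0 ≤ c) (hcω : c < ω)
    (hd : 0 < d) (hM : M ≠ ∞) (hC : C ≠ ∞)
    (hκ : ∀ τ σ x, a < τ → 0 ≤ σ → κ (τ + σ) x = κ τ (T σ x))
    (hN : ∀ σ x, 0 ≤ σ → N (T σ x) ≤ M * ENNReal.ofReal (Real.exp (-(ω * σ))) * N x)
    (hb : ∀ x, ∫⁻ τ in Ioc a (a + d), κ τ x ^ r ≤ C * N x ^ r) :
    ∃ C' : ℝ≥0∞, C' ≠ ∞ ∧ ∀ x,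
      ∫⁻ τ in Ioi a, (κ τ x * ENNReal.ofReal (Real.exp (c * τ))) ^ r ≤ C' * N x ^ r := by
  -- The ratio of the geometric series: per period the weight contributes e^{cdr} and the semigroup
  -- e^{-ωdr}.
  set ξ : ℝ≥0∞ := ENNReal.ofReal (Real.exp (-((ω - c) * d * r))) with hξ
  have hξ1 : ξ < 1 := by
    have : 0 < ω - c := by linarith
    rw [hξ, ENNReal.ofReal_lt_one, Real.exp_lt_one_iff, Left.neg_neg_iff]
    positivity
  set D : ℝ≥0∞ := ENNReal.ofReal (Real.exp (c * (a + d) * r)) * (C * M ^ r) with hD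
  have hD' : D ≠ ∞ := ENNReal.mul_ne_top (by simp)
    (ENNReal.mul_ne_top hC (ENNReal.rpow_ne_top_of_nonneg hr.le hM))
  refine ⟨D * (1 - ξ)⁻¹, ENNReal.mul_ne_top hD'
    (ENNReal.inv_ne_top.2 (tsub_pos_of_lt hξ1).ne'), fun x => ?_⟩
  have hU : Ioi a ⊆ ⋃ n : ℕ, Ioc (a + n * d) (a + n * d + d) := by
    intro τ hτ
    have hτ : a < τ := hτ
    have h0 : 0 < (τ - a) / d := div_pos (by linarith) hd
    obtain ⟨n, hn⟩ : ∃ n : ℕ, ⌈(τ - a) / d⌉₊ = n + 1 :=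
      Nat.exists_eq_succ_of_ne_zero (Nat.ceil_pos.2 h0).ne'
    have h1 := Nat.le_ceil ((τ - a) / d)
    have h2 := Nat.ceil_lt_add_one h0.le
    rw [hn] at h1 h2
    push_cast at h1 h2
    rw [div_le_iff₀ hd] at h1
    have h3 : (n : ℝ) < (τ - a) / d := by linarith
    rw [lt_div_iff₀ hd] at h3
    exact mem_iUnion.2 ⟨n, by linarith, by linarith⟩
  have hn : ∀ n : ℕ, ∫⁻ τ in Ioc (a + n * d) (a + n * d + d),
      (κ τ x * ENNReal.ofReal (Real.exp (c * τ))) ^ r ≤ D * ξ ^ n * N x ^ r := by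
    intro n
    have hnd : 0 ≤ n * d := by positivity
    have e1 : ∫⁻ τ in Ioc (a + n * d) (a + n * d + d), κ τ x ^ r =
        ∫⁻ τ in Ioc a (a + d), κ (τ + n * d) x ^ r := by
      have := (measurePreserving_add_right volume (n * d : ℝ)).setLIntegral_comp_preimage_emb
        (measurableEmbedding_addRight _) (fun τ => κ τ x ^ r) (Ioc (a + n * d) (a + n * d + d))
      rw [← this, preimage_add_const_Ioc]
      congr 2
      · congr 1 <;> ring
    have e2 : ∫⁻ τ in Ioc a (a + d), κ (τ + n * d) x ^ r ≤
        C * (M * ENNReal.ofReal (Real.exp (-(ω * (n * d)))) * N x) ^ r := by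
      calc _ = ∫⁻ τ in Ioc a (a + d), κ τ (T (n * d) x) ^ r := by
            refine setLIntegral_congr_fun measurableSet_Ioc fun τ hτ => ?_
            simp only [hκ τ _ x hτ.1 hnd]
        _ ≤ C * N (T (n * d) x) ^ r := hb _
        _ ≤ _ := by gcongr; exact hN _ _ hnd
    calc _ ≤ ∫⁻ τ in Ioc (a + n * d) (a + n * d + d),
          ENNReal.ofReal (Real.exp (c * (a + n * d + d))) ^ r * κ τ x ^ r := by
          refine setLIntegral_mono' measurableSet_Ioc fun τ hτ => ?_
          rw [ENNReal.mul_rpow_of_nonneg _ _ hr.le, mul_comm]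
          gcongr
          exact hτ.2
      _ = ENNReal.ofReal (Real.exp (c * (a + n * d + d))) ^ r *
          ∫⁻ τ in Ioc (a + n * d) (a + n * d + d), κ τ x ^ r := by
          rw [lintegral_const_mul' _ _ (by finiteness)]
      _ ≤ ENNReal.ofReal (Real.exp (c * (a + n * d + d))) ^ r *
          (C * (M * ENNReal.ofReal (Real.exp (-(ω * (n * d)))) * N x) ^ r) := by
          rw [e1]; gcongr
      _ = _ := by
          rw [ENNReal.mul_rpow_of_nonneg _ _ hr.le, ENNReal.mul_rpow_of_nonneg _ _ hr.le,
            ENNReal.ofReal_rpow_of_nonneg (by positivity) hr.le,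
            ENNReal.ofReal_rpow_of_nonneg (by positivity) hr.le, ← Real.exp_mul, ← Real.exp_mul,
            hξ, ← ENNReal.ofReal_pow (by positivity), ← Real.exp_nat_mul, hD]
          have : Real.exp (c * (a + n * d + d) * r) * Real.exp (-(ω * (n * d)) * r) =
              Real.exp (c * (a + d) * r) * Real.exp (n * -((ω - c) * d * r)) := by
            rw [← Real.exp_add, ← Real.exp_add]; ring_nf
          have h6 : ENNReal.ofReal (Real.exp (c * (a + n * d + d) * r)) *
              ENNReal.ofReal (Real.exp (-(ω * (n * d)) * r)) =
              ENNReal.ofReal (Real.exp (c * (a + d) * r)) *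
              ENNReal.ofReal (Real.exp (n * -((ω - c) * d * r))) := by
            rw [← ENNReal.ofReal_mul (by positivity), ← ENNReal.ofReal_mul (by positivity), this]
          calc _ = (C * M ^ r * N x ^ r) * (ENNReal.ofReal (Real.exp (c * (a + n * d + d) * r)) *
              ENNReal.ofReal (Real.exp (-(ω * (n * d)) * r))) := by ring
            _ = _ := by rw [h6]; ring
  calc _ ≤ ∑' n : ℕ, ∫⁻ τ in Ioc (a + n * d) (a + n * d + d),
        (κ τ x * ENNReal.ofReal (Real.exp (c * τ))) ^ r :=
        (lintegral_mono_set hU).trans (lintegral_iUnion_le _ _)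
    _ ≤ ∑' n : ℕ, D * ξ ^ n * N x ^ r := ENNReal.tsum_le_tsum hn
    _ = _ := by rw [ENNReal.tsum_mul_right, ENNReal.tsum_mul_left, ENNReal.tsum_geometric]

end Period

/-! ## Negative fractional powers as bounded operators -/

section PowInt

variable {Y : Type*} [NormedAddCommGroup Y] [InnerProductSpace ℂ Y] {S : ℝ → Y →L[ℂ] Y}

lemma integrableOn_rpow_mul_exp {a ω : ℝ} (ha : 0 < a) (hω : 0 < ω) :
    IntegrableOn (fun t : ℝ => t ^ (a - 1) * Real.exp (-(ω * t))) (Ioi 0) := by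
  have h : IntegrableOn (fun x : ℝ => x ^ (a - 1) * Real.exp (-ω * x ^ (1 : ℝ))) (Ioi 0) :=
    integrableOn_rpow_mul_exp_neg_mul_rpow (by linarith) zero_lt_one hω
  simpa [neg_mul] using h

lemma IsC0Semigroup.aestronglyMeasurable (hS : IsC0Semigroup S) (y : Y) :
    AEStronglyMeasurable (fun t => S t y) (volume.restrict (Ioi 0)) :=
  ((hS.continuousOn y).mono Ioi_subset_Ici_self).aestronglyMeasurable measurableSet_Ioi

lemma IsC0Semigroup.aestronglyMeasurable_rpow_smul (hS : IsC0Semigroup S) (a : ℝ) (y : Y) :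
    AEStronglyMeasurable (fun t : ℝ => t ^ (a - 1) • S t y) (volume.restrict (Ioi 0)) := by
  have : Measurable fun t : ℝ => t ^ (a - 1) := by fun_prop
  exact this.aestronglyMeasurable.smul (hS.aestronglyMeasurable y)

lemma IsC0Semigroup.comm (hS : IsC0Semigroup S) {s t : ℝ} (hs : 0 ≤ s) (ht : 0 ≤ t) (y : Y) :
    S s (S t y) = S t (S s y) := by
  have h1 := hS.map_add s t hs ht
  rw [add_comm, hS.map_add t s ht hs] at h1
  exact (DFunLike.congr_fun h1 y).symm

lemma norm_rpow_smul_le {M ω a : ℝ} (hM : ∀ t : ℝ, 0 ≤ t → ‖S t‖ ≤ M * Real.exp (-(ω * t)))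
    {t : ℝ} (ht : 0 < t) (y : Y) :
    ‖t ^ (a - 1) • S t y‖ ≤ M * ‖y‖ * (t ^ (a - 1) * Real.exp (-(ω * t))) := by
  rw [norm_smul, Real.norm_of_nonneg (by positivity)]
  calc _ ≤ t ^ (a - 1) * (M * Real.exp (-(ω * t)) * ‖y‖) := by
        gcongr; exact (S t).le_of_opNorm_le (hM t ht.le) y
    _ = _ := by ring

lemma IsC0Semigroup.integrableOn_rpow_smul (hS : IsC0Semigroup S) (hE : IsExpStable S) {a : ℝ}
    (ha : 0 < a) (y : Y) : IntegrableOn (fun t : ℝ => t ^ (a - 1) • S t y) (Ioi 0) := by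
  obtain ⟨M, ω, -, hω, hM⟩ := hE
  refine Integrable.mono' ((integrableOn_rpow_mul_exp ha hω).const_mul (M * ‖y‖))
    (hS.aestronglyMeasurable_rpow_smul a y) ?_
  filter_upwards [ae_restrict_mem measurableSet_Ioi] with t ht
  exact norm_rpow_smul_le hM ht y

/-- The bounded operator `∫₀^∞ t^{a-1} S(t) dt = Γ(a) (-A)^{-a}`. -/
def powInt (hS : IsC0Semigroup S) (hE : IsExpStable S) {a : ℝ} (ha : 0 < a) : Y →L[ℂ] Y :=
  LinearMap.mkContinuousOfExistsBound
    { toFun := fun y => ∫ t in Ioi (0 : ℝ), t ^ (a - 1) • S t y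
      map_add' := fun x y => by
        rw [← integral_add (hS.integrableOn_rpow_smul hE ha x) (hS.integrableOn_rpow_smul hE ha y)]
        simp only [map_add, smul_add]
      map_smul' := fun c x => by
        rw [RingHom.id_apply, ← integral_smul c]
        congr 1
        funext t
        rw [map_smul]
        exact smul_comm _ c (S t x) } <| by
    obtain ⟨M, ω, -, hω, hM⟩ := id hE
    refine ⟨M * ∫ t in Ioi (0 : ℝ), t ^ (a - 1) * Real.exp (-(ω * t)), fun y => ?_⟩
    refine (norm_integral_le_of_norm_le
      ((integrableOn_rpow_mul_exp ha hω).const_mul (M * ‖y‖)) ?_).trans (le_of_eq ?_)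
    · filter_upwards [ae_restrict_mem measurableSet_Ioi] with t ht
      exact norm_rpow_smul_le hM ht y
    · rw [integral_const_mul]; ring

lemma powInt_apply (hS : IsC0Semigroup S) (hE : IsExpStable S) {a : ℝ} (ha : 0 < a) (y : Y) :
    powInt hS hE ha y = ∫ t in Ioi (0 : ℝ), t ^ (a - 1) • S t y := rfl

lemma mem_negPow_domain (hS : IsC0Semigroup S) (hE : IsExpStable S) {a : ℝ} (ha : 0 < a) (x : Y) :
    x ∈ (negPow S a).domain :=
  hS.integrableOn_rpow_smul hE ha x

lemma negPow_apply_eq (hS : IsC0Semigroup S) (hE : IsExpStable S) {a : ℝ} (ha : 0 < a)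
    (x : (negPow S a).domain) : negPow S a x = (Real.Gamma a)⁻¹ • powInt hS hE ha x := rfl

variable [CompleteSpace Y]

lemma powInt_comm (hS : IsC0Semigroup S) (hE : IsExpStable S) {a : ℝ} (ha : 0 < a)
    {Q : Y →L[ℂ] Y} (hQ : ∀ t, 0 ≤ t → ∀ y, Q (S t y) = S t (Q y)) (y : Y) :
    Q (powInt hS hE ha y) = powInt hS hE ha (Q y) := by
  rw [powInt_apply, powInt_apply, ← Q.integral_comp_comm (hS.integrableOn_rpow_smul hE ha y)]
  refine setIntegral_congr_fun measurableSet_Ioi fun t ht => ?_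
  simp only [Q.map_smul_of_tower, hQ t (le_of_lt ht)]

/-- Applying S(h) shifts ∫_0^∞ S(t)y dt to ∫_h^∞. This identity drives everything about the exponent
1, where `powInt` is (-A)^{-1}. -/
lemma semigroup_powInt_one_sub (hS : IsC0Semigroup S) (hE : IsExpStable S) {h : ℝ} (hh : 0 ≤ h)
    (y : Y) : S h (powInt hS hE one_pos y) - powInt hS hE one_pos y = -∫ t in (0 : ℝ)..h, S t y := by
  have hi : IntegrableOn (fun t => S t y) (Ioi 0) := by
    simpa using hS.integrableOn_rpow_smul hE one_pos y
  have e0 : powInt hS hE one_pos y = ∫ t in Ioi (0 : ℝ), S t y := by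
    simp [powInt_apply]
  have e1 : S h (powInt hS hE one_pos y) = ∫ t in Ioi h, S t y := by
    rw [e0, ← (S h).integral_comp_comm hi]
    have := (measurePreserving_add_right volume h).setIntegral_preimage_emb
      (measurableEmbedding_addRight _) (fun t => S t y) (Ioi h)
    rw [← this, preimage_add_const_Ioi, sub_self]
    refine setIntegral_congr_fun measurableSet_Ioi fun t ht => ?_
    have ht : 0 < t := ht
    simp only [hS.map_add t h ht.le hh, ContinuousLinearMap.comp_apply]
    exact hS.comm hh ht.le y
  rw [e1, e0, intervalIntegral.integral_of_le hh, ← Ioc_union_Ioi_eq_Ioi hh,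
    setIntegral_union (Ioc_disjoint_Ioi le_rfl) measurableSet_Ioi
      (hi.mono_set Ioc_subset_Ioi_self) (hi.mono_set (Ioi_subset_Ioi hh))]
  abel

lemma tendsto_inv_smul_integral (hS : IsC0Semigroup S) (y : Y) :
    Tendsto (fun h : ℝ => h⁻¹ • ∫ t in (0 : ℝ)..h, S t y) (𝓝[>] 0) (𝓝 y) := by
  have h1 : HasDerivWithinAt (fun u => ∫ x in (0 : ℝ)..u, S x y) (S 0 y) (Ici 0) 0 := by
    refine intervalIntegral.integral_hasDerivWithinAt_right (t := Ioi 0) (by simp) ?_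
      ((hS.continuousOn y 0 self_mem_Ici).mono Ioi_subset_Ici_self)
    exact ⟨Ioi 0, self_mem_nhdsWithin, hS.aestronglyMeasurable y⟩
  have h2 := (hasDerivWithinAt_iff_tendsto_slope.1 h1)
  rw [Ici_sdiff_left, hS.map_zero] at h2
  refine h2.congr fun h => ?_
  simp [slope_def_module]

/-- If the image of y vanishes, the shift identity gives ∫_0^h S(t)y dt = 0 for all h > 0, while
h^{-1} times these integrals tends to y. -/
lemma powInt_one_injective (hS : IsC0Semigroup S) (hE : IsExpStable S) :
    Function.Injective (powInt hS hE one_pos) := by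
  rw [injective_iff_map_eq_zero]
  intro y hy
  refine tendsto_nhds_unique (tendsto_inv_smul_integral hS y) (tendsto_const_nhds.congr' ?_)
  filter_upwards [self_mem_nhdsWithin] with h hh
  have := semigroup_powInt_one_sub hS hE (le_of_lt hh) y
  rw [hy, map_zero, sub_zero] at this
  rw [neg_eq_zero.1 this.symm, smul_zero]

/-- The integrand is the density of the Beta distribution times its normalizing constant, and a
density has mass one. -/
lemma integral_beta_kernel {a b : ℝ} (ha : 0 < a) (hb : 0 < b) :
    ∫ t : ℝ, (Ioi (0 : ℝ)).indicator (fun t => t ^ (a - 1)) t *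
      (Ioi (0 : ℝ)).indicator (fun t => t ^ (b - 1)) (1 - t) = ProbabilityTheory.beta a b := by
  have hB := ProbabilityTheory.beta_pos ha hb
  have h1 := ProbabilityTheory.lintegral_betaPDF_eq_one ha hb
  have h2 : ∫ t, ProbabilityTheory.betaPDFReal a b t = 1 := by
    rw [integral_eq_lintegral_of_nonneg_ae
      (Eventually.of_forall fun t => ?_)
      (ProbabilityTheory.measurable_betaPDFReal a b).aestronglyMeasurable]
    · simp only [ProbabilityTheory.betaPDF] at h1
      rw [h1]; simp
    · by_cases ht : 0 < t ∧ t < 1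
      · exact (ProbabilityTheory.betaPDFReal_pos ht.1 ht.2 ha hb).le
      · simp [ProbabilityTheory.betaPDFReal, ht]
  have h3 : ∀ t, (Ioi (0 : ℝ)).indicator (fun t => t ^ (a - 1)) t *
      (Ioi (0 : ℝ)).indicator (fun t => t ^ (b - 1)) (1 - t) =
      ProbabilityTheory.beta a b * ProbabilityTheory.betaPDFReal a b t := by
    intro t
    simp only [indicator_apply, mem_Ioi, sub_pos, ProbabilityTheory.betaPDFReal]
    by_cases h1 : 0 < t <;> by_cases h2 : t < 1 <;> simp [h1, h2]
    field_simp
  simp only [h3]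
  rw [integral_const_mul, h2, mul_one]

lemma integral_beta_kernel_scaled {a b u : ℝ} (ha : 0 < a) (hb : 0 < b) (hu : 0 < u) :
    ∫ t : ℝ, (Ioi (0 : ℝ)).indicator (fun t => t ^ (a - 1)) t *
      (Ioi (0 : ℝ)).indicator (fun t => t ^ (b - 1)) (u - t) =
      ProbabilityTheory.beta a b * u ^ (a + b - 1) := by
  have h1 := Measure.integral_comp_mul_left (fun t : ℝ =>
    (Ioi (0 : ℝ)).indicator (fun t => t ^ (a - 1)) t *
      (Ioi (0 : ℝ)).indicator (fun t => t ^ (b - 1)) (u - t)) u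
  have h2 : ∀ t : ℝ, (Ioi (0 : ℝ)).indicator (fun t => t ^ (a - 1)) (u * t) *
      (Ioi (0 : ℝ)).indicator (fun t => t ^ (b - 1)) (u - u * t) = u ^ (a + b - 1 - 1) *
      ((Ioi (0 : ℝ)).indicator (fun t => t ^ (a - 1)) t *
      (Ioi (0 : ℝ)).indicator (fun t => t ^ (b - 1)) (1 - t)) := by
    intro t
    have e1 : 0 < u * t ↔ 0 < t := by simp [hu]
    have e2 : 0 < u - u * t ↔ 0 < 1 - t := by rw [← mul_one_sub]; simp [hu]
    simp only [indicator_apply, mem_Ioi, e1, e2]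
    by_cases h1 : 0 < t <;> by_cases h2 : 0 < 1 - t <;> simp only [h1, h2, if_true, if_false,
      mul_zero, zero_mul]
    rw [← mul_one_sub, Real.mul_rpow hu.le h1.le, Real.mul_rpow hu.le h2.le,
      show a + b - 1 - 1 = (a - 1) + (b - 1) by ring, Real.rpow_add hu]
    ring
  simp only [h2] at h1
  rw [integral_const_mul, integral_beta_kernel ha hb, abs_of_pos (inv_pos.2 hu), smul_eq_mul,
    Real.rpow_sub_one hu.ne'] at h1
  field_simp at h1
  linarith

/-- The composition law for negative powers. -/
lemma powInt_powInt (hS : IsC0Semigroup S) (hE : IsExpStable S) {a b : ℝ} (ha : 0 < a)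
    (hb : 0 < b) (y : Y) : powInt hS hE ha (powInt hS hE hb y) =
      ProbabilityTheory.beta a b • powInt hS hE (add_pos ha hb) y := by
  obtain ⟨M, ω, hM1, hω, hM⟩ := id hE
  set g₁ : ℝ → ℝ := (Ioi (0 : ℝ)).indicator (fun t => t ^ (a - 1)) with hg₁
  set g₂ : ℝ → ℝ := (Ioi (0 : ℝ)).indicator (fun t => t ^ (b - 1)) with hg₂
  set v : ℝ → Y := (Ioi (0 : ℝ)).indicator (fun t => S t y) with hv
  have hg₁m : Measurable g₁ := Measurable.indicator (by fun_prop) measurableSet_Ioi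
  have hg₂m : Measurable g₂ := Measurable.indicator (by fun_prop) measurableSet_Ioi
  have hvm : AEStronglyMeasurable v volume :=
    (aestronglyMeasurable_indicator_iff measurableSet_Ioi).2 (hS.aestronglyMeasurable y)
  have hi : ∀ {e : ℝ}, 0 < e → Integrable fun t : ℝ =>
      (Ioi (0 : ℝ)).indicator (fun t => t ^ (e - 1) * Real.exp (-(ω * t))) t := fun he =>
    (integrable_indicator_iff measurableSet_Ioi).2 (integrableOn_rpow_mul_exp he hω)
  -- The majorant: e^{-ωu} splits as e^{-ωt} e^{-ω(u-t)}, so the double integrand is dominated by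
  -- that of a convolution of two integrable functions.
  have hconv := ((hi ha).convolution_integrand (ContinuousLinearMap.mul ℝ ℝ) (hi hb)).const_mul
    (M * ‖y‖)
  have hG : Integrable (fun z : ℝ × ℝ => (g₁ z.2 * g₂ (z.1 - z.2)) • v z.1)
      (volume.prod volume) := by
    refine hconv.mono' ?_ (Eventually.of_forall fun z => ?_)
    · have : Measurable fun z : ℝ × ℝ => g₁ z.2 * g₂ (z.1 - z.2) := by fun_prop
      exact this.aestronglyMeasurable.smul hvm.comp_fst
    · simp only [hg₁, hg₂, hv, indicator_apply, mem_Ioi, ContinuousLinearMap.mul_apply']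
      by_cases h1 : 0 < z.2 <;> by_cases h2 : 0 < z.1 - z.2 <;>
        simp only [h1, h2, if_true, if_false, mul_zero, zero_mul, zero_smul, norm_zero, le_refl]
      have h3 : 0 < z.1 := by linarith
      simp only [h3, if_true]
      rw [norm_smul, Real.norm_of_nonneg (by positivity)]
      calc _ ≤ z.2 ^ (a - 1) * (z.1 - z.2) ^ (b - 1) * (M * Real.exp (-(ω * z.1)) * ‖y‖) := by
            gcongr; exact (S _).le_of_opNorm_le (hM _ h3.le) y
        _ = _ := by
            have : Real.exp (-(ω * z.1)) = Real.exp (-(ω * z.2)) *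
                Real.exp (-(ω * (z.1 - z.2))) := by
              rw [← Real.exp_add]; ring_nf
            rw [this]; ring
  -- Integrating in t first produces the Beta integral in front of S(u)y; integrating in u first,
  -- with u = s + t, produces the composition of the two operators.
  have hswap := integral_integral_swap (f := fun u t : ℝ => (g₁ t * g₂ (u - t)) • v u) hG
  have hL : ∫ u, ∫ t, (g₁ t * g₂ (u - t)) • v u =
      ProbabilityTheory.beta a b • powInt hS hE (add_pos ha hb) y := by
    rw [powInt_apply, ← integral_smul, ← integral_indicator measurableSet_Ioi]
    refine integral_congr_ae (Eventually.of_forall fun u => ?_)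
    simp only []
    rw [integral_smul_const]
    by_cases hu : 0 < u
    · rw [integral_beta_kernel_scaled ha hb hu]
      simp only [hv, indicator_of_mem (mem_Ioi.2 hu), mul_smul]
    · simp [hv, hu]
  have hR : ∫ t, ∫ u, (g₁ t * g₂ (u - t)) • v u = powInt hS hE ha (powInt hS hE hb y) := by
    rw [powInt_apply, ← integral_indicator measurableSet_Ioi]
    refine integral_congr_ae (Eventually.of_forall fun t => ?_)
    simp only []
    by_cases ht : 0 < t
    · have e1 : g₁ t = t ^ (a - 1) := indicator_of_mem (mem_Ioi.2 ht) _
      rw [indicator_of_mem (mem_Ioi.2 ht), e1]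
      simp only [mul_smul]
      rw [integral_smul, powInt_apply, ← (S t).integral_comp_comm
        (hS.integrableOn_rpow_smul hE hb y), ← integral_indicator measurableSet_Ioi,
        ← integral_add_right_eq_self _ t]
      congr 1
      refine integral_congr_ae (Eventually.of_forall fun s => ?_)
      simp only [add_sub_cancel_right]
      by_cases hs : 0 < s
      · have e2 : g₂ s = s ^ (b - 1) := indicator_of_mem (mem_Ioi.2 hs) _
        rw [indicator_of_mem (mem_Ioi.2 hs), e2, hv, indicator_of_mem (mem_Ioi.2 (add_pos hs ht)),
          (S t).map_smul_of_tower, hS.map_add s t hs.le ht.le, ContinuousLinearMap.comp_apply,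
          hS.comm hs.le ht.le]
      · simp [hg₂, hs]
    · simp [hg₁, ht]
  rw [← hL, ← hR, hswap]

/-- Integer exponents follow by induction from the exponent 1. For general a, composing with the
exponent n + 1 - a gives a positive multiple of the operator of exponent n + 1, which is injective.
-/
lemma powInt_injective (hS : IsC0Semigroup S) (hE : IsExpStable S) {a : ℝ} (ha : 0 < a) :
    Function.Injective (powInt hS hE ha) := by
  have hnat : ∀ n : ℕ, ∀ hn : (0 : ℝ) < n + 1, ∀ y, powInt hS hE hn y = 0 → y = 0 := by
    intro n
    induction n with
    | zero =>
      intro hn y hy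
      refine (injective_iff_map_eq_zero _).1 (powInt_one_injective hS hE) y ?_
      simpa [powInt_apply] using hy
    | succ n ih =>
      intro hn y hy
      have hn' : (0 : ℝ) < n + 1 := by positivity
      have h1 := powInt_powInt hS hE hn' one_pos y
      have h2 : powInt hS hE (add_pos hn' one_pos) y = 0 := by
        rw [← hy, powInt_apply, powInt_apply]; push_cast; rfl
      rw [h2, smul_zero] at h1
      exact (injective_iff_map_eq_zero _).1 (powInt_one_injective hS hE) y (ih hn' _ h1)
  rw [injective_iff_map_eq_zero]
  intro y hy
  obtain ⟨n, hn⟩ := exists_nat_gt a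
  have hb : 0 < n + 1 - a := by linarith
  have h1 := powInt_powInt hS hE hb ha y
  rw [hy, map_zero] at h1
  have h2 := (smul_eq_zero.1 h1.symm).resolve_left (ProbabilityTheory.beta_pos hb ha).ne'
  refine hnat n (by positivity) y ?_
  rw [← h2, powInt_apply, powInt_apply, sub_add_cancel]

/-! ## Domains of the fractional powers -/

/-- The graph of `(-A)^a` consists of the pairs `((-A)^{-a} y, y)`. -/
lemma mem_graph_fracPow (hS : IsC0Semigroup S) (hE : IsExpStable S) {a : ℝ} (ha : 0 < a)
    {z : Y × Y} : z ∈ (fracPow S a).graph ↔ z.1 = (Real.Gamma a)⁻¹ • powInt hS hE ha z.2 := by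
  have hΓ : (Real.Gamma a)⁻¹ ≠ 0 := (inv_pos.2 (Real.Gamma_pos_of_pos ha)).ne'
  have hker : (negPow S a).toFun.ker = ⊥ := by
    rw [LinearMap.ker_eq_bot']
    intro x hx
    have h1 : (Real.Gamma a)⁻¹ • powInt hS hE ha (x : Y) = 0 := hx
    have h2 := (smul_eq_zero.1 h1).resolve_left hΓ
    exact Subtype.ext ((injective_iff_map_eq_zero _).1 (powInt_injective hS hE ha) _ h2)
  rw [fracPow, LinearPMap.inverse_graph hker]
  constructor
  · rintro ⟨⟨x, w⟩, hxw, rfl⟩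
    obtain ⟨x', rfl, rfl⟩ := LinearPMap.mem_graph_iff _ |>.1 hxw
    exact negPow_apply_eq hS hE ha x'
  · intro hz
    refine ⟨(z.2, z.1), ?_, rfl⟩
    refine (LinearPMap.mem_graph_iff _).2 ⟨⟨z.2, mem_negPow_domain hS hE ha _⟩, rfl, ?_⟩
    rw [hz]; rfl

end PowInt

/-! ## Generators and adjoint semigroups -/

section Generator

variable {Y : Type*} [NormedAddCommGroup Y] [InnerProductSpace ℂ Y] {S : ℝ → Y →L[ℂ] Y}
  {A : Y →ₗ.[ℂ] Y}

lemma IsGenerator.map_mem_graph (hA : IsGenerator A S) {Q : Y →L[ℂ] Y}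
    (hQ : ∀ t, 0 ≤ t → ∀ y, Q (S t y) = S t (Q y)) {z : Y × Y} (hz : z ∈ A.graph) :
    (Q z.1, Q z.2) ∈ A.graph := by
  rw [hA]
  have h := (Q.continuous.tendsto _).comp ((hA z.1 z.2).1 hz)
  refine h.congr' ?_
  filter_upwards [self_mem_nhdsWithin] with r hr
  simp only [Function.comp_apply]
  rw [Q.map_smul_of_tower, map_sub, hQ r (le_of_lt hr)]

variable [CompleteSpace Y]

lemma powInt_one_mem_graph (hS : IsC0Semigroup S) (hE : IsExpStable S) (hA : IsGenerator A S)
    (y : Y) : (powInt hS hE one_pos y, -y) ∈ A.graph := by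
  rw [hA]
  refine (tendsto_inv_smul_integral hS y).neg.congr' ?_
  filter_upwards [self_mem_nhdsWithin] with h hh
  rw [semigroup_powInt_one_sub hS hE (le_of_lt hh), smul_neg]

lemma semigroup_powInt (hS : IsC0Semigroup S) (hE : IsExpStable S) {a : ℝ} (ha : 0 < a) {t : ℝ}
    (ht : 0 ≤ t) (y : Y) : S t (powInt hS hE ha y) = powInt hS hE ha (S t y) :=
  powInt_comm hS hE ha (fun _ hs _ => hS.comm ht hs _) y

/-- The averages h^{-1} ∫_0^h S(t)y dt tend to y, and by the shift identity they lie in the range of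
(-A)^{-1}, hence in D(A). -/
lemma dense_domain (hS : IsC0Semigroup S) (hE : IsExpStable S) (hA : IsGenerator A S) :
    Dense (A.domain : Set Y) := by
  intro y
  refine mem_closure_of_tendsto (tendsto_inv_smul_integral hS y) ?_
  filter_upwards [self_mem_nhdsWithin] with h hh
  have h1 := semigroup_powInt_one_sub hS hE (le_of_lt hh) y
  rw [semigroup_powInt hS hE one_pos (le_of_lt hh), ← map_sub] at h1
  have h2 := LinearPMap.mem_domain_of_mem_graph
    (powInt_one_mem_graph hS hE hA (S h y - y))
  rw [h1, Submodule.neg_mem_iff] at h2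
  exact A.domain.smul_of_tower_mem _ h2

lemma mem_graph_adjoint (hd : Dense (A.domain : Set Y)) {z : Y × Y} :
    z ∈ A.adjoint.graph ↔ ∀ u ∈ A.graph, ⟪u.2, z.1⟫_ℂ = ⟪u.1, z.2⟫_ℂ := by
  rw [LinearPMap.adjoint_graph_eq_graph_adjoint hd, Submodule.mem_adjoint_iff]
  simp only [sub_eq_zero]
  exact ⟨fun h u hu => h _ _ hu, fun h a b hu => h _ hu⟩

variable (hS : IsC0Semigroup S) (hE : IsExpStable S) (hA : IsGenerator A S)
include hS hE hA

lemma adjoint_map_mem_graph {Q : Y →L[ℂ] Y} (hQ : ∀ t, 0 ≤ t → ∀ y, Q (S t y) = S t (Q y))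
    {z : Y × Y} (hz : z ∈ A.adjoint.graph) :
    (ContinuousLinearMap.adjoint Q z.1, ContinuousLinearMap.adjoint Q z.2) ∈ A.adjoint.graph := by
  rw [mem_graph_adjoint (dense_domain hS hE hA)] at hz ⊢
  intro u hu
  simp only [ContinuousLinearMap.adjoint_inner_right]
  exact hz _ (hA.map_mem_graph hQ hu)

/-- Together with the next lemma this identifies the adjoint of (-A)^{-1} with (-A^*)^{-1}, without
first knowing that A^* generates the adjoint semigroup. -/
lemma adjoint_powInt_one_mem_graph (w : Y) :
    (ContinuousLinearMap.adjoint (powInt hS hE one_pos) w, -w) ∈ A.adjoint.graph := by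
  rw [mem_graph_adjoint (dense_domain hS hE hA)]
  intro u hu
  rw [ContinuousLinearMap.adjoint_inner_right]
  have h1 := hA.map_mem_graph
    (fun t ht y => (semigroup_powInt hS hE one_pos ht y).symm) hu
  have h2 := powInt_one_mem_graph hS hE hA u.1
  have h3 := A.mem_graph_snd_inj h1 h2 rfl
  rw [h3, inner_neg_left, inner_neg_right]

lemma adjoint_powInt_one_of_mem_graph {z : Y × Y} (hz : z ∈ A.adjoint.graph) :
    ContinuousLinearMap.adjoint (powInt hS hE one_pos) z.2 = -z.1 := by
  refine ext_inner_left ℂ fun y => ?_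
  rw [ContinuousLinearMap.adjoint_inner_right,
    ← (mem_graph_adjoint (dense_domain hS hE hA)).1 hz _ (powInt_one_mem_graph hS hE hA y)]
  simp

omit hA in
-- The orthogonal complement of the range of an adjoint is the kernel of the operator, which is
-- trivial here.
lemma denseRange_adjoint_powInt {a : ℝ} (ha : 0 < a) :
    DenseRange (ContinuousLinearMap.adjoint (powInt hS hE ha)) := by
  have h := ContinuousLinearMap.orthogonal_range (ContinuousLinearMap.adjoint (powInt hS hE ha))
  rw [ContinuousLinearMap.adjoint_adjoint,
    LinearMap.ker_eq_bot.2 (powInt_injective hS hE ha)] at h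
  have := (Submodule.topologicalClosure_eq_top_iff
    (K := (ContinuousLinearMap.adjoint (powInt hS hE ha)).range)).2 h
  exact (Submodule.dense_iff_topologicalClosure_eq_top.2 this)

lemma denseRange_val_adjoint : DenseRange (Dom.val A.adjoint) := by
  refine (denseRange_adjoint_powInt hS hE one_pos).mono ?_
  rintro _ ⟨w, rfl⟩
  exact ⟨⟨_, adjoint_powInt_one_mem_graph hS hE hA w⟩, rfl⟩

omit hS hA in
lemma isExpStable_adjSemigroup : IsExpStable (adjSemigroup S) := by
  obtain ⟨M, ω, h1, h2, h3⟩ := hE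
  refine ⟨M, ω, h1, h2, fun t ht => ?_⟩
  rw [adjSemigroup, LinearIsometryEquiv.norm_map]
  exact h3 t ht

omit hA in
-- Only strong continuity needs an argument. With R = (-A)^{-1}, the shift identity makes t ↦ R S(t)
-- Lipschitz in operator norm, and taking adjoints preserves this. So the orbits of S(t)^* are
-- continuous on the dense range of R^*, and the uniform bound M extends this to all of Y.
lemma isC0Semigroup_adjSemigroup : IsC0Semigroup (adjSemigroup S) := by
  obtain ⟨M, ω, hM1, hω, hM⟩ := id hE
  have hM' : ∀ t : ℝ, 0 ≤ t → ‖S t‖ ≤ M := fun t ht => (hM t ht).trans (by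
    refine mul_le_of_le_one_right (by linarith) ?_
    rw [Real.exp_le_one_iff, Left.neg_nonpos_iff]; positivity)
  refine ⟨?_, fun s t hs ht => ?_, fun x => ?_⟩
  · rw [adjSemigroup, hS.map_zero]
    exact ContinuousLinearMap.adjoint_id
  · simp only [adjSemigroup]
    rw [add_comm, hS.map_add t s ht hs, ContinuousLinearMap.adjoint_comp]
  set R := powInt hS hE one_pos with hR
  have hlip : ∀ s t : ℝ, 0 ≤ s → s ≤ t → ‖R.comp (S t) - R.comp (S s)‖ ≤ M * M * (t - s) := by
    intro s t hs hst
    have hts : 0 ≤ t - s := by linarith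
    refine ContinuousLinearMap.opNorm_le_bound _ (by positivity) fun y => ?_
    have h1 := semigroup_powInt_one_sub hS hE hts (S s y)
    rw [semigroup_powInt hS hE one_pos hts] at h1
    have h2 : S (t - s) (S s y) = S t y := by
      rw [← ContinuousLinearMap.comp_apply, ← hS.map_add _ _ hts hs, sub_add_cancel]
    rw [h2] at h1
    change ‖R (S t y) - R (S s y)‖ ≤ _
    rw [h1, norm_neg]
    refine (intervalIntegral.norm_integral_le_of_norm_le_const (C := M * (M * ‖y‖))
      fun r hr => ?_).trans (le_of_eq ?_)
    · rw [uIoc_of_le hts] at hr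
      refine (S r).le_of_opNorm_le_of_le (hM' r hr.1.le) ?_
      exact (S s).le_of_opNorm_le (hM' s hs) y
    · rw [sub_zero, abs_of_nonneg hts]; ring
  have hcont : ContinuousOn (fun t => R.comp (S t)) (Ici 0) := by
    have : LipschitzOnWith (M * M).toNNReal (fun t => R.comp (S t)) (Ici 0) := by
      refine LipschitzOnWith.of_dist_le_mul fun t ht s hs => ?_
      rw [Real.coe_toNNReal _ (by positivity), dist_eq_norm, Real.dist_eq]
      rcases le_total s t with h | h
      · rw [abs_of_nonneg (sub_nonneg.2 h)]
        exact hlip s t hs h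
      · rw [abs_sub_comm, abs_of_nonneg (sub_nonneg.2 h), norm_sub_rev]
        exact hlip t s ht h
    exact this.continuousOn
  have hcont' : ∀ w, ContinuousOn (fun t => adjSemigroup S t (ContinuousLinearMap.adjoint R w))
      (Ici 0) := by
    intro w
    have h1 := (ContinuousLinearMap.adjoint (𝕜 := ℂ) (E := Y) (F := Y)).continuous.comp_continuousOn
      hcont
    refine (h1.clm_apply continuousOn_const (g := fun _ => w)).congr fun t _ => ?_
    simp [adjSemigroup, ContinuousLinearMap.adjoint_comp]
  refine continuousOn_of_uniform_approx_of_continuousOn fun u hu => ?_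
  obtain ⟨δ, hδ, hδu⟩ := Metric.mem_uniformity_dist.1 hu
  have hMδ : 0 < δ / M := by positivity
  obtain ⟨w, hw⟩ := Metric.denseRange_iff.1 (denseRange_adjoint_powInt hS hE one_pos) x _ hMδ
  refine ⟨_, hcont' w, fun t ht => hδu ?_⟩
  rw [dist_eq_norm, ← map_sub]
  have h1 : ‖adjSemigroup S t‖ ≤ M := by
    rw [adjSemigroup, LinearIsometryEquiv.norm_map]; exact hM' t ht
  refine ((adjSemigroup S t).le_of_opNorm_le h1 _).trans_lt ?_
  rw [dist_eq_norm, lt_div_iff₀ (by linarith)] at hw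
  rwa [mul_comm]

omit hA in
lemma adjoint_powInt {a : ℝ} (ha : 0 < a) : ContinuousLinearMap.adjoint (powInt hS hE ha) =
    powInt (isC0Semigroup_adjSemigroup hS hE) (isExpStable_adjSemigroup hE) ha := by
  ext y
  refine ext_inner_left ℂ fun x => ?_
  rw [ContinuousLinearMap.adjoint_inner_right, powInt_apply, powInt_apply,
    ← integral_inner ((isC0Semigroup_adjSemigroup hS hE).integrableOn_rpow_smul
      (isExpStable_adjSemigroup hE) ha y), ← inner_conj_symm,
    ← integral_inner (hS.integrableOn_rpow_smul hE ha x), ← integral_conj]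
  refine integral_congr_ae (Eventually.of_forall fun t => ?_)
  simp only [inner_conj_symm, adjSemigroup]
  rw [← Complex.coe_smul, ← Complex.coe_smul, inner_smul_left, inner_smul_right,
    Complex.conj_ofReal, ContinuousLinearMap.adjoint_inner_right]

end Generator

/-! ### Restriction of bounded operators to a domain with graph norm -/

section DomMap

variable {Y : Type*} [NormedAddCommGroup Y] [InnerProductSpace ℂ Y]

/-- The restriction to `D(C)` of a bounded operator commuting with `C`. -/
def Dom.map {C : Y →ₗ.[ℂ] Y} (Q : Y →L[ℂ] Y) (hQ : ∀ z ∈ C.graph, (Q z.1, Q z.2) ∈ C.graph) :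
    Dom C →L[ℂ] Dom C :=
  (Q.prodMap Q).restrict hQ

variable {C : Y →ₗ.[ℂ] Y} {Q : Y →L[ℂ] Y} (hQ : ∀ z ∈ C.graph, (Q z.1, Q z.2) ∈ C.graph)

lemma Dom.val_map (z : Dom C) : Dom.val C (Dom.map Q hQ z) = Q (Dom.val C z) := rfl

lemma Dom.op_map (z : Dom C) : Dom.op C (Dom.map Q hQ z) = Q (Dom.op C z) := rfl

lemma Dom.norm_eq (z : Dom C) : ‖z‖ = max ‖Dom.val C z‖ ‖Dom.op C z‖ := rfl

lemma Dom.norm_map_le {M : ℝ} (hM : ‖Q‖ ≤ M) (z : Dom C) : ‖Dom.map Q hQ z‖ ≤ M * ‖z‖ := by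
  have hM0 : 0 ≤ M := (norm_nonneg _).trans hM
  rw [Dom.norm_eq, Dom.val_map, Dom.op_map, Dom.norm_eq, max_le_iff]
  exact ⟨Q.le_of_opNorm_le_of_le hM (le_max_left _ _),
    Q.le_of_opNorm_le_of_le hM (le_max_right _ _)⟩

lemma Dom.ext {z z' : Dom C} (h : Dom.val C z = Dom.val C z') : z = z' :=
  Subtype.ext (Prod.ext h (C.mem_graph_snd_inj z.2 z'.2 h))

end DomMap

/-! ## Backward convolutions on Lebesgue spaces -/

section Dense

variable {α X Z : Type*} [MeasurableSpace α] {μ : Measure α} [NormedAddCommGroup X]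
  [NormedSpace ℂ X] [NormedAddCommGroup Z] [NormedSpace ℂ Z]

/-- Since p < ∞, indicator functions with one vector value generate L^p; such a value is
approximated from the range of J, and the closure of the range is a closed subspace. -/
lemma denseRange_compLpₗ {J : X →L[ℂ] Z} (hJ : DenseRange J) {p : ℝ≥0∞} [Fact (1 ≤ p)]
    (hp : p ≠ ∞) : DenseRange (J.compLpₗ p μ) := by
  intro f
  induction f using Lp.induction hp with
  | @indicatorConst c s hs hμs =>
    rw [Metric.mem_closure_range_iff]
    intro δ hδ
    rw [Lp.simpleFunc.coe_indicatorConst]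
    -- The tolerance is divided by K + 1 rather than K because the set may be null.
    set K : ℝ := ‖indicatorConstLp p hs hμs.ne (1 : ℝ)‖ with hK
    obtain ⟨x, hx⟩ := Metric.denseRange_iff.1 hJ c (δ / (K + 1)) (by positivity)
    refine ⟨indicatorConstLp p hs hμs.ne x, ?_⟩
    have e1 : J.compLpₗ p μ (indicatorConstLp p hs hμs.ne x) =
        indicatorConstLp p hs hμs.ne (J x) := by
      ext1
      rw [ContinuousLinearMap.compLpₗ_apply]
      filter_upwards [J.coeFn_compLp (indicatorConstLp p hs hμs.ne x),
        indicatorConstLp_coeFn (p := p) (hs := hs) (hμs := hμs.ne) (c := x),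
        indicatorConstLp_coeFn (p := p) (hs := hs) (hμs := hμs.ne) (c := J x)] with t h1 h2 h3
      rw [h1, h2, h3]
      by_cases ht : t ∈ s <;> simp [ht]
    have hp0 : p ≠ 0 := (lt_of_lt_of_le zero_lt_one Fact.out).ne'
    rw [e1, dist_eq_norm, indicatorConstLp_sub, norm_indicatorConstLp hp0 hp, ← dist_eq_norm]
    have hK' : K = μ.real s ^ (1 / p.toReal) := by
      rw [hK, norm_indicatorConstLp hp0 hp, norm_one, one_mul]
    rw [← hK']
    rw [lt_div_iff₀ (by positivity)] at hx
    calc _ ≤ dist c (J x) * (K + 1) := by gcongr; linarith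
      _ < δ := hx
  | add hf hg _ h1 h2 =>
    exact (LinearMap.range (J.compLpₗ p μ)).topologicalClosure.add_mem h1 h2
  | isClosed => exact isClosed_closure

end Dense

section Conv

variable {X Z U : Type*} [NormedAddCommGroup X] [NormedSpace ℂ X] [SecondCountableTopology X]
  [NormedAddCommGroup Z] [NormedSpace ℂ Z]
  [NormedAddCommGroup U] [InnerProductSpace ℂ U]

lemma ae_lt_top_of_eLpNorm_lt_top {α : Type*} [MeasurableSpace α] {μ : Measure α} {g : α → ℝ≥0∞}
    (hg : Measurable g) {r : ℝ≥0∞} (hr : r ≠ 0) (h : eLpNorm g r μ < ∞) : ∀ᵐ s ∂μ, g s < ∞ := by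
  rcases eq_or_ne r ∞ with rfl | hr'
  · rw [eLpNorm_exponent_top] at h
    filter_upwards [ae_le_eLpNormEssSup (f := g) (μ := μ)] with s hs
    exact lt_of_le_of_lt hs h
  · have h1 := lintegral_rpow_enorm_lt_top_of_eLpNorm_lt_top hr hr' h
    simp only [enorm_eq_self] at h1
    filter_upwards [ae_lt_top (by fun_prop) h1.ne] with s hs
    by_contra hc
    rw [not_lt, top_le_iff] at hc
    rw [hc, ENNReal.top_rpow_of_pos (ENNReal.toReal_pos hr hr')] at hs
    exact lt_irrefl _ hs

variable {k : ℝ → X →L[ℂ] U} (hk : ∀ x, StronglyMeasurable fun t => k t x)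

include hk

/-- A Carathéodory argument: k(t)x is continuous in x and measurable in t, so it is jointly
measurable when X is second countable. -/
lemma stronglyMeasurable_convKernel {f : ℝ → X} (hf : StronglyMeasurable f) :
    StronglyMeasurable fun z : ℝ × ℝ => k (z.2 - z.1) (f z.2) := by
  borelize X
  have h1 : StronglyMeasurable (Function.uncurry fun (x : X) (t : ℝ) => k t x) :=
    stronglyMeasurable_uncurry_of_continuous_of_stronglyMeasurable
      (fun t => (k t).continuous) hk
  have h2 : Measurable fun z : ℝ × ℝ => (f z.2, z.2 - z.1) :=
    (hf.measurable.comp measurable_snd).prodMk (measurable_snd.sub measurable_fst)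
  exact h1.comp_measurable h2

lemma stronglyMeasurable_convKernel_indicator {f : ℝ → X} (hf : StronglyMeasurable f) :
    StronglyMeasurable (Function.uncurry fun s t : ℝ =>
      (Ioi s).indicator (fun t => k (t - s) (f t)) t) :=
  (stronglyMeasurable_convKernel hk hf).indicator (measurableSet_lt measurable_fst measurable_snd)

lemma measurable_lintegral_conv {f : ℝ → X} (hf : StronglyMeasurable f) :
    Measurable fun s => ∫⁻ t in Ioi s, ‖k (t - s) (f t)‖ₑ := by
  have h := (stronglyMeasurable_convKernel_indicator hk hf).enorm.lintegral_prod_right'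
    (ν := (volume : Measure ℝ))
  simpa only [Function.uncurry, enorm_indicator_eq_indicator_enorm,
    lintegral_indicator measurableSet_Ioi] using h

lemma stronglyMeasurable_integral_conv {f : ℝ → X} (hf : StronglyMeasurable f) :
    StronglyMeasurable fun s => ∫ t in Ioi s, k (t - s) (f t) := by
  have h := (stronglyMeasurable_convKernel_indicator hk hf).integral_prod_right (ν := volume)
  simpa only [integral_indicator measurableSet_Ioi] using h

/-- A norm bound for the absolute values makes a backward convolution into a linear operator. -/
lemma exists_linearMap_isBackwardConv (J : X →L[ℂ] Z) {p r : ℝ≥0∞} (hr : r ≠ 0)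
    {C : ℝ≥0∞} (hC : C ≠ ∞)
    (hb : ∀ f : ℝ → X, StronglyMeasurable f →
      eLpNorm (fun s => ∫⁻ t in Ioi s, ‖k (t - s) (f t)‖ₑ) r halfLine ≤
        C * eLpNorm (fun t => J (f t)) p halfLine) :
    ∃ Λ : Lp X p halfLine →ₗ[ℂ] Lp U r halfLine,
      (∀ f : Lp X p halfLine, IsBackwardConv (fun t x => k t x) f (Λ f)) ∧
        ∀ f, ‖Λ f‖ ≤ C.toReal * ‖J.compLp f‖ := by
  have hJ : ∀ f : Lp X p halfLine, eLpNorm (fun t => J (f t)) p halfLine = ‖J.compLp f‖ₑ := by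
    intro f
    rw [Lp.enorm_def]
    exact eLpNorm_congr_ae (J.coeFn_compLp' f).symm
  have hb' : ∀ f : Lp X p halfLine,
      eLpNorm (fun s => ∫⁻ t in Ioi s, ‖k (t - s) (f t)‖ₑ) r halfLine ≤ C * ‖J.compLp f‖ₑ :=
    fun f => (hb f (Lp.stronglyMeasurable f)).trans_eq (by rw [hJ])
  have hint : ∀ f : Lp X p halfLine, ∀ᵐ s ∂halfLine,
      IntegrableOn (fun t => k (t - s) (f t)) (Ioi s) := by
    intro f
    have hf := Lp.stronglyMeasurable f
    filter_upwards [ae_lt_top_of_eLpNorm_lt_top (measurable_lintegral_conv hk hf) hr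
      ((hb' f).trans_lt (ENNReal.mul_lt_top hC.lt_top enorm_lt_top))] with s hs
    refine ⟨?_, hs⟩
    exact ((stronglyMeasurable_convKernel hk hf).comp_measurable
      measurable_prodMk_left).aestronglyMeasurable
  set w : Lp X p halfLine → ℝ → U := fun f s => ∫ t in Ioi s, k (t - s) (f t) with hw
  have hwle : ∀ f, eLpNorm (w f) r halfLine ≤ C * ‖J.compLp f‖ₑ := by
    intro f
    refine le_trans (eLpNorm_mono_enorm fun s => ?_) (hb' f)
    rw [enorm_eq_self]
    exact enorm_integral_le_lintegral_enorm _
  have hmem : ∀ f, MemLp (w f) r halfLine := fun f =>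
    ⟨(stronglyMeasurable_integral_conv hk (Lp.stronglyMeasurable f)).aestronglyMeasurable,
      (hwle f).trans_lt (ENNReal.mul_lt_top hC.lt_top enorm_lt_top)⟩
  have hpos : ∀ᵐ s ∂halfLine, 0 < s := ae_restrict_mem measurableSet_Ioi
  have hres : ∀ {s : ℝ} {P : ℝ → Prop}, 0 < s → (∀ᵐ t ∂halfLine, P t) →
      ∀ᵐ t ∂volume.restrict (Ioi s), P t := fun hs h =>
    ae_restrict_of_ae_restrict_of_subset (Ioi_subset_Ioi (le_of_lt hs)) h
  refine ⟨{ toFun := fun f => (hmem f).toLp, map_add' := fun f g => ?_, map_smul' := fun c f => ?_},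
    fun f => ?_, fun f => ?_⟩
  · rw [← MemLp.toLp_add, MemLp.toLp_eq_toLp_iff]
    filter_upwards [hint f, hint g, hpos] with s hf hg hs
    simp only [hw, Pi.add_apply]
    rw [← integral_add hf hg]
    refine integral_congr_ae ?_
    filter_upwards [hres hs (Lp.coeFn_add f g)] with t ht
    rw [ht, Pi.add_apply, map_add]
  · rw [RingHom.id_apply, ← MemLp.toLp_const_smul, MemLp.toLp_eq_toLp_iff]
    filter_upwards [hpos] with s hs
    simp only [hw, Pi.smul_apply]
    rw [← integral_smul]
    refine integral_congr_ae ?_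
    filter_upwards [hres hs (Lp.coeFn_smul c f)] with t ht
    rw [ht, Pi.smul_apply, map_smul]
  · filter_upwards [hint f, (hmem f).coeFn_toLp] with s h1 h2
    exact ⟨h1, h2⟩
  · change ‖(hmem f).toLp‖ ≤ _
    rw [Lp.norm_toLp]
    refine (ENNReal.toReal_mono (ENNReal.mul_ne_top hC enorm_ne_top) (hwle f)).trans_eq ?_
    rw [ENNReal.toReal_mul, Lp.enorm_def, ← Lp.norm_def]

/-- The extension of a backward convolution to a larger space by density. -/
lemma exists_extension_isBackwardConv [CompleteSpace U] {J : X →L[ℂ] Z} (hJ : DenseRange J) {p r : ℝ≥0∞}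
    [Fact (1 ≤ p)] [Fact (1 ≤ r)] (hp : p ≠ ∞) {C : ℝ≥0∞} (hC : C ≠ ∞)
    (hb : ∀ f : ℝ → X, StronglyMeasurable f →
      eLpNorm (fun s => ∫⁻ t in Ioi s, ‖k (t - s) (f t)‖ₑ) r halfLine ≤
        C * eLpNorm (fun t => J (f t)) p halfLine) :
    ∃ Λ : Lp Z p halfLine →L[ℂ] Lp U r halfLine,
      ∀ f : Lp X p halfLine, IsBackwardConv (fun t x => k t x) f (Λ (J.compLp f)) := by
  have hr : r ≠ 0 := (lt_of_lt_of_le zero_lt_one Fact.out).ne'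
  obtain ⟨Λ₀, h1, h2⟩ := exists_linearMap_isBackwardConv hk J hr hC hb
  -- The bound for Λ₀ f is by the norm of J f, not of f; this is what makes the extension from the
  -- dense image of J well defined.
  refine ⟨Λ₀.extendOfNorm (J.compLpₗ p halfLine), fun f => ?_⟩
  have h3 := LinearMap.extendOfNorm_eq (f := Λ₀) (denseRange_compLpₗ (μ := halfLine) hJ hp)
    ⟨_, h2⟩ f
  rw [ContinuousLinearMap.compLpₗ_apply] at h3
  rw [h3]
  exact h1 f

end Conv

/-! ## Bounds for backward convolutions -/

section Bounds

lemma eLpNorm_ofReal_eq {α E : Type*} [MeasurableSpace α] [TopologicalSpace E] [ContinuousENorm E]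
    {μ : Measure α} {r : ℝ} (hr : 0 < r) (g : α → E) :
    eLpNorm g (ENNReal.ofReal r) μ = (∫⁻ s, ‖g s‖ₑ ^ r ∂μ) ^ (1 / r) := by
  rw [eLpNorm_eq_lintegral_rpow_enorm_toReal (by simpa using hr) (by simp),
    ENNReal.toReal_ofReal hr.le]

lemma lintegral_rpow_enorm_le_of_ae_eq {α E V : Type*} [MeasurableSpace α] {μ : Measure α}
    [NormedAddCommGroup E] [NormedSpace ℂ E] [NormedAddCommGroup V] [NormedSpace ℂ V] {r : ℝ}
    (hr : 0 < r) [Fact (1 ≤ ENNReal.ofReal r)] (L : E →L[ℂ] Lp V (ENNReal.ofReal r) μ) {y : E}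
    {g : α → V} (h : L y =ᵐ[μ] g) : ∫⁻ s, ‖g s‖ₑ ^ r ∂μ ≤ ‖L‖ₑ ^ r * ‖y‖ₑ ^ r := by
  have h1 : ∫⁻ s, ‖g s‖ₑ ^ r ∂μ = eLpNorm (L y) (ENNReal.ofReal r) μ ^ r := by
    rw [eLpNorm_congr_ae h, eLpNorm_ofReal_eq hr, ← ENNReal.rpow_mul, one_div_mul_cancel hr.ne',
      ENNReal.rpow_one]
  rw [h1, ← Lp.enorm_def, ← ENNReal.mul_rpow_of_nonneg _ _ hr.le]
  exact ENNReal.rpow_le_rpow (L.le_opENorm y) hr.le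

variable {X Z U : Type*} [NormedAddCommGroup X] [NormedSpace ℂ X] [SecondCountableTopology X]
  [NormedAddCommGroup Z] [NormedSpace ℂ Z]
  [NormedAddCommGroup U] [InnerProductSpace ℂ U]

/-- The kernel is its singular majorant plus an excess, and Minkowski's inequality treats them
separately. The excess is a truncated difference rather than ‖G(τ)x‖ because no joint measurability
of F or G is assumed, whereas k and `ker` are jointly measurable. Injectivity of J makes the excess
vanish wherever ‖J f‖ does, as the weighted Schur test requires. -/
lemma exists_lintegral_conv_le {k : ℝ → X →L[ℂ] U} (hk : ∀ x, StronglyMeasurable fun t => k t x)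
    {J : X →L[ℂ] Z} (hJ : ∀ x, J x = 0 → x = 0) {p r γ η c : ℝ} (hp : 1 ≤ p) (hpr : p ≤ r)
    (hc : 0 < c)
    (hker : ∃ C : ℝ≥0∞, C ≠ ∞ ∧ ∀ a : ℝ → ℝ≥0∞, Measurable a →
      (∫⁻ s, (∫⁻ t, a t * ker γ η (t - s)) ^ r) ^ (1 / r) ≤ C * (∫⁻ t, a t ^ p) ^ (1 / p))
    {N C : ℝ≥0∞} (hN : N ≠ ∞) (hC : C ≠ ∞)
    (hg : ∀ x, ∫⁻ τ in Ioi (0 : ℝ), ((‖k τ x‖ₑ - N * (ker γ η τ * ‖J x‖ₑ)) *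
      ENNReal.ofReal (Real.exp (c * τ))) ^ r ≤ C * ‖J x‖ₑ ^ r) :
    ∃ C' : ℝ≥0∞, C' ≠ ∞ ∧ ∀ f : ℝ → X, StronglyMeasurable f →
      (∫⁻ s, (∫⁻ t in Ioi s, ‖k (t - s) (f t)‖ₑ) ^ r) ^ (1 / r) ≤
        C' * (∫⁻ t, ‖J (f t)‖ₑ ^ p) ^ (1 / p) := by
  have hr : 1 ≤ r := hp.trans hpr
  have hr0 : 0 < r := by linarith
  obtain ⟨C₁, hC₁, h₁⟩ := hker
  obtain ⟨C₂, hC₂, h₂⟩ := exists_lintegral_exp_kernel hp hpr hc hC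
  refine ⟨N * C₁ + C₂, by finiteness, fun f hf => ?_⟩
  set a : ℝ → ℝ≥0∞ := fun t => ‖J (f t)‖ₑ with ha
  have ham : Measurable a := (J.continuous.comp_stronglyMeasurable hf).enorm
  have hkf : Measurable fun z : ℝ × ℝ => ‖k (z.2 - z.1) (f z.2)‖ₑ :=
    (stronglyMeasurable_convKernel hk hf).enorm
  set φ : ℝ → ℝ → ℝ≥0∞ := fun s t => a t * ker γ η (t - s) with hφ
  have hφm : Measurable (Function.uncurry φ) :=
    (ham.comp measurable_snd).mul ((measurable_ker γ η).comp (measurable_snd.sub measurable_fst))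
  have hφm' : ∀ s, Measurable fun t => φ s t := fun s => hφm.comp measurable_prodMk_left
  set ψ : ℝ → ℝ → ℝ≥0∞ := fun s t => (Ioi s).indicator
    (fun t => ‖k (t - s) (f t)‖ₑ - N * (ker γ η (t - s) * a t)) t with hψ
  have hψm : Measurable (Function.uncurry ψ) := by
    have h3 : Measurable fun z : ℝ × ℝ =>
        ‖k (z.2 - z.1) (f z.2)‖ₑ - N * (ker γ η (z.2 - z.1) * a z.2) :=
      hkf.sub ((((measurable_ker γ η).comp (measurable_snd.sub measurable_fst)).mul
        (ham.comp measurable_snd)).const_mul N)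
    exact h3.indicator (measurableSet_lt measurable_fst measurable_snd)
  have hψb := h₂ a ham (fun t => enorm_ne_top) ψ hψm
    (fun s t hts => indicator_of_notMem (by simpa using hts) _)
    (fun s t hat => by
      have : f t = 0 := hJ _ (by simpa [ha] using hat)
      simp [hψ, indicator_apply, this]) (fun t => by
      refine le_of_eq_of_le ?_ (hg (f t))
      rw [← lintegral_indicator measurableSet_Ioi]
      -- For fixed t, the substitution τ = t - s turns the integral in the outer variable into the
      -- one bounded by `hg`.
      refine Eq.trans ?_ (lintegral_sub_left_eq_self _ t)
      refine lintegral_congr fun s => ?_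
      simp only [hψ, indicator_apply, mem_Ioi, sub_pos]
      split_ifs
      · rfl
      · simp [hr0])
  have hle : ∀ s, ∫⁻ t in Ioi s, ‖k (t - s) (f t)‖ₑ ≤ N * (∫⁻ t, φ s t) + ∫⁻ t, ψ s t := by
    intro s
    have hm := hφm' s
    rw [← lintegral_const_mul (μ := volume) N hm, ← lintegral_add_left (hm.const_mul N),
      ← lintegral_indicator measurableSet_Ioi]
    refine lintegral_mono fun t => ?_
    simp only [hψ, hφ, indicator_apply]
    split_ifs
    · rw [mul_comm (a t)]
      exact le_add_tsub
    · exact zero_le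
  have hm2 : Measurable fun s => ∫⁻ t, φ s t := hφm.lintegral_prod_right
  have hm3 : Measurable fun s => ∫⁻ t, ψ s t := hψm.lintegral_prod_right
  calc _ ≤ (∫⁻ s, (N * (∫⁻ t, φ s t) + ∫⁻ t, ψ s t) ^ r) ^ (1 / r) := by
        gcongr with s; exact hle s
    _ ≤ (∫⁻ s, (N * ∫⁻ t, φ s t) ^ r) ^ (1 / r) + (∫⁻ s, (∫⁻ t, ψ s t) ^ r) ^ (1 / r) :=
        ENNReal.lintegral_Lp_add_le (μ := volume) (hm2.const_mul N).aemeasurable hm3.aemeasurable hr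
    _ ≤ N * (C₁ * (∫⁻ t, a t ^ p) ^ (1 / p)) + C₂ * (∫⁻ t, a t ^ p) ^ (1 / p) := by
        gcongr
        simp only [ENNReal.mul_rpow_of_nonneg _ _ hr0.le]
        rw [lintegral_const_mul _ (by fun_prop), ENNReal.mul_rpow_of_nonneg _ _ (by positivity),
          ← ENNReal.rpow_mul, mul_one_div_cancel hr0.ne', ENNReal.rpow_one]
        gcongr
        exact h₁ a ham
    _ = _ := by ring

omit [SecondCountableTopology X] in
-- The kernel estimates live on the whole line; extending f by zero to negative times transfers
-- them, since for s > 0 only t > s > 0 enters.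
lemma eLpNorm_conv_le_of_lintegral {k : ℝ → X →L[ℂ] U} {J : X →L[ℂ] Z} {p r : ℝ} (hp : 0 < p)
    (hr : 0 < r) {C : ℝ≥0∞} (h : ∀ f : ℝ → X, StronglyMeasurable f →
      (∫⁻ s, (∫⁻ t in Ioi s, ‖k (t - s) (f t)‖ₑ) ^ r) ^ (1 / r) ≤
        C * (∫⁻ t, ‖J (f t)‖ₑ ^ p) ^ (1 / p)) {f : ℝ → X} (hf : StronglyMeasurable f) :
    eLpNorm (fun s => ∫⁻ t in Ioi s, ‖k (t - s) (f t)‖ₑ) (ENNReal.ofReal r) halfLine ≤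
      C * eLpNorm (fun t => J (f t)) (ENNReal.ofReal p) halfLine := by
  have h1 := h ((Ioi 0).indicator f) (hf.indicator measurableSet_Ioi)
  rw [eLpNorm_ofReal_eq hr, eLpNorm_ofReal_eq hp]
  have e1 : ∫⁻ t, ‖J ((Ioi 0).indicator f t)‖ₑ ^ p = ∫⁻ t, ‖J (f t)‖ₑ ^ p ∂halfLine := by
    rw [halfLine, ← lintegral_indicator measurableSet_Ioi]
    refine lintegral_congr fun t => ?_
    simp only [indicator_apply]
    split_ifs <;> simp [hp]
  rw [e1] at h1
  refine le_trans ?_ h1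
  refine ENNReal.rpow_le_rpow ?_ (by positivity)
  refine le_trans ?_ (setLIntegral_le_lintegral (Ioi 0) _)
  refine setLIntegral_mono' measurableSet_Ioi fun s hs => ?_
  simp only [enorm_eq_self]
  refine ENNReal.rpow_le_rpow (le_of_eq ?_) hr.le
  refine setLIntegral_congr_fun measurableSet_Ioi fun t ht => ?_
  have : t ∈ Ioi (0 : ℝ) := (mem_Ioi.1 hs).trans ht
  simp only [indicator_of_mem this]

end Bounds

/-! ## The observation operators -/

section Observation

lemma IsBackwardConv.congr {X U : Type*} [NormedAddCommGroup U] [InnerProductSpace ℂ U]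
    {k k' : ℝ → X → U} {v : ℝ → X} {w : ℝ → U}
    (h : IsBackwardConv k v w) (hk : ∀ t, 0 < t → ∀ x, k t x = k' t x) :
    IsBackwardConv k' v w := by
  filter_upwards [h] with s hs
  have h1 : EqOn (fun t => k (t - s) (v t)) (fun t => k' (t - s) (v t)) (Ioi s) :=
    fun t ht => hk _ (sub_pos.2 ht) _
  exact ⟨(integrableOn_congr_fun h1 measurableSet_Ioi).1 hs.1,
    hs.2.trans (setIntegral_congr_fun measurableSet_Ioi h1)⟩

variable {Y U : Type*} [NormedAddCommGroup Y] [InnerProductSpace ℂ Y] [CompleteSpace Y]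
  [NormedAddCommGroup U] [InnerProductSpace ℂ U] [CompleteSpace U]
  {A : Y →ₗ.[ℂ] Y} {S : ℝ → Y →L[ℂ] Y}

lemma adjSemigroup_mem_graph (hS : IsC0Semigroup S) (hE : IsExpStable S) (hA : IsGenerator A S)
    {t : ℝ} (ht : 0 ≤ t) (z : Y × Y) (hz : z ∈ A.adjoint.graph) :
    (adjSemigroup S t z.1, adjSemigroup S t z.2) ∈ A.adjoint.graph :=
  adjoint_map_mem_graph hS hE hA (fun _ hs _ => hS.comm ht hs _) hz

/-- The adjoint semigroup on `D(A^*)`, extended by the identity to negative times. -/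
def adjMap (hS : IsC0Semigroup S) (hE : IsExpStable S) (hA : IsGenerator A S) (t : ℝ) :
    Dom A.adjoint →L[ℂ] Dom A.adjoint :=
  Dom.map (adjSemigroup S (max t 0)) (adjSemigroup_mem_graph hS hE hA (le_max_right t 0))

/-- The operators `B^* e^{A^* t}` on `D(A^*)`, extended by `B^*` to negative times. -/
def obsCLM (hS : IsC0Semigroup S) (hE : IsExpStable S) (hA : IsGenerator A S)
    (B : U →L[ℂ] AntiDual (Dom A.adjoint)) (t : ℝ) : Dom A.adjoint →L[ℂ] U :=
  (adjControl B).comp (adjMap hS hE hA t)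

variable (hS : IsC0Semigroup S) (hE : IsExpStable S) (hA : IsGenerator A S)
  (B : U →L[ℂ] AntiDual (Dom A.adjoint))

lemma val_adjMap {t : ℝ} (ht : 0 ≤ t) (x : Dom A.adjoint) :
    Dom.val A.adjoint (adjMap hS hE hA t x) = adjSemigroup S t (Dom.val A.adjoint x) := by
  rw [adjMap, Dom.val_map, max_eq_left ht]

lemma obs_eq_obsCLM {t : ℝ} (ht : 0 ≤ t) (x : Dom A.adjoint) :
    obs A S B t (Dom.val A.adjoint x) = obsCLM hS hE hA B t x := by
  have hmem : adjSemigroup S t (Dom.val A.adjoint x) ∈ A.adjoint.domain :=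
    adjSemigroup_mem_domain hS hA ht (LinearPMap.mem_domain_of_mem_graph x.2)
  rw [obs, dif_pos hmem, obsCLM, ContinuousLinearMap.comp_apply]
  congr 1
  refine Dom.ext ?_
  rw [val_adjMap hS hE hA ht]
  rfl

include hS hE in
lemma continuous_adjSemigroup_max (y : Y) :
    Continuous fun t : ℝ => adjSemigroup S (max t 0) y :=
  ((isC0Semigroup_adjSemigroup hS hE).continuousOn y).comp_continuous
    (continuous_id.max continuous_const) fun _ => mem_Ici.2 (le_max_right _ _)

lemma continuous_obsCLM (x : Dom A.adjoint) : Continuous fun t => obsCLM hS hE hA B t x := by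
  refine (adjControl B).continuous.comp ?_
  refine Continuous.subtype_mk (Continuous.prodMk ?_ ?_) _
  · exact continuous_adjSemigroup_max hS hE _
  · exact continuous_adjSemigroup_max hS hE _

lemma obsCLM_add {τ σ : ℝ} (hτ : 0 ≤ τ) (hσ : 0 ≤ σ) (x : Dom A.adjoint) :
    obsCLM hS hE hA B (τ + σ) x = obsCLM hS hE hA B τ (adjMap hS hE hA σ x) := by
  simp only [obsCLM, ContinuousLinearMap.comp_apply]
  congr 1
  refine Dom.ext ?_
  rw [val_adjMap hS hE hA (add_nonneg hτ hσ), val_adjMap hS hE hA hτ, val_adjMap hS hE hA hσ,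
    (isC0Semigroup_adjSemigroup hS hE).map_add _ _ hτ hσ, ContinuousLinearMap.comp_apply]

/-- A bound for the integral operator gives the mapping property of `L^*`. -/
lemma lStarMaps_of_lintegral [TopologicalSpace.SeparableSpace Y]
    {Z : Type*} [NormedAddCommGroup Z] [NormedSpace ℂ Z]
    {J : Dom A.adjoint →L[ℂ] Z} (hJd : DenseRange J) {p r : ℝ} (hp : 1 ≤ p) (hr : 1 ≤ r)
    {C : ℝ≥0∞} (hC : C ≠ ∞) (h : ∀ f : ℝ → Dom A.adjoint, StronglyMeasurable f →
      (∫⁻ s, (∫⁻ t in Ioi s, ‖obsCLM hS hE hA B (t - s) (f t)‖ₑ) ^ r) ^ (1 / r) ≤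
        C * (∫⁻ t, ‖J (f t)‖ₑ ^ p) ^ (1 / p)) :
    LStarMaps A S B J (ENNReal.ofReal p) (ENNReal.ofReal r) := by
  have := UniformSpace.secondCountable_of_separable Y
  have h1 : Fact (1 ≤ ENNReal.ofReal p) := ⟨ENNReal.one_le_ofReal.2 hp⟩
  have h2 : Fact (1 ≤ ENNReal.ofReal r) := ⟨ENNReal.one_le_ofReal.2 hr⟩
  refine ⟨h1, h2, ?_⟩
  obtain ⟨Λ, hΛ⟩ := exists_extension_isBackwardConv (k := obsCLM hS hE hA B)
    (fun x => (continuous_obsCLM hS hE hA B x).stronglyMeasurable) hJd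
    (p := ENNReal.ofReal p) (r := ENNReal.ofReal r) ENNReal.ofReal_ne_top hC
    (fun f hf => eLpNorm_conv_le_of_lintegral (by linarith) (by linarith) h hf)
  exact ⟨Λ, fun f => (hΛ f).congr fun t ht x => (obs_eq_obsCLM hS hE hA B ht.le x).symm⟩

end Observation

/-! ## The fractional domains -/

section FracDomain

variable {Y : Type*} [NormedAddCommGroup Y] [InnerProductSpace ℂ Y] [CompleteSpace Y]
  {S : ℝ → Y →L[ℂ] Y} (hS : IsC0Semigroup S) (hE : IsExpStable S) {a : ℝ} (ha : 0 < a)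

/-- The parametrization `y ↦ (-A)^{-a} y` of the domain of `(-A)^a`. -/
def fracEmb : Y →L[ℂ] Dom (fracPow S a) :=
  ((((Real.Gamma a)⁻¹ • powInt hS hE ha).prod (ContinuousLinearMap.id ℂ Y))).codRestrict
    (fracPow S a).graph fun _ => (mem_graph_fracPow hS hE ha).2 rfl

lemma val_fracEmb (y : Y) :
    Dom.val (fracPow S a) (fracEmb hS hE ha y) = (Real.Gamma a)⁻¹ • powInt hS hE ha y := rfl

lemma op_fracEmb (y : Y) : Dom.op (fracPow S a) (fracEmb hS hE ha y) = y := rfl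

lemma fracEmb_op (z : Dom (fracPow S a)) : fracEmb hS hE ha (Dom.op (fracPow S a) z) = z :=
  Subtype.ext (Prod.ext ((mem_graph_fracPow hS hE ha).1 z.2).symm rfl)

lemma pivot_fracEmb (x y : Y) : pivot (fracPow S a) x (fracEmb hS hE ha y) =
    ⟪y, (Real.Gamma a)⁻¹ • ContinuousLinearMap.adjoint (powInt hS hE ha) x⟫_ℂ := by
  rw [pivot_apply, val_fracEmb, ← Complex.coe_smul, ← Complex.coe_smul, inner_smul_left,
    inner_smul_right, Complex.conj_ofReal, ContinuousLinearMap.adjoint_inner_right]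

/-- Let v be the image of x under the adjoint. Testing the functional of x on the domain element
parametrized by v gives ‖v‖²/Γ(a), and that element has norm at most a constant times ‖v‖. So the
norm of [D((-A)^a)]' dominates that of (-A^*)^{-a} x. -/
lemma exists_norm_adjoint_powInt_le : ∃ C : ℝ, 0 ≤ C ∧ ∀ x : Y,
    ‖ContinuousLinearMap.adjoint (powInt hS hE ha) x‖ ≤ C * ‖pivot (fracPow S a) x‖ := by
  have hΓ := Real.Gamma_pos_of_pos ha
  refine ⟨Real.Gamma a * ‖fracEmb hS hE ha‖, by positivity, fun x => ?_⟩
  set v := ContinuousLinearMap.adjoint (powInt hS hE ha) x with hv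
  have h1 := pivot_fracEmb hS hE ha x v
  have h2 : ‖pivot (fracPow S a) x (fracEmb hS hE ha v)‖ ≤
      ‖pivot (fracPow S a) x‖ * (‖fracEmb hS hE ha‖ * ‖v‖) :=
    ContinuousLinearMap.le_opNorm_of_le _ (ContinuousLinearMap.le_opNorm _ _)
  rw [h1, ← hv, ← Complex.coe_smul, inner_smul_right, norm_mul, Complex.norm_real,
    Real.norm_of_nonneg (by positivity), inner_self_eq_norm_sq_to_K, norm_pow] at h2
  simp only [Complex.coe_algebraMap, Complex.norm_real, norm_norm] at h2
  rcases (norm_nonneg v).eq_or_lt with h0 | h0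
  · rw [← h0]; positivity
  · rw [inv_mul_le_iff₀ hΓ, pow_two] at h2
    refine le_of_mul_le_mul_right (h2.trans_eq ?_) h0
    ring

/-- The reverse comparison: in the parametrization by y = (-A)^a z the functional is an inner
product, and the graph norm of z is at least ‖y‖. -/
lemma norm_sub_pivot_le (l : AntiDual (Dom (fracPow S a))) {w : Y}
    (hw : ∀ y, l (fracEmb hS hE ha y) = ⟪y, w⟫_ℂ) (x : Y) : ‖l - pivot (fracPow S a) x‖ ≤
      ‖w - (Real.Gamma a)⁻¹ • ContinuousLinearMap.adjoint (powInt hS hE ha) x‖ := by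
  refine ContinuousLinearMap.opNorm_le_bound _ (norm_nonneg _) fun z => ?_
  rw [sub_apply]
  nth_rewrite 1 [← fracEmb_op hS hE ha z]
  nth_rewrite 2 [← fracEmb_op hS hE ha z]
  rw [hw, pivot_fracEmb, ← inner_sub_right, mul_comm]
  refine (norm_inner_le_norm _ _).trans ?_
  gcongr
  rw [Dom.norm_eq]
  exact le_max_right _ _

lemma exists_inner_eq (l : AntiDual (Dom (fracPow S a))) :
    ∃ w : Y, ∀ y, l (fracEmb hS hE ha y) = ⟪y, w⟫_ℂ := by
  set m : Y →L⋆[ℂ] ℂ := l.comp (fracEmb hS hE ha) with hm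
  obtain ⟨M, hM⟩ : ∃ M : ℝ, ∀ y, ‖m y‖ ≤ M * ‖y‖ := ⟨_, m.le_opNorm⟩
  -- The Riesz theorem is for linear functionals, so the conjugate-linear one is conjugated first.
  let m' : Y →L[ℂ] ℂ := LinearMap.mkContinuous
    { toFun := fun y => starRingEnd ℂ (m y)
      map_add' := fun x y => by rw [map_add, map_add]
      map_smul' := fun c y => by simp } M (fun y => by simpa using hM y)
  refine ⟨(InnerProductSpace.toDual ℂ Y).symm m', fun y => ?_⟩
  rw [← inner_conj_symm, InnerProductSpace.toDual_symm_apply]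
  exact (Complex.conj_conj _).symm

include hS hE ha in
-- Representing a functional by w, its approximation reduces to approximating Γ(a) w in Y, where the
-- adjoint has dense range.
lemma denseRange_pivot_comp {V : Type*} {j : V → Y} (hj : DenseRange j) :
    DenseRange fun v => pivot (fracPow S a) (j v) := by
  have hΓ := Real.Gamma_pos_of_pos ha
  rw [Metric.denseRange_iff]
  intro l δ hδ
  obtain ⟨w, hw⟩ := exists_inner_eq hS hE ha l
  have hd : DenseRange fun v => ContinuousLinearMap.adjoint (powInt hS hE ha) (j v) :=
    (denseRange_adjoint_powInt hS hE ha).comp hj (ContinuousLinearMap.continuous _)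
  obtain ⟨v, hv⟩ := Metric.denseRange_iff.1 hd (Real.Gamma a • w) (Real.Gamma a * δ)
    (by positivity)
  refine ⟨v, ?_⟩
  rw [dist_eq_norm] at hv ⊢
  refine (norm_sub_pivot_le hS hE ha l hw (j v)).trans_lt ?_
  have e : w - (Real.Gamma a)⁻¹ • ContinuousLinearMap.adjoint (powInt hS hE ha) (j v) =
      (Real.Gamma a)⁻¹ • (Real.Gamma a • w -
        ContinuousLinearMap.adjoint (powInt hS hE ha) (j v)) := by
    rw [smul_sub, smul_smul, inv_mul_cancel₀ hΓ.ne', one_smul]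
  rw [e, norm_smul, Real.norm_of_nonneg (by positivity), inv_mul_lt_iff₀ hΓ]
  exact hv

end FracDomain

/-! ### Weighted integral estimates for B^* e^{A^* t}, and their mapping consequences -/

section Estimates

variable {Y U : Type*} [NormedAddCommGroup Y] [InnerProductSpace ℂ Y] [CompleteSpace Y]
  [NormedAddCommGroup U] [InnerProductSpace ℂ U] [CompleteSpace U]
  {A : Y →ₗ.[ℂ] Y} {S : ℝ → Y →L[ℂ] Y}

/-- The auxiliary Q measures x in the appropriate norm: the identity for data in Y, a multiple of
(-A^*)^{-ε} for data in [D(A^ε)]'. Commutation with the adjoint semigroup lets ‖Q x‖ inherit its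
exponential decay. -/
lemma exists_lintegral_Ioi_obs_le (hS : IsC0Semigroup S) (hE : IsExpStable S)
    (hA : IsGenerator A S) (B : U →L[ℂ] AntiDual (Dom A.adjoint)) {Q : Y →L[ℂ] Y}
    (hQ : ∀ t, 0 ≤ t → ∀ y, Q (adjSemigroup S t y) = adjSemigroup S t (Q y)) {r a d : ℝ}
    (hr : 0 < r) (ha : 0 ≤ a) (hd : 0 < d) {C : ℝ≥0∞} (hC : C ≠ ∞)
    (hb : ∀ x, ∫⁻ τ in Ioc a (a + d), ‖obsCLM hS hE hA B τ x‖ₑ ^ r ≤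
      C * ‖Q (Dom.val A.adjoint x)‖ₑ ^ r) :
    ∃ c : ℝ, 0 < c ∧ ∃ C' : ℝ≥0∞, C' ≠ ∞ ∧ ∀ x,
      ∫⁻ τ in Ioi a, (‖obsCLM hS hE hA B τ x‖ₑ * ENNReal.ofReal (Real.exp (c * τ))) ^ r ≤
        C' * ‖Q (Dom.val A.adjoint x)‖ₑ ^ r := by
  obtain ⟨M, ω, hM1, hω, hM⟩ := isExpStable_adjSemigroup hE
  refine ⟨ω / 2, by positivity, ?_⟩
  refine exists_lintegral_Ioi_le_of_period (N := fun x => ‖Q (Dom.val A.adjoint x)‖ₑ)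
    (T := fun σ x => adjMap hS hE hA σ x) (κ := fun τ x => ‖obsCLM hS hE hA B τ x‖ₑ) (ω := ω)
    (M := ENNReal.ofReal M) hr (by positivity) (by linarith) hd (by simp) hC ?_ ?_ hb
  · intro τ σ x hτ hσ
    rw [obsCLM_add hS hE hA B (ha.trans hτ.le) hσ]
  · intro σ x hσ
    rw [val_adjMap hS hE hA hσ, hQ σ hσ, ← ENNReal.ofReal_mul (by linarith), ← ofReal_norm,
      ← ofReal_norm, ← ENNReal.ofReal_mul (by positivity)]
    exact ENNReal.ofReal_le_ofReal ((adjSemigroup S σ).le_of_opNorm_le (hM σ hσ) _)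

variable {B : U →L[ℂ] AntiDual (Dom A.adjoint)} {F : ℝ → Y →L[ℂ] U}
  {G : ℝ → Dom A.adjoint →L[ℂ] U} {γ ε q : ℝ} (h : Assumptions A S B F G γ ε q)

include h

lemma Assumptions.exists_enorm_F_le : ∃ η : ℝ, 0 < η ∧ ∃ N : ℝ≥0∞, N ≠ ∞ ∧
    ∀ t, 0 < t → ∀ y, ‖F t y‖ₑ ≤ N * (ker γ η t * ‖y‖ₑ) := by
  obtain ⟨η, N, hη, hN, hF⟩ := h.F_bound
  refine ⟨η, hη, ENNReal.ofReal N, by simp, fun t ht y => ?_⟩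
  rw [ker_of_pos _ _ ht, ← mul_assoc, ← ENNReal.ofReal_mul hN.le, ← ofReal_norm, ← ofReal_norm,
    ← ENNReal.ofReal_mul (by positivity), ← mul_assoc N]
  exact ENNReal.ofReal_le_ofReal ((F t).le_of_opNorm_le (hF t ht) y)

lemma Assumptions.exists_lintegral_G_le : ∃ T : ℝ, 0 < T ∧ ∀ r : ℝ, 1 ≤ r → ∃ C : ℝ≥0∞, C ≠ ∞ ∧
    ∀ x, ∫⁻ τ in Ioo 0 T, ‖G τ x‖ₑ ^ r ≤ C * ‖Dom.val A.adjoint x‖ₑ ^ r := by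
  obtain ⟨T, hT, hG⟩ := h.G_Lp
  refine ⟨T, hT, fun r hr => ?_⟩
  obtain ⟨_, G', hG'⟩ := hG r hr
  have hr0 : 0 < r := by linarith
  exact ⟨‖G'‖ₑ ^ r, ENNReal.rpow_ne_top_of_nonneg hr0.le enorm_ne_top, fun x =>
    lintegral_rpow_enorm_le_of_ae_eq hr0 G' (hG' x)⟩

/-- The part of `B^* e^{A^* t}` that is not controlled by the bound for `F` is exponentially
integrable to every power. -/
lemma Assumptions.exists_lintegral_remainder_le : ∃ η : ℝ, 0 < η ∧ ∃ N : ℝ≥0∞, N ≠ ∞ ∧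
    ∀ r : ℝ, 1 ≤ r → ∃ c : ℝ, 0 < c ∧ ∃ C : ℝ≥0∞, C ≠ ∞ ∧ ∀ x,
      ∫⁻ τ in Ioi (0 : ℝ), ((‖obsCLM h.semigroup h.stable h.generator B τ x‖ₑ -
        N * (ker γ η τ * ‖Dom.val A.adjoint x‖ₑ)) * ENNReal.ofReal (Real.exp (c * τ))) ^ r ≤
          C * ‖Dom.val A.adjoint x‖ₑ ^ r := by
  obtain ⟨η, hη, N, hN, hF⟩ := h.exists_enorm_F_le
  obtain ⟨T, hT, hG⟩ := h.exists_lintegral_G_le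
  refine ⟨η, hη, N, hN, fun r hr => ?_⟩
  have hr0 : 0 < r := by linarith
  obtain ⟨C₁, hC₁, h₁⟩ := hG r hr
  set k := obsCLM h.semigroup h.stable h.generator B with hk
  have hdec : ∀ τ, 0 < τ → ∀ x, k τ x = F τ (Dom.val A.adjoint x) + G τ x := fun τ hτ x => by
    rw [hk, ← obs_eq_obsCLM h.semigroup h.stable h.generator B hτ.le x, h.decomposition τ hτ x]
  have hle : ∀ τ, 0 < τ → ∀ x,
      ‖k τ x‖ₑ ≤ N * (ker γ η τ * ‖Dom.val A.adjoint x‖ₑ) + ‖G τ x‖ₑ := fun τ hτ x => by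
    rw [hdec τ hτ]
    exact (enorm_add_le _ _).trans (by gcongr; exact hF τ hτ _)
  -- The period (δ, 2δ] lies inside (0, T), where G is controlled, and away from 0, where the
  -- singular kernel is bounded.
  set δ : ℝ := T / 3 with hδ
  have hδ0 : 0 < δ := by positivity
  set D : ℝ≥0∞ := (N * ker γ η δ) ^ r with hD
  have hD' : D ≠ ∞ := ENNReal.rpow_ne_top_of_nonneg hr0.le (ENNReal.mul_ne_top hN (ker_ne_top _ _ _))
  have hkerδ : ∀ τ, δ ≤ τ → ker γ η τ ≤ ker γ η δ := by
    intro τ hτ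
    rw [ker_of_pos _ _ (hδ0.trans_le hτ), ker_of_pos _ _ hδ0]
    refine ENNReal.ofReal_le_ofReal ?_
    have h1 : τ ^ (-γ) ≤ δ ^ (-γ) :=
      Real.rpow_le_rpow_of_nonpos hδ0 hτ (by linarith [h.gamma_mem.1])
    gcongr
  have hper : ∀ x, ∫⁻ τ in Ioc δ (δ + δ), ‖k τ x‖ₑ ^ r ≤
      (2 ^ (r - 1) * (D * ENNReal.ofReal δ + C₁)) *
        ‖ContinuousLinearMap.id ℂ Y (Dom.val A.adjoint x)‖ₑ ^ r := by
    intro x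
    calc _ ≤ ∫⁻ τ in Ioc δ (δ + δ), 2 ^ (r - 1) *
          (D * ‖Dom.val A.adjoint x‖ₑ ^ r + ‖G τ x‖ₑ ^ r) := by
          refine setLIntegral_mono' measurableSet_Ioc fun τ hτ => ?_
          refine (ENNReal.rpow_le_rpow (hle τ (hδ0.trans hτ.1) x) hr0.le).trans ?_
          refine (ENNReal.rpow_add_le_mul_rpow_add_rpow _ _ hr).trans ?_
          gcongr
          rw [hD, ← ENNReal.mul_rpow_of_nonneg _ _ hr0.le, mul_assoc]
          gcongr
          exact hkerδ τ hτ.1.le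
      _ = 2 ^ (r - 1) * (D * ‖Dom.val A.adjoint x‖ₑ ^ r * ENNReal.ofReal δ +
          ∫⁻ τ in Ioc δ (δ + δ), ‖G τ x‖ₑ ^ r) := by
          rw [lintegral_const_mul' _ _ (by finiteness), lintegral_add_left measurable_const,
            setLIntegral_const, Real.volume_Ioc, add_sub_cancel_right]
      _ ≤ 2 ^ (r - 1) * (D * ‖Dom.val A.adjoint x‖ₑ ^ r * ENNReal.ofReal δ +
          C₁ * ‖Dom.val A.adjoint x‖ₑ ^ r) := by
          gcongr
          refine le_trans (lintegral_mono_set fun τ hτ => ?_) (h₁ x)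
          exact ⟨hδ0.trans hτ.1, hτ.2.trans_lt (by rw [hδ]; linarith)⟩
      _ = _ := by
          rw [ContinuousLinearMap.id_apply]; ring
  obtain ⟨c, hc, C₂, hC₂, h₂⟩ := exists_lintegral_Ioi_obs_le h.semigroup h.stable h.generator B
    (Q := ContinuousLinearMap.id ℂ Y) (fun _ _ _ => rfl) hr0 hδ0.le hδ0 (by finiteness) hper
  refine ⟨c, hc, ENNReal.ofReal (Real.exp (c * δ)) ^ r * C₁ + C₂, by finiteness, fun x => ?_⟩
  -- On (0, δ] the excess is at most ‖G(τ)x‖; beyond δ the subtraction is dropped, since k itself is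
  -- controlled there.
  rw [← Ioc_union_Ioi_eq_Ioi hδ0.le]
  refine (lintegral_union_le _ _ _).trans ?_
  rw [add_mul]
  refine add_le_add ?_ ?_
  · calc _ ≤ ∫⁻ τ in Ioc 0 δ, ENNReal.ofReal (Real.exp (c * δ)) ^ r * ‖G τ x‖ₑ ^ r := by
          refine setLIntegral_mono' measurableSet_Ioc fun τ hτ => ?_
          rw [← ENNReal.mul_rpow_of_nonneg _ _ hr0.le, mul_comm]
          gcongr
          · exact hτ.2
          · exact tsub_le_iff_left.2 (hle τ hτ.1 x)
      _ = ENNReal.ofReal (Real.exp (c * δ)) ^ r * ∫⁻ τ in Ioc 0 δ, ‖G τ x‖ₑ ^ r :=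
          lintegral_const_mul' _ _ (by finiteness)
      _ ≤ _ := by
          rw [mul_assoc]
          gcongr
          refine le_trans (lintegral_mono_set fun τ hτ => ?_) (h₁ x)
          exact ⟨hτ.1, hτ.2.trans_lt (by rw [hδ]; linarith)⟩
  · refine le_trans (lintegral_mono fun τ => ?_) (h₂ x)
    gcongr
    exact tsub_le_self

/-- The excess poses no restriction beyond p ≤ r < ∞, so (i), (ii) and (iii) reduce to a scalar
inequality for `ker γ η`. -/
lemma Assumptions.lStarMaps_val [TopologicalSpace.SeparableSpace Y] {p r : ℝ} (hp : 1 ≤ p)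
    (hpr : p ≤ r)
    (hker : ∀ η : ℝ, 0 < η → ∃ C : ℝ≥0∞, C ≠ ∞ ∧ ∀ a : ℝ → ℝ≥0∞, Measurable a →
      (∫⁻ s, (∫⁻ t, a t * ker γ η (t - s)) ^ r) ^ (1 / r) ≤ C * (∫⁻ t, a t ^ p) ^ (1 / p)) :
    LStarMaps A S B (Dom.val A.adjoint) (ENNReal.ofReal p) (ENNReal.ofReal r) := by
  have := UniformSpace.secondCountable_of_separable Y
  obtain ⟨η, hη, N, hN, H⟩ := h.exists_lintegral_remainder_le
  obtain ⟨c, hc, C, hC, hg⟩ := H r (hp.trans hpr)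
  obtain ⟨C', hC', hb⟩ := exists_lintegral_conv_le
    (fun x => (continuous_obsCLM h.semigroup h.stable h.generator B x).stronglyMeasurable)
    (J := Dom.val A.adjoint) (fun x hx => Dom.ext (hx.trans (map_zero _).symm)) hp hpr hc
    (hker η hη) hN hC hg
  exact lStarMaps_of_lintegral h.semigroup h.stable h.generator B
    (denseRange_val_adjoint h.semigroup h.stable h.generator) hp (hp.trans hpr) hC' hb

/-- The bound of `B^* e^{A^* t}` in terms of a negative power, from its extension `K`. -/
lemma Assumptions.exists_lintegral_obs_le_powInt : ∃ T : ℝ, 0 < T ∧ ∃ C : ℝ≥0∞, C ≠ ∞ ∧ ∀ x,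
    ∫⁻ τ in Ioo 0 T, ‖obsCLM h.semigroup h.stable h.generator B τ x‖ₑ ^ q ≤
      C * ‖ContinuousLinearMap.adjoint (powInt h.semigroup h.stable h.eps_pos)
        (Dom.val A.adjoint x)‖ₑ ^ q := by
  obtain ⟨T, hT, -, _, K, hK⟩ := h.eps_cond
  have hq0 : 0 < q := by linarith [h.q_mem.1]
  have hS' := isC0Semigroup_adjSemigroup h.semigroup h.stable
  have hE' := isExpStable_adjSemigroup h.stable
  have hΓ := Real.Gamma_pos_of_pos h.eps_pos
  have h1ε : 0 < 1 + ε := by linarith [h.eps_pos]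
  refine ⟨T, hT, ‖K‖ₑ ^ q * ‖(Real.Gamma ε)⁻¹‖ₑ ^ q, by finiteness, fun x => ?_⟩
  set z := fracEmb hS' hE' h.eps_pos (Dom.val A.adjoint x) with hz
  -- The extension K is prescribed only on D((A^*)^{1+ε}). For x in D(A^*), x = (-A^*)^{-1}(-A^* x),
  -- so the law of exponents places (-A^*)^{-ε} x there.
  obtain ⟨y, hy⟩ : ∃ y, Dom.val _ (fracEmb hS' hE' h1ε y) = Dom.val _ z := by
    have h1 := adjoint_powInt_one_of_mem_graph h.semigroup h.stable h.generator x.2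
    rw [adjoint_powInt] at h1
    have h2 := powInt_powInt hS' hE' h.eps_pos one_pos (-(x : Y × Y).2)
    rw [map_neg (powInt hS' hE' one_pos), h1, neg_neg] at h2
    have h3 : ∀ v, powInt hS' hE' (add_pos h.eps_pos one_pos) v = powInt hS' hE' h1ε v := by
      intro v
      rw [powInt_apply, powInt_apply, add_comm ε]
    rw [h3] at h2
    have hΓ' := Real.Gamma_pos_of_pos h1ε
    refine ⟨Real.Gamma (1 + ε) • (Real.Gamma ε)⁻¹ • ProbabilityTheory.beta ε 1 •
      (-(x : Y × Y).2), ?_⟩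
    rw [hz, val_fracEmb, val_fracEmb]
    simp only [ContinuousLinearMap.map_smul_of_tower]
    rw [inv_smul_smul₀ hΓ'.ne', ← h2]
    rfl
  have h4 := hK (fracEmb hS' hE' h1ε y) z hy.symm
  have h5 := lintegral_rpow_enorm_le_of_ae_eq hq0 K h4
  rw [hy, hz, val_fracEmb, enorm_smul, ENNReal.mul_rpow_of_nonneg _ _ hq0.le, ← mul_assoc] at h5
  rw [adjoint_powInt]
  refine le_of_eq_of_le ?_ h5
  refine setLIntegral_congr_fun measurableSet_Ioo fun τ hτ => ?_
  simp only [op_fracEmb, obs_eq_obsCLM h.semigroup h.stable h.generator B hτ.1.le]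

/-- The bound of `B^* e^{A^* t}` in terms of a negative power is exponentially integrable. -/
lemma Assumptions.exists_lintegral_Ioi_powInt_le {r : ℝ} (hr : 1 ≤ r) (hrq : r ≤ q) :
    ∃ c : ℝ, 0 < c ∧ ∃ C : ℝ≥0∞, C ≠ ∞ ∧ ∀ x,
      ∫⁻ τ in Ioi (0 : ℝ), (‖obsCLM h.semigroup h.stable h.generator B τ x‖ₑ *
        ENNReal.ofReal (Real.exp (c * τ))) ^ r ≤
          C * ‖pivot (fracPow S ε) (Dom.val A.adjoint x)‖ₑ ^ r := by
  have hr0 : 0 < r := by linarith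
  have hq0 : 0 < q := by linarith
  obtain ⟨T, hT, C, hC, hb⟩ := h.exists_lintegral_obs_le_powInt
  set k := obsCLM h.semigroup h.stable h.generator B with hk
  set P : Y →L[ℂ] Y := ContinuousLinearMap.adjoint (powInt h.semigroup h.stable h.eps_pos) with hP
  set d : ℝ := T / 2 with hd
  have hd0 : 0 < d := by positivity
  have hcont : ∀ x, Continuous fun t => k t x :=
    continuous_obsCLM h.semigroup h.stable h.generator B
  have hper : ∀ x, ∫⁻ τ in Ioc 0 (0 + d), ‖k τ x‖ₑ ^ r ≤
      (C ^ (r / q) * ENNReal.ofReal d ^ (1 - r / q)) * ‖P (Dom.val A.adjoint x)‖ₑ ^ r := by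
    intro x
    have h1 : 0 ≤ 1 - r / q := by rw [sub_nonneg, div_le_one hq0]; exact hrq
    have hm : Measurable fun τ => ‖k τ x‖ₑ ^ q := (hcont x).enorm.measurable.pow_const q
    -- Hölder against the constant 1 on the bounded window lowers the exponent from q to r.
    have h2 := ENNReal.lintegral_mul_norm_pow_le (μ := volume.restrict (Ioc 0 (0 + d)))
      hm.aemeasurable (g := fun _ => 1) aemeasurable_const (p := r / q) (q := 1 - r / q)
      (by positivity) h1 (by ring)
    have e1 : ∀ τ, (‖k τ x‖ₑ ^ q) ^ (r / q) * (1 : ℝ≥0∞) ^ (1 - r / q) = ‖k τ x‖ₑ ^ r := by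
      intro τ
      rw [← ENNReal.rpow_mul, mul_div_cancel₀ _ hq0.ne', ENNReal.one_rpow, mul_one]
    simp only [e1] at h2
    refine h2.trans ?_
    have h3 : ∫⁻ τ in Ioc 0 (0 + d), ‖k τ x‖ₑ ^ q ≤ C * ‖P (Dom.val A.adjoint x)‖ₑ ^ q := by
      refine le_trans (lintegral_mono_set fun τ hτ => ?_) (hb x)
      exact ⟨hτ.1, hτ.2.trans_lt (by rw [hd]; linarith)⟩
    calc _ ≤ (C * ‖P (Dom.val A.adjoint x)‖ₑ ^ q) ^ (r / q) *
          ENNReal.ofReal d ^ (1 - r / q) := by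
          gcongr
          simp
      _ = _ := by
          rw [ENNReal.mul_rpow_of_nonneg _ _ (by positivity), ← ENNReal.rpow_mul,
            mul_div_cancel₀ _ hq0.ne']
          ring
  have hcomm : ∀ t, 0 ≤ t → ∀ y, P (adjSemigroup S t y) = adjSemigroup S t (P y) := by
    intro t ht y
    rw [hP, adjoint_powInt]
    exact (semigroup_powInt _ _ h.eps_pos ht y).symm
  have hC' : C ^ (r / q) * ENNReal.ofReal d ^ (1 - r / q) ≠ ∞ := by
    have h1 : 0 ≤ 1 - r / q := by rw [sub_nonneg, div_le_one hq0]; exact hrq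
    finiteness
  obtain ⟨c, hc, C₂, hC₂, h₂⟩ := exists_lintegral_Ioi_obs_le h.semigroup h.stable h.generator B
    hcomm hr0 le_rfl hd0 hC' hper
  obtain ⟨D, hD, hPD⟩ := exists_norm_adjoint_powInt_le h.semigroup h.stable h.eps_pos
  refine ⟨c, hc, C₂ * ENNReal.ofReal D ^ r, by finiteness, fun x => (h₂ x).trans ?_⟩
  rw [mul_assoc, ← ENNReal.mul_rpow_of_nonneg _ _ hr0.le]
  gcongr
  rw [← ofReal_norm, ← ofReal_norm, ← ENNReal.ofReal_mul hD]
  exact ENNReal.ofReal_le_ofReal (hPD _)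

omit h in
lemma injective_pivot_fracPow (hS : IsC0Semigroup S) (hE : IsExpStable S) {a : ℝ} (ha : 0 < a)
    {y : Y} (hy : pivot (fracPow S a) y = 0) : y = 0 := by
  obtain ⟨D, hD, hPD⟩ := exists_norm_adjoint_powInt_le hS hE ha
  have h1 := hPD y
  rw [hy, norm_zero, mul_zero, norm_le_zero_iff, adjoint_powInt] at h1
  exact (injective_iff_map_eq_zero _).1 (powInt_injective _ _ ha) _ h1

lemma Assumptions.lStarMaps_pivot [TopologicalSpace.SeparableSpace Y] {r : ℝ} (hr : 1 ≤ r)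
    (hrq : r ≤ q) :
    LStarMaps A S B ((pivot (fracPow S ε)).comp (Dom.val A.adjoint)) (ENNReal.ofReal 1)
      (ENNReal.ofReal r) := by
  have := UniformSpace.secondCountable_of_separable Y
  have hr0 : 0 < r := by linarith
  obtain ⟨c, hc, C, hC, hb⟩ := h.exists_lintegral_Ioi_powInt_le hr hrq
  have hd : DenseRange ((pivot (fracPow S ε)).comp (Dom.val A.adjoint)) :=
    denseRange_pivot_comp h.semigroup h.stable h.eps_pos
      (denseRange_val_adjoint h.semigroup h.stable h.generator)
  have hJ0 : ∀ x, (pivot (fracPow S ε)).comp (Dom.val A.adjoint) x = 0 → x = 0 := fun x hx =>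
    Dom.ext ((injective_pivot_fracPow h.semigroup h.stable h.eps_pos hx).trans (map_zero _).symm)
  have hb1 : ∀ x, ∫⁻ τ in Ioi (0 : ℝ), (‖obsCLM h.semigroup h.stable h.generator B τ x‖ₑ *
        ENNReal.ofReal (Real.exp (c * τ))) ^ r ≤
          C * ‖(pivot (fracPow S ε)).comp (Dom.val A.adjoint) x‖ₑ ^ r := hb
  generalize (pivot (fracPow S ε)).comp (Dom.val A.adjoint) = J at hd hJ0 hb1 ⊢
  obtain ⟨C', hC', hb'⟩ := exists_lintegral_conv_le
    (k := obsCLM h.semigroup h.stable h.generator B) (J := J) (γ := 0) (η := 1) (p := 1) (r := r)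
    (c := c) (N := 0) (C := C)
    (fun x => (continuous_obsCLM h.semigroup h.stable h.generator B x).stronglyMeasurable)
    hJ0 le_rfl hr hc
    (exists_young_ker (γ := 0) (c := 1) le_rfl hr (by simp [hr0]) one_pos) ENNReal.zero_ne_top
    hC (fun x => by
      simp only [zero_mul, tsub_zero]
      exact hb1 x)
  exact lStarMaps_of_lintegral h.semigroup h.stable h.generator B hd le_rfl hr hC' hb'

end Estimates

/-! ## The observation operators on `D((A^*)^ε)` -/

section FracObservation

/-- The condition p > 1/(1-γ) says that τ^{-γ} is locally in the conjugate Lebesgue space, so this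
is Hölder; for p = ∞ integrability of the kernel is enough. -/
lemma exists_lintegral_mul_ker_le_eLpNorm {p : ℝ≥0∞} {γ c β : ℝ} (hγ0 : 0 ≤ γ) (hγ1 : γ < 1)
    (hp : ENNReal.ofReal (1 / (1 - γ)) < p) (hc : 0 < c) (hβ : β ≤ γ) :
    ∃ C : ℝ≥0∞, C ≠ ∞ ∧ ∀ s : ℝ, ∀ b : ℝ → ℝ≥0∞, Measurable b →
      ∫⁻ t, b t * ker β c (t - s) ≤ C * eLpNorm b p volume := by
  have hγ' : 0 < 1 - γ := by linarith
  have h1γ : 1 ≤ 1 / (1 - γ) := by rw [one_le_div hγ']; linarith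
  rcases eq_or_ne p ∞ with rfl | hp'
  · refine ⟨∫⁻ τ, ker β c τ, lintegral_ker_ne_top (by linarith) hc, fun s b hb => ?_⟩
    have hm : Measurable fun t => ker β c (t - s) :=
      (measurable_ker β c).comp (measurable_id.sub_const s)
    rw [eLpNorm_exponent_top, ← lintegral_sub_right_eq_self (ker β c) s, ← lintegral_mul_const _ hm]
    refine lintegral_mono_ae ?_
    filter_upwards [ae_le_eLpNormEssSup (f := b) (μ := volume)] with t ht
    rw [mul_comm]
    gcongr
    exact ht
  · obtain ⟨p', hp'0, rfl⟩ : ∃ p' : ℝ, 0 ≤ p' ∧ p = ENNReal.ofReal p' :=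
      ⟨p.toReal, ENNReal.toReal_nonneg, (ENNReal.ofReal_toReal hp').symm⟩
    rw [ENNReal.ofReal_lt_ofReal_iff_of_nonneg (by positivity)] at hp
    have h1p : 1 < p' := by linarith
    have hlt : γ < 1 - 1 / p' := by
      have : 1 / p' < 1 - γ := by
        rw [div_lt_iff₀ (by linarith)]
        rwa [div_lt_iff₀ hγ', mul_comm] at hp
      linarith
    obtain ⟨C, hC, H⟩ := exists_lintegral_mul_ker_le (p := p') (β := β) (c := c) h1p.le hc
      (Or.inr ⟨h1p, by linarith⟩)
    refine ⟨C, hC, fun s b hb => ?_⟩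
    rw [eLpNorm_ofReal_eq (by linarith)]
    simpa only [enorm_eq_self] using H s b hb

/-- A kernel dominated by `ker γ c + ker 0 c` maps `L^p` to `L^∞` for large `p`. -/
lemma exists_clm_isBackwardConv_top {X U : Type*} [NormedAddCommGroup X] [NormedSpace ℂ X]
    [SecondCountableTopology X] [NormedAddCommGroup U] [InnerProductSpace ℂ U]
    {k : ℝ → X →L[ℂ] U} (hk : ∀ x, StronglyMeasurable fun t => k t x)
    {p : ℝ≥0∞} [Fact (1 ≤ p)] {γ c : ℝ} (hγ0 : 0 ≤ γ) (hγ1 : γ < 1)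
    (hp : ENNReal.ofReal (1 / (1 - γ)) < p) (hc : 0 < c) {N : ℝ≥0∞} (hN : N ≠ ∞)
    (hb : ∀ t, 0 < t → ∀ x, ‖k t x‖ₑ ≤ N * ((ker γ c t + ker 0 c t) * ‖x‖ₑ)) :
    ∃ Λ : Lp X p halfLine →L[ℂ] Lp U ∞ halfLine,
      ∀ v : Lp X p halfLine, IsBackwardConv (fun t x => k t x) v (Λ v) := by
  obtain ⟨C₁, hC₁, h₁⟩ := exists_lintegral_mul_ker_le_eLpNorm hγ0 hγ1 hp hc le_rfl
  obtain ⟨C₂, hC₂, h₂⟩ := exists_lintegral_mul_ker_le_eLpNorm hγ0 hγ1 hp hc hγ0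
  have hC : N * (C₁ + C₂) ≠ ∞ := by finiteness
  obtain ⟨Λ, h1, h2⟩ := exists_linearMap_isBackwardConv hk (ContinuousLinearMap.id ℂ X)
    (p := p) (r := ∞) (by simp) hC fun f hf => by
      rw [eLpNorm_exponent_top]
      refine eLpNormEssSup_le_of_ae_enorm_bound ?_
      filter_upwards [ae_restrict_mem measurableSet_Ioi] with s hs
      have hs : 0 < s := hs
      set b : ℝ → ℝ≥0∞ := (Ioi (0 : ℝ)).indicator fun t => ‖f t‖ₑ with hbdef
      have hbm : Measurable b := hf.enorm.indicator measurableSet_Ioi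
      have hbn : eLpNorm b p volume = eLpNorm f p halfLine := by
        rw [halfLine, ← eLpNorm_indicator_eq_eLpNorm_restrict measurableSet_Ioi]
        refine eLpNorm_congr_enorm_ae (Eventually.of_forall fun t => ?_)
        rw [enorm_eq_self, hbdef, enorm_indicator_eq_indicator_enorm]
      have hm1 : ∀ β, Measurable fun t => ker β c (t - s) := fun β =>
        (measurable_ker β c).comp (measurable_id.sub_const s)
      have hm2 := hm1 γ
      have hm3 := hm1 0
      rw [enorm_eq_self]
      calc _ ≤ ∫⁻ t in Ioi s, N * (b t * ker γ c (t - s) + b t * ker 0 c (t - s)) := by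
            refine setLIntegral_mono' measurableSet_Ioi fun t ht => ?_
            refine (hb _ (sub_pos.2 ht) _).trans (le_of_eq ?_)
            rw [hbdef, indicator_of_mem (mem_Ioi.2 (hs.trans ht))]
            ring
        _ ≤ ∫⁻ t, N * (b t * ker γ c (t - s) + b t * ker 0 c (t - s)) :=
            setLIntegral_le_lintegral _ _
        _ = N * ((∫⁻ t, b t * ker γ c (t - s)) + ∫⁻ t, b t * ker 0 c (t - s)) := by
            rw [lintegral_const_mul _ (by fun_prop), lintegral_add_left (by fun_prop)]
        _ ≤ N * (C₁ * eLpNorm b p volume + C₂ * eLpNorm b p volume) := by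
            gcongr
            · exact h₁ s b hbm
            · exact h₂ s b hbm
        _ = N * (C₁ + C₂) * eLpNorm f p halfLine := by rw [hbn]; ring
  refine ⟨Λ.mkContinuous (N * (C₁ + C₂)).toReal fun v => ?_, h1⟩
  refine (h2 v).trans ?_
  gcongr
  refine (ContinuousLinearMap.norm_compLp_le _ _).trans ?_
  exact mul_le_of_le_one_left (norm_nonneg _) ContinuousLinearMap.norm_id_le

variable {Y U : Type*} [NormedAddCommGroup Y] [InnerProductSpace ℂ Y] [CompleteSpace Y]
  [NormedAddCommGroup U] [InnerProductSpace ℂ U] [CompleteSpace U]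
  {A : Y →ₗ.[ℂ] Y} {S : ℝ → Y →L[ℂ] Y}

lemma semigroup_mem_graph_fracPow (hS : IsC0Semigroup S) (hE : IsExpStable S) {a : ℝ} (ha : 0 < a)
    {t : ℝ} (ht : 0 ≤ t) (z : Y × Y) (hz : z ∈ (fracPow S a).graph) :
    (S t z.1, S t z.2) ∈ (fracPow S a).graph := by
  rw [mem_graph_fracPow hS hE ha] at hz ⊢
  rw [hz, (S t).map_smul_of_tower, semigroup_powInt hS hE ha ht]

variable {B : U →L[ℂ] AntiDual (Dom A.adjoint)} {F : ℝ → Y →L[ℂ] U}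
  {G : ℝ → Dom A.adjoint →L[ℂ] U} {γ ε q : ℝ} (h : Assumptions A S B F G γ ε q)

include h

/-- The bounded extensions of `B^* e^{A^* t}` to `D((A^*)^ε)`. -/
lemma Assumptions.exists_fracObs : ∃ K : ℝ → Dom (fracPow (adjSemigroup S) ε) →L[ℂ] U,
    (∀ t, t ≤ 0 → K t = 0) ∧
    (∀ t, 0 < t → ∀ x : Dom A.adjoint, ∀ z : Dom (fracPow (adjSemigroup S) ε),
      Dom.val _ x = Dom.val _ z →
        K t z = obsCLM h.semigroup h.stable h.generator B t x) ∧
    ∃ c : ℝ, 0 < c ∧ ∃ N : ℝ≥0∞, N ≠ ∞ ∧ ∀ t, 0 < t → ∀ z,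
      ‖K t z‖ₑ ≤ N * ((ker γ c t + ker 0 c t) * ‖z‖ₑ) := by
  have hS' := isC0Semigroup_adjSemigroup h.semigroup h.stable
  have hE' := isExpStable_adjSemigroup h.stable
  obtain ⟨η, N, hη, hN, hF⟩ := h.F_bound
  obtain ⟨T, hT, ⟨H, hH⟩, -⟩ := h.eps_cond
  obtain ⟨M, ω, hM1, hω, hM⟩ := id hE'
  set C := fracPow (adjSemigroup S) ε with hC
  -- This is the extension up to time T: H acts on (A^*)^ε z in place of G on z. The projection onto
  -- [0, T] only makes the formula total.
  let base : ℝ → Dom C →L[ℂ] U := fun t => (F t).comp (Dom.val C) +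
    (ContinuousMap.evalCLM ℂ (projIcc 0 T hT.le t)).comp (H.comp (Dom.op C))
  let fm : ℝ → Dom C →L[ℂ] Dom C := fun t => Dom.map (adjSemigroup S (max (t - T) 0))
    (semigroup_mem_graph_fracPow hS' hE' h.eps_pos (le_max_right (t - T) 0))
  -- Times beyond T split as T + (t - T), with the semigroup on D((A^*)^ε) covering the second
  -- piece; no bound on G after T is needed.
  let K : ℝ → Dom C →L[ℂ] U := fun t => if 0 < t then (base (min t T)).comp (fm t) else 0
  have hK : ∀ t, 0 < t → ∀ z, K t z = base (min t T) (fm t z) := fun t ht z => by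
    simp only [K, if_pos ht, ContinuousLinearMap.comp_apply]
  have hbase : ∀ t z, base t z = F t (Dom.val C z) + H (Dom.op C z) (projIcc 0 T hT.le t) :=
    fun t z => rfl
  -- With m = min(t, T), the factor T^γ absorbs the bounded H part into m^{-γ}, e^{ωT} replaces
  -- decay in t - m by decay in t, and 1 + T^{-γ} bounds m^{-γ} by a multiple of t^{-γ} + 1.
  refine ⟨K, fun t ht => if_neg ht.not_gt, fun t ht x z hxz => ?_, ω, hω,
    ENNReal.ofReal ((N + ‖H‖ * T ^ γ) * M * Real.exp (ω * T) * (1 + T ^ (-γ))), by simp,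
    fun t ht z => ?_⟩
  · have hm : 0 < min t T := lt_min ht hT
    have hσ : 0 ≤ max (t - T) 0 := le_max_right _ _
    have hsum : min t T + max (t - T) 0 = t := by
      rcases le_total t T with h1 | h1
      · rw [min_eq_left h1, max_eq_right (by linarith)]; ring
      · rw [min_eq_right h1, max_eq_left (by linarith)]; ring
    set x' := adjMap h.semigroup h.stable h.generator (max (t - T) 0) x with hx'
    have hval : Dom.val A.adjoint x' = Dom.val C (fm t z) := by
      rw [hx', val_adjMap _ _ _ hσ, hxz]
      rfl
    have h1 := hH ⟨min t T, hm.le, min_le_right _ _⟩ hm (fm t z) x' hval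
    have h2 : projIcc 0 T hT.le (min t T) = ⟨min t T, hm.le, min_le_right _ _⟩ :=
      projIcc_of_mem _ ⟨hm.le, min_le_right _ _⟩
    rw [hK t ht, hbase, h2, h1, ← hval, ← h.decomposition _ hm x',
      obs_eq_obsCLM h.semigroup h.stable h.generator B hm.le, hx', ← obsCLM_add _ _ _ _ hm.le hσ,
      hsum]
  · have hm : 0 < min t T := lt_min ht hT
    set m := min t T with hmdef
    set σ := max (t - T) 0 with hσdef
    have hσ : 0 ≤ σ := le_max_right _ _
    have hγ0 : 0 < γ := h.gamma_mem.1
    have h1 : ‖fm t z‖ ≤ M * Real.exp (-(ω * σ)) * ‖z‖ := Dom.norm_map_le _ (hM σ hσ) z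
    have h2 : ‖base m (fm t z)‖ ≤ (N + ‖H‖ * T ^ γ) * m ^ (-γ) * ‖fm t z‖ := by
      rw [hbase]
      have h3 : ‖F m (Dom.val C (fm t z))‖ ≤ N * m ^ (-γ) * ‖fm t z‖ := by
        refine (F m).le_of_opNorm_le_of_le ((hF m hm).trans ?_) ?_
        · refine mul_le_of_le_one_right (by positivity) ?_
          rw [Real.exp_le_one_iff, Left.neg_nonpos_iff]; positivity
        · rw [Dom.norm_eq]; exact le_max_left _ _
      have h4 : ‖H (Dom.op C (fm t z)) (projIcc 0 T hT.le m)‖ ≤ ‖H‖ * ‖fm t z‖ := by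
        refine (ContinuousMap.norm_coe_le_norm _ _).trans (H.le_opNorm_of_le ?_)
        rw [Dom.norm_eq]; exact le_max_right _ _
      have h5 : 1 ≤ T ^ γ * m ^ (-γ) := by
        rw [Real.rpow_neg hm.le, ← div_eq_mul_inv, one_le_div (by positivity)]
        exact Real.rpow_le_rpow hm.le (min_le_right _ _) hγ0.le
      calc _ ≤ N * m ^ (-γ) * ‖fm t z‖ + ‖H‖ * ‖fm t z‖ := (norm_add_le _ _).trans (add_le_add h3 h4)
        _ ≤ N * m ^ (-γ) * ‖fm t z‖ + ‖H‖ * ‖fm t z‖ * (T ^ γ * m ^ (-γ)) := by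
          exact add_le_add le_rfl (le_mul_of_one_le_right (by positivity) h5)
        _ = _ := by ring
    have h6 : m ^ (-γ) * Real.exp (-(ω * σ)) ≤ Real.exp (ω * T) * (1 + T ^ (-γ)) *
        (t ^ (-γ) * Real.exp (-(ω * t)) + Real.exp (-(ω * t))) := by
      have e1 : Real.exp (-(ω * t)) = Real.exp (-(ω * m)) * Real.exp (-(ω * σ)) := by
        rw [← Real.exp_add]
        have : m + σ = t := by
          rcases le_total t T with h1 | h1
          · rw [hmdef, hσdef, min_eq_left h1, max_eq_right (by linarith)]; ring
          · rw [hmdef, hσdef, min_eq_right h1, max_eq_left (by linarith)]; ring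
        rw [← this]; ring_nf
      have e2 : m ^ (-γ) ≤ (1 + T ^ (-γ)) * (t ^ (-γ) + 1) := by
        have p1 : 0 < T ^ (-γ) := by positivity
        have p2 : 0 < t ^ (-γ) := by positivity
        rcases le_total t T with h1 | h1
        · rw [hmdef, min_eq_left h1]; nlinarith
        · rw [hmdef, min_eq_right h1]; nlinarith
      have e3 : 1 ≤ Real.exp (ω * T) * Real.exp (-(ω * m)) := by
        rw [← Real.exp_add, Real.one_le_exp_iff]
        have : m ≤ T := min_le_right _ _
        nlinarith
      calc _ ≤ ((1 + T ^ (-γ)) * (t ^ (-γ) + 1)) * Real.exp (-(ω * σ)) := by gcongr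
        _ ≤ ((1 + T ^ (-γ)) * (t ^ (-γ) + 1)) * Real.exp (-(ω * σ)) *
            (Real.exp (ω * T) * Real.exp (-(ω * m))) := le_mul_of_one_le_right (by positivity) e3
        _ = _ := by rw [e1]; ring
    rw [hK t ht, ker_of_pos _ _ ht, ker_of_pos _ _ ht, neg_zero, Real.rpow_zero, one_mul,
      ← ENNReal.ofReal_add (by positivity) (by positivity), ← ofReal_norm, ← ofReal_norm,
      ← ENNReal.ofReal_mul (by positivity), ← ENNReal.ofReal_mul (by positivity)]
    refine ENNReal.ofReal_le_ofReal ?_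
    calc _ ≤ (N + ‖H‖ * T ^ γ) * m ^ (-γ) * (M * Real.exp (-(ω * σ)) * ‖z‖) :=
          h2.trans (by gcongr)
      _ = (N + ‖H‖ * T ^ γ) * M * ‖z‖ * (m ^ (-γ) * Real.exp (-(ω * σ))) := by ring
      _ ≤ (N + ‖H‖ * T ^ γ) * M * ‖z‖ * (Real.exp (ω * T) * (1 + T ^ (-γ)) *
        (t ^ (-γ) * Real.exp (-(ω * t)) + Real.exp (-(ω * t)))) := by gcongr
      _ = _ := by ring

/-- Extensions of `B^* e^{A^* t}` to `D((A^*)^ε)` are strongly measurable in `t`. -/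
lemma Assumptions.stronglyMeasurable_fracObs {K : ℝ → Dom (fracPow (adjSemigroup S) ε) →L[ℂ] U}
    (hK0 : ∀ t, t ≤ 0 → K t = 0)
    (hK : ∀ t, 0 < t → ∀ x : Dom A.adjoint, ∀ z : Dom (fracPow (adjSemigroup S) ε),
      Dom.val _ x = Dom.val _ z → K t z = obsCLM h.semigroup h.stable h.generator B t x)
    (z : Dom (fracPow (adjSemigroup S) ε)) : StronglyMeasurable fun t => K t z := by
  have hS' := isC0Semigroup_adjSemigroup h.semigroup h.stable
  have hE' := isExpStable_adjSemigroup h.stable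
  have hd := denseRange_val_adjoint h.semigroup h.stable h.generator
  obtain ⟨y, hy, hlim⟩ := mem_closure_iff_seq_limit.1 (hd (Dom.op _ z))
  choose x hx using hy
  have hPmem := fun z hz => adjoint_map_mem_graph (z := z) h.semigroup h.stable h.generator
    (fun t ht y => (semigroup_powInt h.semigroup h.stable h.eps_pos ht y).symm) hz
  -- These are (-A^*)^{-ε} x_n, with x_n in D(A^*) tending to (A^*)^ε z in Y. They lie in D(A^*) and
  -- converge to z in graph norm, so K(t)z is a pointwise limit of measurable functions.
  set x' : ℕ → Dom A.adjoint := fun n => (Real.Gamma ε)⁻¹ • Dom.map _ hPmem (x n) with hx'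
  have hval : ∀ n, Dom.val A.adjoint (x' n) =
      Dom.val _ (fracEmb hS' hE' h.eps_pos (y n)) := by
    intro n
    rw [hx', ContinuousLinearMap.map_smul_of_tower, Dom.val_map, val_fracEmb, adjoint_powInt, hx]
  have hlim' : Tendsto (fun n => fracEmb hS' hE' h.eps_pos (y n)) atTop (𝓝 z) := by
    have := ((fracEmb hS' hE' h.eps_pos).continuous.tendsto _).comp hlim
    rwa [fracEmb_op] at this
  refine stronglyMeasurable_of_tendsto atTop
    (f := fun n => (Ioi (0 : ℝ)).indicator fun t =>
      obsCLM h.semigroup h.stable h.generator B t (x' n))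
    (fun n => (continuous_obsCLM h.semigroup h.stable h.generator B
      (x' n)).stronglyMeasurable.indicator measurableSet_Ioi) ?_
  rw [tendsto_pi_nhds]
  intro t
  by_cases ht : 0 < t
  · refine (((K t).continuous.tendsto z).comp hlim').congr fun n => ?_
    rw [indicator_of_mem (mem_Ioi.2 ht), Function.comp_apply]
    exact hK t ht _ _ (hval n)
  · simp [ht, hK0 t (not_lt.1 ht)]

end FracObservation

end

end BoundaryControl

/-! ### Assembly of the five mapping properties -/

theorem proposition2p7 {Y U : Type*}
    [NormedAddCommGroup Y] [InnerProductSpace ℂ Y] [CompleteSpace Y]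
    [TopologicalSpace.SeparableSpace Y]
    [NormedAddCommGroup U] [InnerProductSpace ℂ U] [CompleteSpace U]
    [TopologicalSpace.SeparableSpace U]
    (A : Y →ₗ.[ℂ] Y) (S : ℝ → Y →L[ℂ] Y)
    (B : U →L[ℂ] AntiDual (Dom A.adjoint))
    (F : ℝ → Y →L[ℂ] U) (G : ℝ → Dom A.adjoint →L[ℂ] U) (γ ε q : ℝ)
    (h : Assumptions A S B F G γ ε q) :
    -- (i) `L^1(Y) → L^r(U)`
    (∀ r : ℝ, 1 ≤ r → r < 1 / γ →
      LStarMaps A S B (Dom.val A.adjoint) 1 (ENNReal.ofReal r)) ∧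
    -- (ii) `L^p(Y) → L^r(U)`, subcritical `p`
    (∀ p r : ℝ, 1 < p → p < 1 / (1 - γ) → p ≤ r → r ≤ p / (1 - (1 - γ) * p) →
      LStarMaps A S B (Dom.val A.adjoint)
        (ENNReal.ofReal p) (ENNReal.ofReal r)) ∧
    -- (iii) `L^p(Y) → L^r(U)`, critical and supercritical finite `p`
    (∀ p r : ℝ, 1 / (1 - γ) ≤ p → p ≤ r →
      LStarMaps A S B (Dom.val A.adjoint)
        (ENNReal.ofReal p) (ENNReal.ofReal r)) ∧
    -- (iv) `L^p(D((A^*)^ε)) → L^∞(U)`; each `B^* e^{A^* t}`, `t > 0`, has a bounded extension `K t`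
    -- to `D((A^*)^ε)`, and `L^*` is given by the integral with this kernel
    (∃ K : ℝ → Dom (fracPow (adjSemigroup S) ε)
        →L[ℂ] U,
      (∀ t : ℝ, 0 < t → ∀ x : Dom A.adjoint,
        ∀ z : Dom (fracPow (adjSemigroup S) ε),
          Dom.val _ x = Dom.val _ z →
          K t z = obs A S B t (Dom.val _ x)) ∧
      ∀ p : ℝ≥0∞, ENNReal.ofReal (1 / (1 - γ)) < p → ∃ _ : Fact (1 ≤ p),
        ∃ Λ : Lp (Dom
              (fracPow (adjSemigroup S) ε)) p
              halfLine →L[ℂ] Lp U ∞ halfLine,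
          ∀ v : Lp (Dom (fracPow (adjSemigroup S) ε)) p halfLine,
            IsBackwardConv (fun t z => K t z) v (Λ v)) ∧
    -- (v) `L^1([D(A^ε)]') → L^r(U)`
    (∀ r : ℝ, 1 ≤ r → r ≤ q →
      LStarMaps A S B
        ((pivot (fracPow S ε)).comp
          (Dom.val A.adjoint)) 1 (ENNReal.ofReal r)) := by
  have hγ0 : 0 < γ := h.gamma_mem.1
  have hγ1 : 0 < 1 - γ := by linarith [h.gamma_mem.2]
  have h1γ : 1 ≤ 1 / (1 - γ) := by rw [one_le_div hγ1]; linarith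
  refine ⟨fun r hr hrγ => ?_, fun p r hp hpγ hpr hr => ?_, fun p r hp hpr => ?_, ?_,
    fun r hr hrq => ?_⟩
  · have := h.lStarMaps_val le_rfl hr fun η hη => exists_young_ker le_rfl hr
      (by rw [div_one, sub_self, add_zero]
          exact (lt_div_comm₀ (by linarith) hγ0).1 hrγ) hη
    rwa [ENNReal.ofReal_one] at this
  · refine h.lStarMaps_val hp.le hpr fun η hη => ?_
    have hp0 : 0 < p := by linarith
    have hr0 : 0 < r := by linarith
    have hd : 0 < 1 - (1 - γ) * p := by
      rw [lt_div_iff₀ hγ1, mul_comm] at hpγ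
      linarith
    have e : 1 / (p / (1 - (1 - γ) * p)) = 1 / p - (1 - γ) := by
      field_simp
    -- Below the endpoint, γ < 1/r + 1 - 1/p holds strictly and Young applies. At the endpoint it is
    -- an equality, so the exponential is discarded and Hardy-Littlewood-Sobolev is used.
    rcases hr.lt_or_eq with hlt | rfl
    · refine exists_young_ker hp.le hpr ?_ hη
      have := one_div_lt_one_div_of_lt hr0 hlt
      linarith
    · obtain ⟨C, hC, H⟩ := exists_hardy_littlewood_sobolev hγ0 h.gamma_mem.2 hp hpγ
      refine ⟨C, hC, fun a ha => le_trans ?_ (H a ha)⟩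
      gcongr
      exact ker_mono hη.le _
  · have hp1 : 1 ≤ p := h1γ.trans hp
    refine h.lStarMaps_val hp1 hpr fun η hη => exists_young_ker hp1 hpr ?_ hη
    -- Here γ ≤ 1 - 1/p already, and finiteness of r supplies the strict inequality through 1/r > 0,
    -- also at the critical p.
    have h2 : 1 / p ≤ 1 - γ := by
      rw [div_le_iff₀ (by linarith)]
      rwa [div_le_iff₀ hγ1, mul_comm] at hp
    have h3 : 0 < 1 / r := one_div_pos.2 (by linarith)
    linarith
  · obtain ⟨K, hK0, hK, c, hc, N, hN, hb⟩ := h.exists_fracObs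
    refine ⟨K, fun t ht x z hxz => ?_, fun p hp => ?_⟩
    · rw [hK t ht x z hxz, obs_eq_obsCLM h.semigroup h.stable h.generator B ht.le]
    · have hp1 : Fact (1 ≤ p) :=
        ⟨(ENNReal.one_le_ofReal.2 h1γ).trans hp.le⟩
      have := UniformSpace.secondCountable_of_separable Y
      exact ⟨hp1, exists_clm_isBackwardConv_top (h.stronglyMeasurable_fracObs hK0 hK) hγ0.le
        h.gamma_mem.2 hp hc hN hb⟩
  · have := h.lStarMaps_pivot hr hrq
    rwa [ENNReal.ofReal_one] at this
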